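/- Let $g\ge 0$, $X=\{x_1,\dots,x_n\}$ with $n>0$ and $2g-2+n>0$. Let $m_*=(m_0,m_1,\dots)$ be nonnegative integers with $\sum_i(2i+1)m_i=4g-4+2n$, and put $r=\sum_i i\,m_i$, $d=3g-3+n-r$. **Ribbon graphs.** A ribbon graph $(E,\sigma_0,\sigma_1)$ is a finite set $E$ of oriented edges, a permutation $\sigma_0$ and a fixed-point-free involution $\sigma_1$; put $\sigma_\infty=\sigma_1\sigma_0^{-1}$. Vertices, edges and holes are the orbits of $\sigma_0,\sigma_1,\sigma_\infty$. An *enriched $X$-marked ribbon graph* $\mathbb G$ of genus $g$ is the combinatorial datum of a connected nodal surface of total genus $g$ whose visible components are the connected components of a ribbon graph; its nodes lie at vertices, each node joining two visible components (possibly equal) or a visible component to an invisible one (an invisible component has only a genus, its nodes, which join it to vertices, and its marked points, and is stable); every hole contains exactly one point of $X$; every other point of $X$ lies at a vertex or on an invisible component; a vertex carries at most one node or one point of $X$, and all vertices carrying neither are at least trivalent. Shrinking a nonempty proper subset $Z$ of the edges to length zero gives the contraction $\mathbb G/Z$: $\sigma_1$ is restricted and $\sigma_\infty$ replaced by its first-return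 map, and the components of the subsurface formed by vertices, nodes, invisible components and $Z$ become new vertices, nodes or invisible components, with the induced genus and marked points. **Cells.** Let $\overline{\mathcal M}^{comb}_{g,X}$ be the orbispace of metrized enriched $X$-marked ribbon graphs $(\mathbb G,\ell)$ of genus $g$, $\ell:E_1(\mathbb G)\to\mathbb R_{>0}$ (equivalently, of weighted arc systems on an $X$-marked surface of genus $g$ modulo the mapping class group). Let $p_i(\ell)$ be the sum of the lengths of the sides of the hole marked by $x_i$ ($0$ if $x_i$ marks no hole). For $\underline p\in\mathbb R_{\ge0}^X\setminus\{0\}$ let $\overline{\mathcal M}^{comb}_{g,X}(\underline p)$ be the locus where $(p_i)=\underline p$, and let $\overline{\mathcal M}^{comb}_{g,X}(\mathbb R_+^X)$ be the locus where all $p_i>0$. Each is a cell complex of orbispaces: its cells are the sets of metrics on a fixed $\mathbb G$ that lie in the locus, modulo $\mathrm{Aut}(\mathbb G)$, and the faces of the cell of $\mathbb G$ are cells of contractions of $\mathbb G$. A cellular $k$-chain assigns to each oriented $k$-cell a rational multiplicity, odd in the orientation and invariant under isomorphisms. The coefficient of $\partial c$ at a $(k-1)$-cell $\mathbb G'$ is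 the sum of the coefficients of $c$ over all $k$-cells in the star of $\mathbb G'$, i.e. over the isomorphism classes of contractions $\mathbb G\to\mathbb G'$ with $\mathbb G$ a $k$-cell, oriented by the outward-normal-first rule. **Witten subcomplexes.** $\overline{\mathcal M}^{comb}_{m_*,X}$ is the smallest subcomplex of $\overline{\mathcal M}^{comb}_{g,X}$ containing the cells of all nonsingular graphs (no nodes, invisible components or marked vertices) with exactly $m_i$ vertices of valence $2i+3$ for each $i$ and no others. Let $\overline{\mathcal M}^{comb}_{m_*,X}(\underline p)$ and $\overline{\mathcal M}^{comb}_{m_*,X}(\mathbb R_+^X)$ be its intersections with the loci above, regarded as cellular chains: the sums of all their cells of dimension $2d=6g-6+2n-2r$, resp. $2d+n$. Orient these cells by $\overline\Omega^{\,d}$, resp. $\overline\Omega^{\,d}\wedge dp_1\wedge\dots\wedge dp_n$, where $$\overline\Omega=\sum_i p_i^2\,\overline\eta_i=\frac14\sum_i\ \sum_{1\le s<t\le k_i-1}d\ell(e^i_s)\wedge d\ell(e^i_t),$$ the first sum running over the $i$ such that $x_i$ marks a hole, and $e^i_1,\dots,e^i_{k_i}$ being the cyclically ordered sides of the hole of $x_i$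 (modulo the $dp_i$ this does not depend on the choice of first sides). **Lemma (Kontsevich).** These top-degree forms vanish on none of these cells, so they do define orientations, and with these orientations 1. $\overline{\mathcal M}^{comb}_{m_*,X}(\underline p)$ is a cycle for every $\underline p\in\mathbb R_{\ge 0}^X\setminus\{0\}$; 2. $\overline{\mathcal M}^{comb}_{m_*,X}(\mathbb R_+^X)$ is a cycle with non-compact support. -/

import Mathlib

noncomputable section

open scoped Classical

namespace WittenCycle

/-! ## Ribbon graphs -/

/-- A ribbon graph `(E, σ₀, σ₁)`: `E` is the set of oriented edges, `σ₁` reverses the orientation,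
and `σ₀` is the cyclic order of the oriented edges going out of each vertex. -/
structure RibbonGraph (E : Type) where
  σ₀ : Equiv.Perm E
  σ₁ : Equiv.Perm E
  σ₁_invol : ∀ e, σ₁ (σ₁ e) = e
  σ₁_ne : ∀ e, σ₁ e ≠ e

namespace RibbonGraph

variable {E : Type} (G : RibbonGraph E)

/-- `σ∞ = σ₁ σ₀⁻¹`; its orbits are the holes. -/
def σinf : Equiv.Perm E := G.σ₁ * G.σ₀⁻¹

/-- Vertices are the orbits of `σ₀`. -/
abbrev Vertex : Type := Quotient (Equiv.Perm.SameCycle.setoid G.σ₀)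

/-- Unoriented edges are the orbits of `σ₁`. -/
abbrev Edge : Type := Quotient (Equiv.Perm.SameCycle.setoid G.σ₁)

/-- Holes are the orbits of `σ∞`. -/
abbrev Hole : Type := Quotient (Equiv.Perm.SameCycle.setoid G.σinf)

/-- The vertex out of which an oriented edge goes. -/
def vertexOf (e : E) : G.Vertex := Quotient.mk _ e

def edgeOf (e : E) : G.Edge := Quotient.mk _ e

/-- The hole bordered by an oriented edge. -/
def holeOf (e : E) : G.Hole := Quotient.mk _ e

def valence (v : G.Vertex) : ℕ := Nat.card {e : E // G.vertexOf e = v}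

/-- The number of sides of the hole bordered by `e` (an edge both of whose sides border the hole
is counted twice). -/
def sides (e : E) : ℕ := Nat.card {e' : E // G.holeOf e' = G.holeOf e}

end RibbonGraph

/-! ## Enriched ribbon graphs -/

/-- The data of a reduced enriched ribbon graph marked by `X = {x₀, …, x_{n-1}}`.

The visible components are the connected components of the ribbon graph.  The vertices of the
ribbon graph are grouped into `blocks` (equivalence classes of `block`), and each block carries a
genus and possibly markings.  The blocks are of the following kinds:
* one vertex, genus `0`, no marking: an ordinary vertex;
* one vertex, genus `0`, one marking: a vertex marked by a point of `X`;
* two vertices, genus `0`, no marking: a node joining two (possibly equal) visible components;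
* anything else: an invisible component (of the given genus, with the given invisible marked
  points), joined by nodes to the (special) vertices of the block.
The marking sends a point of `X` either to the hole or to the block where it lies. -/
structure EnrichedData (n : ℕ) (E : Type) extends RibbonGraph E where
  block : Setoid E
  block_of_vertex : ∀ a b : E, σ₀.SameCycle a b → block a b
  genus : Quotient block → ℕ
  mark : Fin n → toRibbonGraph.Hole ⊕ Quotient block

namespace EnrichedData

variable {n : ℕ} {E : Type} (G : EnrichedData n E)

abbrev Block : Type := Quotient G.block

/-- The block containing the vertex out of which an oriented edge goes. -/
def blockOf (e : E) : G.Block := Quotient.mk _ e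

/-- `x_i` marks the hole bordered by the oriented edge `e`. -/
def MarksHole (i : Fin n) (e : E) : Prop := G.mark i = Sum.inl (G.holeOf e)

/-- `x_i` lies on the block of the oriented edge `e`. -/
def MarksBlock (i : Fin n) (e : E) : Prop := G.mark i = Sum.inr (G.blockOf e)

/-- The Euler characteristic `2 - 2g - v` of a compact surface of the genus of the block with one
boundary circle for each vertex of the block. -/
def blockChi (c : G.Block) : ℤ :=
  2 - 2 * (G.genus c : ℤ) - (Nat.card {v : G.Vertex // ∃ e, G.vertexOf e = v ∧ G.blockOf e = c} : ℤ)

end EnrichedData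

/-- A reduced enriched ribbon graph of total genus `g`, marked by `n` points. -/
structure EnrichedRibbonGraph (g n : ℕ) (E : Type) extends EnrichedData n E where
  /-- Every hole contains exactly one marked point. -/
  hole_marked : ∀ h : toEnrichedData.Hole, ∃! i, mark i = Sum.inl h
  /-- Ordinary vertices are at least trivalent. -/
  trivalent : ∀ e : E, genus (toEnrichedData.blockOf e) = 0 →
    (∀ i, ¬ toEnrichedData.MarksBlock i e) →
    (∀ e', block e e' → σ₀.SameCycle e e') →
    3 ≤ toRibbonGraph.valence (toRibbonGraph.vertexOf e)
  /-- The total nodal surface is connected. -/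
  connected : ∀ a b : E, Relation.EqvGen (fun x y => block x y ∨ y = σ₁ x) a b
  /-- The total surface (with its nodes smoothed) has genus `g`.  It is obtained from the surfaces
  of the blocks by attaching one strip for each edge and one disc for each hole. -/
  total_genus : (2 : ℤ) - 2 * (g : ℤ) = (∑ᶠ c : toEnrichedData.Block, toEnrichedData.blockChi c)
    - (Nat.card toRibbonGraph.Edge : ℤ) + (Nat.card toRibbonGraph.Hole : ℤ)

section Morphisms

variable {g n : ℕ} {E E' : Type}

/-- An isomorphism of enriched ribbon graphs, as a bijection of oriented edges. -/
structure IsIso (G : EnrichedRibbonGraph g n E) (G' : EnrichedRibbonGraph g n E') (h : E' ≃ E) :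
    Prop where
  σ₀ : ∀ a, h (G'.σ₀ a) = G.σ₀ (h a)
  σ₁ : ∀ a, h (G'.σ₁ a) = G.σ₁ (h a)
  block : ∀ a b, G'.block a b ↔ G.block (h a) (h b)
  genus : ∀ a, G'.genus (G'.blockOf a) = G.genus (G.blockOf (h a))
  marksHole : ∀ i a, G'.MarksHole i a ↔ G.MarksHole i (h a)
  marksBlock : ∀ i a, G'.MarksBlock i a ↔ G.MarksBlock i (h a)

/-- For `f : E' → E`, the edges outside the range of `f` are the collapsed ones. Two oriented edges
of `G` are `Joined` if their initial vertices are connected through blocks of `G` and collapsed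
edges. -/
def Joined (G : EnrichedRibbonGraph g n E) (f : E' → E) : E → E → Prop :=
  Relation.EqvGen (fun x y => G.block x y ∨ (x ∉ Set.range f ∧ y = G.σ₁ x))

/-- `G' = G/Z`: the injection `f` of the oriented edges of `G'` into those of `G` exhibits `G'` as
the (reduced) enriched ribbon graph obtained from `G` by shrinking to length zero the set `Z` of
all edges outside the range of `f`.  `Z = ∅` is allowed.
* `σ₁` is restricted, `σ∞` is the induced (first return) operator, `σ₀ = σ∞⁻¹ σ₁`;
* the blocks of `G'` are the components of the union of the blocks of `G` and of `Z`; the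
  genus of a new block is determined by the Euler characteristic of the corresponding subsurface
  (made of the surfaces of the old blocks, a strip for each edge in `Z`, and a
  disc for each hole that is bordered only by edges in `Z`);
* a marked point on a hole bordered only by edges in `Z` moves to the corresponding new block. -/
structure IsContraction (G : EnrichedRibbonGraph g n E) (G' : EnrichedRibbonGraph g n E')
    (f : E' → E) : Prop where
  injective : Function.Injective f
  σ₁ : ∀ a, f (G'.σ₁ a) = G.σ₁ (f a)
  σinf : ∀ a, ∃ k : ℕ, 0 < k ∧ (G.σinf ^ k) (f a) = f (G'.σinf a) ∧
    ∀ j : ℕ, 0 < j → j < k → (G.σinf ^ j) (f a) ∉ Set.range f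
  block : ∀ a b, G'.block a b ↔ Joined G f (f a) (f b)
  genus : ∀ a, G'.blockChi (G'.blockOf a) =
    (∑ᶠ c ∈ {c : G.Block | ∃ z, G.blockOf z = c ∧ Joined G f (f a) z}, G.blockChi c)
    - (Nat.card {ε : G.Edge // ∃ z, G.edgeOf z = ε ∧ z ∉ Set.range f ∧ Joined G f (f a) z} : ℤ)
    + (Nat.card {h : G.Hole // (∀ z, G.holeOf z = h → z ∉ Set.range f) ∧
        ∃ z, G.holeOf z = h ∧ Joined G f (f a) z} : ℤ)
  marksHole : ∀ i a, G'.MarksHole i a ↔ G.MarksHole i (f a)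
  marksBlock : ∀ i a, G'.MarksBlock i a ↔
    (∃ z, G.MarksBlock i z ∧ Joined G f (f a) z) ∨
    (∃ z, G.MarksHole i z ∧ (∀ z', G.holeOf z' = G.holeOf z → z' ∉ Set.range f) ∧
      Joined G f (f a) z)

end Morphisms

/-! ## Metrics, cells and the forms `Ω` -/

namespace EnrichedRibbonGraph

variable {g n : ℕ} {E : Type} [Fintype E] (G : EnrichedRibbonGraph g n E)

/-- The perimeter `p_i` of the hole marked by `x_i`, as a linear function of the lengths of the
edges; it is `0` if `x_i` does not mark a hole. -/
def perimeter (i : Fin n) : (E → ℝ) →ₗ[ℝ] ℝ :=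
  ∑ e : E, if G.MarksHole i e then LinearMap.proj e else 0

/-- The (open) cell of `G` in the space of metrized enriched ribbon graphs whose vector of
perimeters lies in `B`: all metrics `ℓ : E₁ → ℝ_{>0}` (written as functions on oriented edges that
are invariant under reversal) with perimeters in `B`. -/
def openCell (B : Set (Fin n → ℝ)) : Set (E → ℝ) :=
  {ℓ | (∀ e, ℓ (G.σ₁ e) = ℓ e) ∧ (∀ e, 0 < ℓ e) ∧ (fun i => G.perimeter i ℓ) ∈ B}

/-- The tangent space of the cell. -/
def tangent (B : Set (Fin n → ℝ)) : Submodule ℝ (E → ℝ) := vectorSpan ℝ (G.openCell B)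

/-- `v` is a basis of the tangent space of the (nonempty) cell of `G`; in particular the
cell has dimension `k`. -/
def IsFrame (B : Set (Fin n → ℝ)) {k : ℕ} (v : Fin k → E → ℝ) : Prop :=
  (G.openCell B).Nonempty ∧ LinearIndependent ℝ v ∧
    Submodule.span ℝ (Set.range v) = G.tangent B

/-- The `2`-form `de ∧ de'` on the space of edge lengths. -/
def wedge₂ (e e' : E) : (E → ℝ) →ₗ[ℝ] (E → ℝ) →ₗ[ℝ] ℝ :=
  LinearMap.mk₂ ℝ (fun u v => u e * v e' - u e' * v e)
    (fun _ _ _ => by simp only [Pi.add_apply]; ring)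
    (fun _ _ _ => by simp only [Pi.smul_apply, smul_eq_mul]; ring)
    (fun _ _ _ => by simp only [Pi.add_apply]; ring)
    (fun _ _ _ => by simp only [Pi.smul_apply, smul_eq_mul]; ring)

/-- The form `∑_{1 ≤ s < t ≤ k-1} de_s ∧ de_t` of a hole with cyclically ordered sides
`e_1, e_2 = σ∞ e_1, …, e_k`, where `e = e_1` is a chosen first side. -/
def holeForm (e : E) : (E → ℝ) →ₗ[ℝ] (E → ℝ) →ₗ[ℝ] ℝ :=
  ∑ t ∈ Finset.range (G.sides e - 1), ∑ s ∈ Finset.range t,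
    wedge₂ ((G.σinf ^ s) e) ((G.σinf ^ t) e)

/-- `Ω = ∑_i p_i² η_i`, where `η_i = ∑_{1 ≤ s < t ≤ k-1} d(e_s/2p_i) ∧ d(e_t/2p_i)` and the `p_i`
are constant, so that `p_i² η_i = (1/4) ∑_{s < t ≤ k-1} de_s ∧ de_t`.  Modulo the `dp_i` this
does not depend on the first side of the hole; we take the average over all choices of it. -/
def Omega : (E → ℝ) →ₗ[ℝ] (E → ℝ) →ₗ[ℝ] ℝ :=
  (1 / 4 : ℝ) • ∑ e : E, (1 / (G.sides e : ℝ)) • G.holeForm e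

end EnrichedRibbonGraph

/-- The multilinear function
`v ↦ ∏_{a < d} ω(v_{a,0}, v_{a,1}) · ∏_{j < q} η_j(v_j)`. -/
def wedgeProduct {V : Type} [AddCommGroup V] [Module ℝ V] (d q : ℕ)
    (ω : V →ₗ[ℝ] V →ₗ[ℝ] ℝ) (η : Fin q → V →ₗ[ℝ] ℝ) :
    MultilinearMap ℝ (fun _ : (Fin d × Fin 2) ⊕ Fin q => V) ℝ where
  toFun v := (∏ a : Fin d, ω (v (Sum.inl (a, 0))) (v (Sum.inl (a, 1)))) *
    ∏ j : Fin q, η j (v (Sum.inr j))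
  map_update_add' := by
    intro inst v i x y
    rw [Subsingleton.elim inst (inferInstance : DecidableEq ((Fin d × Fin 2) ⊕ Fin q))]
    rcases i with ⟨a, b⟩ | j
    · have h3 : ∀ (z : V) (j : Fin q), Function.update v (Sum.inl (a, b)) z (Sum.inr j)
          = v (Sum.inr j) := fun z j => Function.update_of_ne (by simp) _ _
      have h4 : ∀ (z : V) (a' : Fin d) (b' : Fin 2), a' ≠ a →
          Function.update v (Sum.inl (a, b)) z (Sum.inl (a', b')) = v (Sum.inl (a', b')) :=
        fun z a' b' h => Function.update_of_ne (by simp [h]) _ _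
      simp only [h3, ← add_mul]
      congr 1
      rw [← Finset.mul_prod_erase _ _ (Finset.mem_univ a),
        ← Finset.mul_prod_erase _ _ (Finset.mem_univ a),
        ← Finset.mul_prod_erase _ _ (Finset.mem_univ a)]
      have h5 : ∀ z : V, ∏ a' ∈ Finset.univ.erase a,
          ω (Function.update v (Sum.inl (a, b)) z (Sum.inl (a', 0)))
            (Function.update v (Sum.inl (a, b)) z (Sum.inl (a', 1)))
          = ∏ a' ∈ Finset.univ.erase a, ω (v (Sum.inl (a', 0))) (v (Sum.inl (a', 1))) := by
        intro z
        refine Finset.prod_congr rfl fun a' ha' => ?_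
        rw [h4 z a' 0 (Finset.ne_of_mem_erase ha'), h4 z a' 1 (Finset.ne_of_mem_erase ha')]
      rw [h5, h5, h5, ← add_mul]
      congr 1
      fin_cases b <;> simp
    · have h3 : ∀ (z : V) (c : Fin d × Fin 2), Function.update v (Sum.inr j) z (Sum.inl c)
          = v (Sum.inl c) := fun z j => Function.update_of_ne (by simp) _ _
      simp only [h3, ← mul_add]
      congr 1
      rw [← Finset.mul_prod_erase _ _ (Finset.mem_univ j),
        ← Finset.mul_prod_erase _ _ (Finset.mem_univ j),
        ← Finset.mul_prod_erase _ _ (Finset.mem_univ j)]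
      have h5 : ∀ z : V, ∏ j' ∈ Finset.univ.erase j,
          η j' (Function.update v (Sum.inr j) z (Sum.inr j'))
          = ∏ j' ∈ Finset.univ.erase j, η j' (v (Sum.inr j')) := by
        intro z
        refine Finset.prod_congr rfl fun j' hj' => ?_
        rw [Function.update_of_ne (by simpa using Finset.ne_of_mem_erase hj')]
      rw [h5, h5, h5, ← add_mul]
      simp
  map_update_smul' := by
    intro inst v i c x
    rw [Subsingleton.elim inst (inferInstance : DecidableEq ((Fin d × Fin 2) ⊕ Fin q))]
    rcases i with ⟨a, b⟩ | j
    · have h3 : ∀ (z : V) (j : Fin q), Function.update v (Sum.inl (a, b)) z (Sum.inr j)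
          = v (Sum.inr j) := fun z j => Function.update_of_ne (by simp) _ _
      have h4 : ∀ (z : V) (a' : Fin d) (b' : Fin 2), a' ≠ a →
          Function.update v (Sum.inl (a, b)) z (Sum.inl (a', b')) = v (Sum.inl (a', b')) :=
        fun z a' b' h => Function.update_of_ne (by simp [h]) _ _
      simp only [h3, smul_eq_mul, ← mul_assoc]
      congr 1
      rw [← Finset.mul_prod_erase _ _ (Finset.mem_univ a),
        ← Finset.mul_prod_erase _ _ (Finset.mem_univ a)]
      have h5 : ∀ z : V, ∏ a' ∈ Finset.univ.erase a,
          ω (Function.update v (Sum.inl (a, b)) z (Sum.inl (a', 0)))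
            (Function.update v (Sum.inl (a, b)) z (Sum.inl (a', 1)))
          = ∏ a' ∈ Finset.univ.erase a, ω (v (Sum.inl (a', 0))) (v (Sum.inl (a', 1))) := by
        intro z
        refine Finset.prod_congr rfl fun a' ha' => ?_
        rw [h4 z a' 0 (Finset.ne_of_mem_erase ha'), h4 z a' 1 (Finset.ne_of_mem_erase ha')]
      rw [h5, h5, ← mul_assoc]
      congr 1
      fin_cases b <;> simp
    · have h3 : ∀ (z : V) (c : Fin d × Fin 2), Function.update v (Sum.inr j) z (Sum.inl c)
          = v (Sum.inl c) := fun z j => Function.update_of_ne (by simp) _ _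
      simp only [h3, smul_eq_mul, mul_left_comm c]
      congr 1
      rw [← Finset.mul_prod_erase _ _ (Finset.mem_univ j),
        ← Finset.mul_prod_erase _ _ (Finset.mem_univ j)]
      have h5 : ∀ z : V, ∏ j' ∈ Finset.univ.erase j,
          η j' (Function.update v (Sum.inr j) z (Sum.inr j'))
          = ∏ j' ∈ Finset.univ.erase j, η j' (v (Sum.inr j')) := by
        intro z
        refine Finset.prod_congr rfl fun j' hj' => ?_
        rw [Function.update_of_ne (by simpa using Finset.ne_of_mem_erase hj')]
      rw [h5, h5, ← mul_assoc]
      simp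

/-- The form `ω^d ∧ η_0 ∧ ⋯ ∧ η_{q-1}` of degree `2d + q` (up to a positive constant, depending
on `d` and `q` only). -/
def powerForm {V : Type} [AddCommGroup V] [Module ℝ V] (d q : ℕ)
    (ω : V →ₗ[ℝ] V →ₗ[ℝ] ℝ) (η : Fin q → V →ₗ[ℝ] ℝ) : V [⋀^Fin (d * 2 + q)]→ₗ[ℝ] ℝ :=
  (MultilinearMap.alternatization (wedgeProduct d q ω η)).domDomCongr
    ((Equiv.sumCongr finProdFinEquiv (Equiv.refl (Fin q))).trans finSumFinEquiv)

/-! ## Cellular chains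

For `B ⊆ ℝ^X`, the orbispace of metrized enriched ribbon graphs with perimeters in `B` is decomposed
into the cells `openCell G B` (modulo automorphisms), and the boundary of the cell of `G`
consists of the cells of contractions of `G`. -/

/-- The vector on `E` that agrees with `u` on `E'` and vanishes on the collapsed edges. -/
def extendByZero {E E' : Type} (f : E' → E) (u : E' → ℝ) : E → ℝ := Function.extend f u 0

/-- A cellular `k`-chain with rational coefficients: to each `k`-cell, with the orientation given by
a frame, it assigns its multiplicity, which changes sign with the orientation and is
invariant under isomorphisms. -/
structure CellularChain (g n : ℕ) (B : Set (Fin n → ℝ)) (k : ℕ) where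
  coeff : ∀ {N : ℕ}, EnrichedRibbonGraph g n (Fin N) → (Fin k → Fin N → ℝ) → ℚ
  coeff_orientation : ∀ {N : ℕ} (G : EnrichedRibbonGraph g n (Fin N)) (v : Fin k → Fin N → ℝ)
    (A : Matrix (Fin k) (Fin k) ℝ), G.IsFrame B v → G.IsFrame B (fun i => ∑ j, A i j • v j) →
    coeff G (fun i => ∑ j, A i j • v j) = ((SignType.sign A.det : SignType) : ℚ) * coeff G v
  coeff_iso : ∀ {N N' : ℕ} (G : EnrichedRibbonGraph g n (Fin N))
    (G' : EnrichedRibbonGraph g n (Fin N')) (h : Fin N' ≃ Fin N) (v : Fin k → Fin N' → ℝ),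
    IsIso G G' h → coeff G (fun i => extendByZero h (v i)) = coeff G' v

/-- A contraction onto `G'`, that is, a cell of the star of the cell of `G'`. -/
structure Over {g n : ℕ} {E' : Type} (G' : EnrichedRibbonGraph g n E') where
  N : ℕ
  graph : EnrichedRibbonGraph g n (Fin N)
  map : E' → Fin N
  isContraction : IsContraction graph G' map

/-- Isomorphism of contractions onto `G'`. -/
def Over.Iso {g n : ℕ} {E' : Type} {G' : EnrichedRibbonGraph g n E'} (x y : Over G') : Prop :=
  ∃ h : Fin y.N ≃ Fin x.N, IsIso x.graph y.graph h ∧ ∀ a, h (y.map a) = x.map a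

/-- The star of `G'`: isomorphism classes of contractions onto `G'`. -/
abbrev Star {g n : ℕ} {E' : Type} (G' : EnrichedRibbonGraph g n E') : Type :=
  Quot (Over.Iso (G' := G'))

/-- The coefficient of `∂c` at the cell of `G'`, oriented by the frame `v`: the sum of the
coefficients of `c` at all the `k`-cells of the star of `G'` (finitely many), each oriented by the
frame consisting of an outward pointing vector followed by `v`. The outward vector
is the difference of a point of the face and a point of the `k`-cell. -/
def CellularChain.boundaryCoeff {g n : ℕ} {B : Set (Fin n → ℝ)} {k : ℕ} (c : CellularChain g n B k)
    {j : ℕ} (hj : j + 1 = k) {N' : ℕ} (G' : EnrichedRibbonGraph g n (Fin N'))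
    (v : Fin j → Fin N' → ℝ) : ℚ :=
  ∑ᶠ x : Star G',
    if h : (G'.openCell B).Nonempty ∧ (x.out.graph.openCell B).Nonempty ∧
        Module.finrank ℝ (x.out.graph.tangent B) = k then
      c.coeff x.out.graph (fun i =>
        (Fin.cons (extendByZero x.out.map h.1.some - h.2.1.some)
          (fun a => extendByZero x.out.map (v a)) : Fin (j + 1) → Fin x.out.N → ℝ)
          (Fin.cast hj.symm i))
    else 0

/-- `∂c = 0`: the boundary of `c` has coefficient `0` at each `(k-1)`-cell. -/
def CellularChain.IsCycle {g n : ℕ} {B : Set (Fin n → ℝ)} {k : ℕ} (c : CellularChain g n B k) :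
    Prop :=
  ∀ (j : ℕ) (hj : j + 1 = k) (N' : ℕ) (G' : EnrichedRibbonGraph g n (Fin N'))
    (v : Fin j → Fin N' → ℝ), G'.IsFrame B v → c.boundaryCoeff hj G' v = 0

/-! ## Witten chains -/

/-- `G` is (dual to) a maximal simplex of the combinatorial subcomplex of `m`: it is nonsingular
(no nodes, no invisible components, no marked vertices), has exactly `m i` vertices of valence
`2i + 3` for each `i`, and no other vertices. -/
structure EnrichedRibbonGraph.IsOfType {g n : ℕ} {E : Type} (G : EnrichedRibbonGraph g n E)
    (m : ℕ →₀ ℕ) : Prop where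
  block : ∀ a b, G.block a b → G.vertexOf a = G.vertexOf b
  genus : ∀ c, G.genus c = 0
  mark : ∀ i, ∃ h, G.mark i = Sum.inl h
  odd : ∀ v : G.Vertex, ∃ i, G.valence v = 2 * i + 3
  count : ∀ i, Nat.card {v : G.Vertex // G.valence v = 2 * i + 3} = m i

/-- `G` is a cell of the combinatorial subcomplex of `m`, the smallest subcomplex containing
the cells of the graphs of type `m`. -/
def EnrichedRibbonGraph.InSubcomplex {g n : ℕ} {E : Type} (G : EnrichedRibbonGraph g n E)
    (m : ℕ →₀ ℕ) : Prop :=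
  ∃ x : Over G, x.graph.IsOfType m

/-- The form `Ω^d ∧ dp_{s 0} ∧ ⋯ ∧ dp_{s (q-1)}`.  For `q = 0` it is `Ω^d`; for `q = n` and `s` the
identity it is the exterior product of `Ω^d` and of the pull-back of the volume form of `ℝ^X`
by the perimeter map. -/
def EnrichedRibbonGraph.topForm {g n : ℕ} {E : Type} [Fintype E] (G : EnrichedRibbonGraph g n E)
    (d : ℕ) {q : ℕ} (s : Fin q → Fin n) : (E → ℝ) [⋀^Fin (d * 2 + q)]→ₗ[ℝ] ℝ :=
  powerForm d q G.Omega (fun j => G.perimeter (s j))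

/-! ### Invariance -/

theorem alternating_matrix {V : Type} [AddCommGroup V] [Module ℝ V] {k : ℕ}
    (f : V [⋀^Fin k]→ₗ[ℝ] ℝ) (v : Fin k → V) (A : Matrix (Fin k) (Fin k) ℝ) :
    f (fun i => ∑ j, A i j • v j) = A.det * f v := by
  have h1 := DFunLike.congr_fun ((f.compLinearMap (Fintype.linearCombination ℝ v)).eq_smul_basis_det
    (Pi.basisFun ℝ (Fin k))) (Matrix.of.symm A)
  have h2 : (fun i => Fintype.linearCombination ℝ v (Pi.basisFun ℝ (Fin k) i)) = v := by
    funext i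
    simp [Fintype.linearCombination_apply_single]
  have h3 : (f.compLinearMap (Fintype.linearCombination ℝ v)) (Pi.basisFun ℝ (Fin k)) = f v := by
    rw [AlternatingMap.compLinearMap_apply]
    exact congrArg f h2
  rw [AlternatingMap.smul_apply, smul_eq_mul, h3, Pi.basisFun_det_apply, mul_comm] at h1
  exact h1

namespace IsIso

variable {g n : ℕ} {E E' : Type} {G : EnrichedRibbonGraph g n E} {G' : EnrichedRibbonGraph g n E'}
  {h : E' ≃ E}

theorem symm (H : IsIso G G' h) : IsIso G' G h.symm where
  σ₀ a := by rw [Equiv.symm_apply_eq, H.σ₀, Equiv.apply_symm_apply]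
  σ₁ a := by rw [Equiv.symm_apply_eq, H.σ₁, Equiv.apply_symm_apply]
  block a b := by rw [H.block]; simp
  genus a := by rw [H.genus]; simp
  marksHole i a := by rw [H.marksHole]; simp
  marksBlock i a := by rw [H.marksBlock]; simp

theorem σ₀_inv (H : IsIso G G' h) (a : E') : h (G'.σ₀⁻¹ a) = G.σ₀⁻¹ (h a) := by
  rw [Equiv.Perm.eq_inv_iff_eq, ← H.σ₀]; simp

theorem σinf (H : IsIso G G' h) (a : E') : h (G'.σinf a) = G.σinf (h a) := by
  simp only [RibbonGraph.σinf, Equiv.Perm.mul_apply]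
  rw [H.σ₁, H.σ₀_inv]

theorem conj_sameCycle {f : Equiv.Perm E} {f' : Equiv.Perm E'} (hf : ∀ a, h (f' a) = f (h a))
    (a b : E') : f'.SameCycle a b ↔ f.SameCycle (h a) (h b) := by
  have hz : ∀ (k : ℤ) (a : E'), h ((f' ^ k) a) = (f ^ k) (h a) := by
    have : f = (h.symm.trans f').trans h := by
      ext x; simp [hf]
    intro k a
    have h2 : f ^ k = (h.symm.trans (f' ^ k)).trans h := by
      rw [this]
      exact (map_zpow (Equiv.permCongrHom h) f' k).symm
    rw [h2]; simp
  constructor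
  · rintro ⟨k, hk⟩
    exact ⟨k, by rw [← hz, hk]⟩
  · rintro ⟨k, hk⟩
    exact ⟨k, h.injective (by rw [hz, hk])⟩

theorem vertexOf (H : IsIso G G' h) (a b : E') :
    G'.vertexOf a = G'.vertexOf b ↔ G.vertexOf (h a) = G.vertexOf (h b) := by
  unfold RibbonGraph.vertexOf
  rw [Quotient.eq, Quotient.eq]
  exact conj_sameCycle H.σ₀ a b

theorem holeOf (H : IsIso G G' h) (a b : E') :
    G'.holeOf a = G'.holeOf b ↔ G.holeOf (h a) = G.holeOf (h b) := by
  unfold RibbonGraph.holeOf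
  rw [Quotient.eq, Quotient.eq]
  exact conj_sameCycle H.σinf a b

theorem blockOf (H : IsIso G G' h) (a b : E') :
    G'.blockOf a = G'.blockOf b ↔ G.blockOf (h a) = G.blockOf (h b) := by
  unfold EnrichedData.blockOf
  rw [Quotient.eq, Quotient.eq]
  exact H.block a b

theorem blockChi (H : IsIso G G' h) (a : E') :
    G'.blockChi (G'.blockOf a) = G.blockChi (G.blockOf (h a)) := by
  unfold EnrichedData.blockChi
  rw [H.genus]
  congr 2
  let φ : G'.Vertex → G.Vertex := Quotient.map h (fun a b hab => (conj_sameCycle H.σ₀ a b).1 hab)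
  have hφ : ∀ e, φ (G'.vertexOf e) = G.vertexOf (h e) := fun e => rfl
  refine Nat.card_congr (Equiv.ofBijective (fun v => ⟨φ v.1, ?_⟩) ⟨?_, ?_⟩)
  · obtain ⟨e, he, he'⟩ := v.2
    exact ⟨h e, by rw [← he, hφ], (H.blockOf _ _).1 he'⟩
  · rintro ⟨v, e, rfl, he⟩ ⟨w, e', rfl, he'⟩ hvw
    simp only [Subtype.mk.injEq, hφ] at hvw ⊢
    exact (H.vertexOf _ _).2 hvw
  · rintro ⟨v, e, rfl, he⟩
    refine ⟨⟨G'.vertexOf (h.symm e), h.symm e, rfl, (H.blockOf _ _).2 (by simpa using he)⟩, ?_⟩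
    simp [hφ]

theorem sides (H : IsIso G G' h) (a : E') : G'.sides a = G.sides (h a) := by
  refine Nat.card_congr (Equiv.subtypeEquiv h fun b => H.holeOf b a)

end IsIso

theorem extendByZero_equiv {E E' : Type} (h : E' ≃ E) (u : E' → ℝ) (a : E') :
    extendByZero h u (h a) = u a :=
  h.injective.extend_apply u 0 a

namespace IsIso

variable {g n : ℕ} {E E' : Type} {G : EnrichedRibbonGraph g n E} {G' : EnrichedRibbonGraph g n E'}
  {h : E' ≃ E}

theorem perimeter [Fintype E] [Fintype E'] (H : IsIso G G' h) (i : Fin n) (u : E' → ℝ) :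
    G.perimeter i (extendByZero h u) = G'.perimeter i u := by
  simp only [EnrichedRibbonGraph.perimeter, LinearMap.sum_apply]
  rw [← Equiv.sum_comp h]
  refine Finset.sum_congr rfl fun a _ => ?_
  by_cases ha : G'.MarksHole i a
  · rw [if_pos ha, if_pos ((H.marksHole i a).1 ha)]
    simp [extendByZero_equiv]
  · rw [if_neg ha, if_neg (fun hh => ha ((H.marksHole i a).2 hh))]
    simp

theorem Omega [Fintype E] [Fintype E'] (H : IsIso G G' h) (u v : E' → ℝ) :
    G.Omega (extendByZero h u) (extendByZero h v) = G'.Omega u v := by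
  have hz : ∀ (k : ℕ) (a : E'), h ((G'.σinf ^ k) a) = (G.σinf ^ k) (h a) := by
    intro k
    induction k with
    | zero => intro a; rfl
    | succ k ih => intro a; rw [pow_succ, pow_succ, Equiv.Perm.mul_apply, Equiv.Perm.mul_apply,
        ih, H.σinf]
  simp only [EnrichedRibbonGraph.Omega, LinearMap.smul_apply, LinearMap.sum_apply]
  congr 1
  rw [← Equiv.sum_comp h]
  refine Finset.sum_congr rfl fun a _ => ?_
  rw [H.sides]
  congr 1
  simp only [EnrichedRibbonGraph.holeForm, LinearMap.sum_apply, H.sides]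
  refine Finset.sum_congr rfl fun t _ => Finset.sum_congr rfl fun s _ => ?_
  simp only [EnrichedRibbonGraph.wedge₂, LinearMap.mk₂_apply, ← hz, extendByZero_equiv]

theorem topForm [Fintype E] [Fintype E'] (H : IsIso G G' h) (d : ℕ) {q : ℕ} (s : Fin q → Fin n)
    (v : Fin (d * 2 + q) → E' → ℝ) :
    G.topForm d s (fun i => extendByZero h (v i)) = G'.topForm d s v := by
  simp only [EnrichedRibbonGraph.topForm, powerForm, AlternatingMap.domDomCongr_apply,
    MultilinearMap.alternatization_apply]
  refine Finset.sum_congr rfl fun τ _ => ?_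
  congr 1
  simp only [MultilinearMap.domDomCongr_apply, wedgeProduct, MultilinearMap.coe_mk,
    Function.comp_apply, H.Omega, H.perimeter]

end IsIso

theorem IsContraction.comp_iso {g n : ℕ} {D E E' : Type} {F : EnrichedRibbonGraph g n D}
    {G : EnrichedRibbonGraph g n E} {G' : EnrichedRibbonGraph g n E'} {f : E → D} {h : E' ≃ E}
    (C : IsContraction F G f) (H : IsIso G G' h) : IsContraction F G' (f ∘ h) := by
  have hr : Set.range (f ∘ h) = Set.range f := h.surjective.range_comp f
  have hJ : Joined F (f ∘ h) = Joined F f := by unfold Joined; rw [hr]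
  refine ⟨C.injective.comp h.injective, fun a => ?_, fun a => ?_, fun a b => ?_, fun a => ?_,
    fun i a => ?_, fun i a => ?_⟩
  · simp only [Function.comp_apply, H.σ₁, C.σ₁]
  · simp only [hr, Function.comp_apply, H.σinf]
    exact C.σinf (h a)
  · rw [hJ, H.block, C.block]; rfl
  · rw [hr, hJ, H.blockChi, C.genus]; rfl
  · rw [H.marksHole, C.marksHole]; rfl
  · rw [hr, hJ, H.marksBlock, C.marksBlock]; rfl

theorem IsIso.inSubcomplex {g n N N' : ℕ} {G : EnrichedRibbonGraph g n (Fin N)}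
    {G' : EnrichedRibbonGraph g n (Fin N')} {h : Fin N' ≃ Fin N} (H : IsIso G G' h)
    (m : ℕ →₀ ℕ) : G.InSubcomplex m ↔ G'.InSubcomplex m :=
  ⟨fun ⟨x, hx⟩ => ⟨⟨x.N, x.graph, _, x.isContraction.comp_iso H⟩, hx⟩,
    fun ⟨x, hx⟩ => ⟨⟨x.N, x.graph, _, x.isContraction.comp_iso H.symm⟩, hx⟩⟩

/-! ### The chains -/

/-- The sum of the cells of dimension `2d + q`, with perimeters in `B`, of the combinatorial
subcomplex of `m`, oriented by the form `Ω^d ∧ dp_{s 0} ∧ ⋯ ∧ dp_{s (q-1)}`. -/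
def wittenChain (g n : ℕ) (m : ℕ →₀ ℕ) (B : Set (Fin n → ℝ)) (d : ℕ) {q : ℕ}
    (s : Fin q → Fin n) : CellularChain g n B (d * 2 + q) where
  coeff G v := if G.InSubcomplex m then ((SignType.sign (G.topForm d s v) : SignType) : ℚ) else 0
  coeff_orientation G v A _ _ := by
    rw [alternating_matrix, sign_mul]
    split_ifs <;> simp
  coeff_iso G G' h v H := by
    simp only [H.inSubcomplex m, H.topForm d s v]

/-- The oriented chain of the slice `{perimeters = p}`, of dimension `2d`. -/
def wittenSlice (g n : ℕ) (m : ℕ →₀ ℕ) (d : ℕ) (p : Fin n → ℝ) : CellularChain g n {p} (d * 2) :=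
  wittenChain g n m {p} d (Fin.elim0 : Fin 0 → Fin n)

/-- The oriented chain of the part where all perimeters are positive, of dimension
`2d + n`. Its cells are not relatively compact. -/
def wittenTotal (g n : ℕ) (m : ℕ →₀ ℕ) (d : ℕ) :
    CellularChain g n {p : Fin n → ℝ | ∀ i, 0 < p i} (d * 2 + n) :=
  wittenChain g n m {p | ∀ i, 0 < p i} d (fun i : Fin n => i)

end WittenCycle

end

/-!
Both assertions are local at a cell. Throughout, `D` is the space of allowed variations of the
perimeters (`⊥` for a slice, `⊤` for the part with positive perimeters), and the tangent space of
the cell of `G` is `G.tangentIn D`: the functions on oriented edges that are invariant under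
reversal and whose perimeters lie in `D`.

**The radical of `Ω`.** A function `w` whose sums over the holes vanish has a primitive along the
holes, `w e = W e - W (σ∞⁻¹ e)`, and in terms of primitives `Ω` becomes a simple sum
(`EnrichedRibbonGraph.Omega_eq`). Duality then shows that the elements of the radical of `Ω` on
`G.tangentIn ⊥` have primitives that change sign from each oriented edge to the next one at the
same vertex (`exists_alternating_of_radical`). Linear relations between the perimeters also give
such alternating functions (`alternating_holeFun`). Alternating functions vanish at the vertices
of odd valence.

**Nonvanishing.** For a graph of type `m` all valences are odd, so that `Ω` is nondegenerate and
the perimeters are independent; this and a count of edges give the dimension of its cell. A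
contraction of such a graph whose cell has the same dimension has the same tangent space, extended
by zero, and this extension is compatible with `Ω` and the perimeters
(`IsContraction.topForm_ne_zero`).

**The boundary.** Let `G'` be a cell of codimension one. Let `τ` be the permutation of the
oriented edges of `G'` that turns by one step each vertex at which some alternating function does
not vanish (`RibbonGraph.turn`). If `G → G'` is a contraction, one may take out the collapsed part
of `G` and glue it back after turning the vertices of `G'` by `τ`: on the level of permutations,
`σ₀` is conjugated by the extension of `τ` by the identity. This gives another contraction onto
`G'` (`Over.rotate`) with the same edges, and hence a permutation of the star of `G'`
(`Over.rotateStar`), which preserves the subcomplex of `m`. Since `τ` changes the sign of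
alternating functions, the two contractions are mirror images of each other (`IsMirror`), and they
induce opposite orientations of the cell of `G'` (`IsMirror.topForm_neg`). There are two cases.
* If the forms `dp_i` are independent on the tangent space of `G'`, their common kernel has odd
  dimension, so `Ω` has a radical on it. For `u` tangent to the cell of `G`, the pairing of `u`
  with an element of the radical only involves the lengths of the collapsed edges and the values
  of an alternating function, and changes sign. By the expansion of a Pfaffian along a row with
  one nonzero entry (`pfaffian_neg`), so does the top form.
* If there is a relation `∑ c_i dp_i = 0` on the tangent space of `G'`, then `∑ c_i dp_i (u)`
  changes sign in the same way, and so does the determinant of the `dp_i`.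

So the contributions to the boundary coefficient at `G'` sum up to the opposite of their sum.
-/

noncomputable section

open scoped Classical

namespace WittenCycle

open Equiv (Perm)

section

/-! ### First return permutations -/

theorem sameCycle_iff_of_agree {α : Type} {p p' : Perm α} {z : α}
    (h : ∀ x, p.SameCycle z x → p' x = p x) (y : α) : p'.SameCycle z y ↔ p.SameCycle z y := by
  have key : ∀ k : ℤ, (p' ^ k) z = (p ^ k) z := by
    intro k
    induction k using Int.induction_on with
    | zero => rfl
    | succ k ih =>
      rw [add_comm, zpow_one_add, zpow_one_add, Perm.mul_apply, Perm.mul_apply, ih,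
        h _ ⟨k, rfl⟩]
    | pred k ih =>
      rw [sub_eq_add_neg, add_comm, zpow_add, zpow_add, zpow_neg_one, zpow_neg_one,
        Perm.mul_apply, Perm.mul_apply, ih, Perm.inv_eq_iff_eq,
        h _ ⟨-1 + -(k : ℤ), by rw [zpow_add, zpow_neg_one, Perm.mul_apply]⟩]
      simp
  exact exists_congr fun k => by rw [key]

/-- `p'` is the first return permutation of `p` on the range of the injection `f`. -/
structure FirstReturn {E E' : Type} (p : Perm E) (p' : Perm E') (f : E' → E) : Prop where
  injective : Function.Injective f
  ret : ∀ a, ∃ k : ℕ, 0 < k ∧ (p ^ k) (f a) = f (p' a) ∧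
    ∀ j : ℕ, 0 < j → j < k → (p ^ j) (f a) ∉ Set.range f

theorem FirstReturn.sameCycle {E E' : Type} [Finite E] {p : Perm E} {p' : Perm E'} {f : E' → E}
    (h : FirstReturn p p' f) (a b : E') : p'.SameCycle a b ↔ p.SameCycle (f a) (f b) := by
  have : Finite E' := Finite.of_injective f h.injective
  constructor
  · intro hab
    obtain ⟨k, rfl⟩ := hab.exists_nat_pow_eq
    induction k with
    | zero => exact Perm.SameCycle.refl _ _
    | succ k ih =>
      refine (ih ⟨k, by simp⟩).trans ?_
      obtain ⟨l, -, hl, -⟩ := h.ret ((p' ^ k) a)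
      refine ⟨l, ?_⟩
      rw [pow_succ', Perm.mul_apply, ← hl, zpow_natCast]
  · intro hab
    obtain ⟨k, hk⟩ := hab.exists_nat_pow_eq
    clear hab
    induction k using Nat.strong_induction_on generalizing a with
    | _ k ih =>
      rcases Nat.eq_zero_or_pos k with rfl | hpos
      · rw [h.injective hk]
      · obtain ⟨l, hl0, hl, hl'⟩ := h.ret a
        by_cases hlk : l ≤ k
        · have := ih (k - l) (by omega) (p' a) (by
            rw [← hl, ← Perm.mul_apply, ← pow_add, Nat.sub_add_cancel hlk, hk])
          exact (Perm.sameCycle_apply_left).1 this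
        · exact absurd ⟨b, hk.symm⟩ (hl' k hpos (by omega))

variable {g n : ℕ} {E E' : Type}

theorem IsContraction.firstReturn {G : EnrichedRibbonGraph g n E} {G' : EnrichedRibbonGraph g n E'}
    {f : E' → E} (C : IsContraction G G' f) : FirstReturn G.σinf G'.σinf f :=
  ⟨C.injective, C.σinf⟩

theorem RibbonGraph.σ₁_σinf (G : RibbonGraph E) (e : E) : G.σ₁ (G.σinf e) = G.σ₀⁻¹ e := by
  rw [RibbonGraph.σinf, Perm.mul_apply, G.σ₁_invol]

/-! ### Rotations -/

/-- The ribbon graph with the same edges and edge reversal, whose operator `σ₀` is conjugated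
by `θ`. -/
def RibbonGraph.conj (G : RibbonGraph E) (θ : Perm E) : RibbonGraph E where
  σ₀ := θ * G.σ₀ * θ⁻¹
  σ₁ := G.σ₁
  σ₁_invol := G.σ₁_invol
  σ₁_ne := G.σ₁_ne

theorem RibbonGraph.conj_σinf (G : RibbonGraph E) (θ : Perm E) (x : E) :
    (G.conj θ).σinf (θ x) = G.σ₁ (θ (G.σ₁ (G.σinf x))) := by
  rw [G.σ₁_σinf]
  simp [RibbonGraph.σinf, RibbonGraph.conj]

/-- `θ` rotates the parts of `G` outside of `R` relatively to `R`: it is the identity outside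
of `R`, and conjugating `σ₀` by `θ` neither changes which oriented edges in `R` border the same hole
nor disconnects the graph. -/
structure IsRotation (G : EnrichedData n E) (θ : Perm E) (R : Set E) : Prop where
  σ₁_mem : ∀ e, e ∈ R → G.σ₁ e ∈ R
  apply_notMem : ∀ e, e ∉ R → θ e = e
  sameCycle : ∀ x ∈ R, ∀ y ∈ R,
    (G.toRibbonGraph.conj θ).σinf.SameCycle x y ↔ G.σinf.SameCycle x y
  connected : ∀ a b : E,
    Relation.EqvGen (fun x y => G.block (θ⁻¹ x) (θ⁻¹ y) ∨ y = G.σ₁ x) a b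

/-- The oriented edges that lie in `R`, or border a hole disjoint from `R`. -/
def RibbonGraph.Anchored (G : RibbonGraph E) (R : Set E) (y : E) : Prop :=
  y ∈ R ∨ ∀ x, G.σinf.SameCycle y x → x ∉ R

namespace IsRotation

variable {G : EnrichedData n E} {θ : Perm E} {R : Set E}

theorem σ₁_notMem (H : IsRotation G θ R) {e : E} (he : e ∉ R) : G.σ₁ e ∉ R :=
  fun h => he (by simpa [G.σ₁_invol] using H.σ₁_mem _ h)

theorem conj_σinf_of_notMem (H : IsRotation G θ R) {x : E} (hx : G.σinf x ∉ R) :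
    (G.toRibbonGraph.conj θ).σinf (θ x) = G.σinf x := by
  rw [G.conj_σinf, H.apply_notMem _ (H.σ₁_notMem hx), G.σ₁_invol]

theorem σinf_eq_of_notMem (H : IsRotation G θ R) {x : E} (hx : x ∉ R)
    (h : (G.toRibbonGraph.conj θ).σinf x ∉ R) :
    (G.toRibbonGraph.conj θ).σinf x = G.σinf x := by
  have h1 := G.conj_σinf θ x
  rw [H.apply_notMem x hx] at h1
  have h2 : θ (G.σ₁ (G.σinf x)) ∉ R := fun hh => h (h1 ▸ H.σ₁_mem _ hh)
  have h3 : θ (G.σ₁ (G.σinf x)) = G.σ₁ (G.σinf x) := θ.injective (H.apply_notMem _ h2)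
  rw [h1, h3, G.σ₁_invol]

theorem sameCycle_of_disjoint (H : IsRotation G θ R) {z : E}
    (hz : ∀ x, G.σinf.SameCycle z x → x ∉ R) (y : E) :
    (G.toRibbonGraph.conj θ).σinf.SameCycle z y ↔ G.σinf.SameCycle z y := by
  refine sameCycle_iff_of_agree (fun x hx => ?_) y
  have h1 := H.conj_σinf_of_notMem (hz _ (Perm.sameCycle_apply_right.2 hx))
  rwa [H.apply_notMem x (hz x hx)] at h1

theorem sameCycle_of_disjoint' (H : IsRotation G θ R) {z : E}
    (hz : ∀ x, (G.toRibbonGraph.conj θ).σinf.SameCycle z x → x ∉ R) (y : E) :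
    (G.toRibbonGraph.conj θ).σinf.SameCycle z y ↔ G.σinf.SameCycle z y := by
  refine (sameCycle_iff_of_agree (fun x hx => ?_) y).symm
  exact (H.σinf_eq_of_notMem (hz x hx) (hz _ (Perm.sameCycle_apply_right.2 hx))).symm

theorem disjoint_iff (H : IsRotation G θ R) (z : E) :
    (∀ x, (G.toRibbonGraph.conj θ).σinf.SameCycle z x → x ∉ R) ↔
      ∀ x, G.σinf.SameCycle z x → x ∉ R :=
  ⟨fun h x hx => h x ((H.sameCycle_of_disjoint' h x).2 hx),
    fun h x hx => h x ((H.sameCycle_of_disjoint h x).1 hx)⟩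

theorem anchored_iff (H : IsRotation G θ R) (z : E) :
    (G.toRibbonGraph.conj θ).Anchored R z ↔ G.Anchored R z :=
  or_congr Iff.rfl (H.disjoint_iff z)

theorem sameCycle_anchored (H : IsRotation G θ R) {x y : E} (hx : G.Anchored R x)
    (hy : G.Anchored R y) :
    (G.toRibbonGraph.conj θ).σinf.SameCycle x y ↔ G.σinf.SameCycle x y := by
  rcases hx with hx | hx
  · rcases hy with hy | hy
    · exact H.sameCycle x hx y hy
    · rw [Perm.sameCycle_comm, H.sameCycle_of_disjoint hy, Perm.sameCycle_comm]
  · exact H.sameCycle_of_disjoint hx y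

end IsRotation

theorem RibbonGraph.exists_anchored (G : RibbonGraph E) (R : Set E) (x : E) :
    ∃ y, G.Anchored R y ∧ G.σinf.SameCycle x y := by
  by_cases h : ∃ y ∈ R, G.σinf.SameCycle x y
  · obtain ⟨y, hy, hxy⟩ := h
    exact ⟨y, Or.inl hy, hxy⟩
  · push Not at h
    exact ⟨x, Or.inr fun y hy hR => h y hR hy, Perm.SameCycle.refl _ _⟩

theorem RibbonGraph.holeOf_eq_iff (G : RibbonGraph E) (x y : E) :
    G.holeOf x = G.holeOf y ↔ G.σinf.SameCycle x y := by
  unfold RibbonGraph.holeOf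
  rw [Quotient.eq]
  rfl

theorem RibbonGraph.vertexOf_eq_iff (G : RibbonGraph E) (x y : E) :
    G.vertexOf x = G.vertexOf y ↔ G.σ₀.SameCycle x y := by
  unfold RibbonGraph.vertexOf
  rw [Quotient.eq]
  rfl

theorem RibbonGraph.exists_holeOf (G : RibbonGraph E) (h : G.Hole) : ∃ e, G.holeOf e = h :=
  Quotient.exists_rep h

theorem EnrichedData.exists_blockOf (G : EnrichedData n E) (h : G.Block) : ∃ e, G.blockOf e = h :=
  Quotient.exists_rep h

theorem EnrichedData.blockOf_eq_iff (G : EnrichedData n E) (x y : E) :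
    G.blockOf x = G.blockOf y ↔ G.block x y := by
  unfold EnrichedData.blockOf
  rw [Quotient.eq]

theorem RibbonGraph.exists_anchored_rep (G : RibbonGraph E) (R : Set E) (h : G.Hole) :
    ∃ y, G.Anchored R y ∧ G.holeOf y = h := by
  obtain ⟨e, rfl⟩ := G.exists_holeOf h
  obtain ⟨y, hy, he⟩ := G.exists_anchored R e
  exact ⟨y, hy, (G.holeOf_eq_iff y e).2 he.symm⟩

namespace EnrichedData

variable (G : EnrichedData n E) (θ : Perm E) (R : Set E)

/-- The enriched ribbon graph obtained from `G` by conjugating `σ₀` by `θ`.  Blocks with their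
genera and markings are transported by `θ`; a hole is followed through the oriented edges in `R`
that it contains, or through any of its oriented edges if it is disjoint from `R`. -/
def rotate : EnrichedData n E where
  toRibbonGraph := G.toRibbonGraph.conj θ
  block := G.block.comap ⇑θ⁻¹
  block_of_vertex a b h := G.block_of_vertex _ _ (Perm.sameCycle_conj.1 h)
  genus := Quotient.lift (fun a => G.genus (G.blockOf (θ⁻¹ a))) fun a b h =>
    congrArg G.genus (Quotient.sound h)
  mark i := (G.mark i).map
    (fun h => (G.toRibbonGraph.conj θ).holeOf (G.exists_anchored_rep R h).choose)
    (Quotient.map θ fun a b h => by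
      change G.block (θ⁻¹ (θ a)) (θ⁻¹ (θ b))
      simpa using h)

theorem rotate_block (a b : E) : (G.rotate θ R).block a b ↔ G.block (θ⁻¹ a) (θ⁻¹ b) := Iff.rfl

theorem rotate_genus (a : E) :
    (G.rotate θ R).genus ((G.rotate θ R).blockOf a) = G.genus (G.blockOf (θ⁻¹ a)) := rfl

theorem rotate_vertex (a b : E) : (G.rotate θ R).σ₀.SameCycle a b ↔
    G.σ₀.SameCycle (θ⁻¹ a) (θ⁻¹ b) := Perm.sameCycle_conj

theorem rotate_marksBlock (i : Fin n) (a : E) :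
    (G.rotate θ R).MarksBlock i a ↔ G.MarksBlock i (θ⁻¹ a) := by
  unfold MarksBlock
  rcases h : G.mark i with h' | c
  · simp [rotate, h]
  · obtain ⟨e, rfl⟩ := G.exists_blockOf c
    have h1 : (G.rotate θ R).mark i = Sum.inr ((G.rotate θ R).blockOf (θ e)) := by
      simp only [rotate, h, Sum.map_inr]
      rfl
    rw [h1, Sum.inr.injEq, Sum.inr.injEq, blockOf_eq_iff, blockOf_eq_iff, rotate_block]
    simp

theorem rotate_marksHole {θ : Perm E} {R : Set E} (H : IsRotation G θ R) (i : Fin n) (a : E) :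
    (G.rotate θ R).MarksHole i a ↔ ∃ y, G.Anchored R y ∧
      (G.toRibbonGraph.conj θ).σinf.SameCycle y a ∧ G.MarksHole i y := by
  unfold MarksHole
  rcases h : G.mark i with h' | c
  · have h1 := (G.exists_anchored_rep R h').choose_spec
    have h2 : (G.rotate θ R).mark i = Sum.inl ((G.rotate θ R).holeOf
        (G.exists_anchored_rep R h').choose) := by
      simp only [rotate, h, Sum.map_inl]
    rw [h2]
    set y := (G.exists_anchored_rep R h').choose
    rw [Sum.inl.injEq]
    constructor
    · intro h3
      exact ⟨y, h1.1, (RibbonGraph.holeOf_eq_iff _ _ _).1 h3, by rw [h1.2]⟩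
    · rintro ⟨z, hz, hza, hzh⟩
      refine (RibbonGraph.holeOf_eq_iff _ _ _).2 ?_
      refine Perm.SameCycle.trans ?_ hza
      refine (H.sameCycle_anchored h1.1 hz).2 ?_
      rw [← RibbonGraph.holeOf_eq_iff, h1.2]
      exact Sum.inl.inj hzh
  · simp [rotate, h]

theorem rotate_marksHole_anchored {θ : Perm E} {R : Set E} (H : IsRotation G θ R) (i : Fin n)
    {a : E} (ha : G.Anchored R a) : (G.rotate θ R).MarksHole i a ↔ G.MarksHole i a := by
  rw [G.rotate_marksHole H]
  constructor
  · rintro ⟨y, hy, hya, hm⟩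
    rw [H.sameCycle_anchored hy ha, ← RibbonGraph.holeOf_eq_iff] at hya
    rwa [MarksHole, ← hya]
  · exact fun h => ⟨a, ha, Perm.SameCycle.refl _ _, h⟩

/-- Rotation transports blocks. -/
def rotateBlockEquiv : G.Block ≃ (G.rotate θ R).Block :=
  Quotient.congr θ fun a b => by
    change _ ↔ G.block (θ⁻¹ (θ a)) (θ⁻¹ (θ b))
    simp

theorem rotateBlockEquiv_blockOf (a : E) :
    G.rotateBlockEquiv θ R (G.blockOf a) = (G.rotate θ R).blockOf (θ a) := rfl

/-- Rotation transports vertices. -/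
def rotateVertexEquiv : G.Vertex ≃ (G.rotate θ R).Vertex :=
  Quotient.congr θ fun a b => by
    change G.σ₀.SameCycle a b ↔ (G.rotate θ R).σ₀.SameCycle (θ a) (θ b)
    rw [G.rotate_vertex]
    simp

theorem rotateVertexEquiv_vertexOf (a : E) :
    G.rotateVertexEquiv θ R (G.vertexOf a) = (G.rotate θ R).vertexOf (θ a) := rfl

theorem rotate_valence (v : G.Vertex) :
    (G.rotate θ R).valence (G.rotateVertexEquiv θ R v) = G.valence v := by
  refine Nat.card_congr (θ.subtypeEquiv fun a => ?_).symm
  rw [← G.rotateVertexEquiv_vertexOf, (G.rotateVertexEquiv θ R).apply_eq_iff_eq]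

theorem rotate_blockChi (c : G.Block) :
    (G.rotate θ R).blockChi (G.rotateBlockEquiv θ R c) = G.blockChi c := by
  obtain ⟨a, rfl⟩ := G.exists_blockOf c
  unfold blockChi
  rw [rotateBlockEquiv_blockOf, rotate_genus]
  rw [show θ⁻¹ (θ a) = a by simp]
  congr 2
  refine Nat.card_congr ((G.rotateVertexEquiv θ R).subtypeEquiv fun v => ?_).symm
  constructor
  · rintro ⟨e, rfl, he⟩
    exact ⟨θ e, rfl, by rw [← rotateBlockEquiv_blockOf, he, rotateBlockEquiv_blockOf]⟩
  · rintro ⟨e, he, he'⟩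
    refine ⟨θ⁻¹ e, (G.rotateVertexEquiv θ R).injective ?_, (G.rotateBlockEquiv θ R).injective ?_⟩
    · rw [rotateVertexEquiv_vertexOf]; simpa using he
    · rw [rotateBlockEquiv_blockOf, rotateBlockEquiv_blockOf]; simpa using he'

end EnrichedData

/-- Since every hole carries exactly one marked point, sets of holes can be counted by their
marked points. -/
theorem EnrichedData.card_hole (G : EnrichedData n E)
    (hG : ∀ h : G.Hole, ∃! i, G.mark i = Sum.inl h) (P : G.Hole → Prop) :
    Nat.card {h : G.Hole // P h} = Nat.card {i // ∃ h, G.mark i = Sum.inl h ∧ P h} := by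
  refine Nat.card_congr (Equiv.ofBijective (fun h => ⟨(hG h.1).choose, h.1,
    (hG h.1).choose_spec.1, h.2⟩) ⟨?_, ?_⟩)
  · rintro ⟨h, _⟩ ⟨h', _⟩ hh
    have h1 : (hG h).choose = (hG h').choose := congrArg Subtype.val hh
    have h2 := (hG h).choose_spec.1
    simp only at h2
    rw [h1, (hG h').choose_spec.1] at h2
    exact Subtype.ext (Sum.inl.inj h2).symm
  · rintro ⟨i, h, hi, hP⟩
    exact ⟨⟨h, hP⟩, Subtype.ext ((hG h).choose_spec.2 i hi).symm⟩

theorem EnrichedData.rotate_hole_marked {G : EnrichedData n E} {θ : Perm E} {R : Set E}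
    (H : IsRotation G θ R) (hG : ∀ h : G.Hole, ∃! i, G.mark i = Sum.inl h)
    (h : (G.rotate θ R).Hole) : ∃! i, (G.rotate θ R).mark i = Sum.inl h := by
  obtain ⟨y, hy, rfl⟩ := RibbonGraph.exists_anchored_rep (G.rotate θ R).toRibbonGraph R h
  have hy' : G.Anchored R y := (H.anchored_iff y).1 hy
  obtain ⟨i, hi, hu⟩ := hG (G.holeOf y)
  exact ⟨i, (G.rotate_marksHole_anchored H i hy').2 hi,
    fun j hj => hu j ((G.rotate_marksHole_anchored H j hy').1 hj)⟩

/-- The rotation of an enriched ribbon graph of genus `g`. -/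
def EnrichedRibbonGraph.rotate (G : EnrichedRibbonGraph g n E) (θ : Perm E) (R : Set E)
    (H : IsRotation G.toEnrichedData θ R) : EnrichedRibbonGraph g n E where
  toEnrichedData := G.toEnrichedData.rotate θ R
  hole_marked := EnrichedData.rotate_hole_marked H G.hole_marked
  trivalent e h1 h2 h3 := by
    have h4 := G.trivalent (θ⁻¹ e) h1
      (fun i hi => h2 i ((EnrichedData.rotate_marksBlock _ _ _ _ _).2 hi))
      (fun e' he' => by
        have := h3 (θ e') (by
          rw [EnrichedData.rotate_block]; simpa using he')
        rw [EnrichedData.rotate_vertex] at this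
        simpa using this)
    rw [← EnrichedData.rotate_valence _ θ R, EnrichedData.rotateVertexEquiv_vertexOf] at h4
    simpa using h4
  connected := H.connected
  total_genus := by
    have h1 := G.total_genus
    have h2 : ∑ᶠ c, (G.toEnrichedData.rotate θ R).blockChi c = ∑ᶠ c, G.blockChi c := by
      rw [← finsum_comp_equiv (G.toEnrichedData.rotateBlockEquiv θ R)]
      simp only [EnrichedData.rotate_blockChi]
    have h3 : Nat.card (G.toEnrichedData.rotate θ R).Hole = Nat.card G.Hole := by
      have e1 := G.card_hole G.hole_marked fun _ => True
      have e2 := EnrichedData.card_hole _ (EnrichedData.rotate_hole_marked H G.hole_marked)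
        fun _ => True
      rw [Nat.card_congr (Equiv.subtypeUnivEquiv fun _ => trivial)] at e1 e2
      rw [e1, e2]
      refine Nat.card_congr (Equiv.subtypeEquivRight fun i => ?_)
      rcases h : G.mark i with h' | c <;> simp [EnrichedData.rotate, h]
    rw [h2, h3]
    exact h1

end

section

variable {g n : ℕ} {E E' : Type}

/-! ### Rotations and contractions -/

theorem EqvGen.map {α β : Type} {r : α → α → Prop} {s : β → β → Prop} {φ : α → β}
    (h : ∀ x y, r x y → Relation.EqvGen s (φ x) (φ y)) {a b : α} (hab : Relation.EqvGen r a b) :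
    Relation.EqvGen s (φ a) (φ b) := by
  induction hab with
  | rel x y hxy => exact h x y hxy
  | refl x => exact Relation.EqvGen.refl _
  | symm x y _ ih => exact ih.symm
  | trans x y z _ _ ih1 ih2 => exact ih1.trans _ _ _ ih2

namespace IsContraction

variable {G : EnrichedRibbonGraph g n E} {G' : EnrichedRibbonGraph g n E'} {f : E' → E}

theorem σ₁_notMem_range (C : IsContraction G G' f) {z : E} (hz : z ∉ Set.range f) :
    G.σ₁ z ∉ Set.range f := by
  rintro ⟨a, ha⟩
  exact hz ⟨G'.σ₁ a, by rw [C.σ₁, ha, G.σ₁_invol]⟩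

theorem exists_joined_range (C : IsContraction G G' f) [Nonempty E'] (x : E) :
    ∃ a, Joined G f x (f a) := by
  have key : ∀ x y, Relation.EqvGen (fun x y => G.block x y ∨ y = G.σ₁ x) x y →
      ((∃ a, Joined G f x (f a)) ↔ ∃ a, Joined G f y (f a)) := by
    intro x y hxy
    induction hxy with
    | rel x y h =>
      have hj : Joined G f x y → ((∃ a, Joined G f x (f a)) ↔ ∃ a, Joined G f y (f a)) :=
        fun hj => ⟨fun ⟨a, ha⟩ => ⟨a, (hj.symm).trans _ _ _ ha⟩,
          fun ⟨a, ha⟩ => ⟨a, hj.trans _ _ _ ha⟩⟩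
      rcases h with h | rfl
      · exact hj (Relation.EqvGen.rel _ _ (Or.inl h))
      · by_cases hx : x ∈ Set.range f
        · obtain ⟨a, rfl⟩ := hx
          exact ⟨fun _ => ⟨G'.σ₁ a, by rw [C.σ₁]; exact Relation.EqvGen.refl _⟩,
            fun _ => ⟨a, Relation.EqvGen.refl _⟩⟩
        · exact hj (Relation.EqvGen.rel _ _ (Or.inr ⟨hx, rfl⟩))
    | refl x => exact Iff.rfl
    | symm x y _ ih => exact ih.symm
    | trans x y z _ _ ih1 ih2 => exact ih1.trans ih2
  obtain ⟨a⟩ := ‹Nonempty E'›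
  exact (key x (f a) (G.connected _ _)).2 ⟨a, Relation.EqvGen.refl _⟩

variable {θ : Perm E} {τ : Perm E'}

/-- Outside of the range of `f`, the hole operator of the rotated graph runs through the same
oriented edges as that of `G`, but starting from a rotated oriented edge. -/
theorem conj_σinf_pow (C : IsContraction G G' f) (hθ : ∀ a, θ (f a) = f (τ a))
    (hθ' : ∀ z, z ∉ Set.range f → θ z = z) (a : E') (k : ℕ)
    (hk : ∀ j, 0 < j → j ≤ k → (G.σinf ^ j) (f a) ∉ Set.range f) :
    ((G.conj θ).σinf ^ k) (f (τ a)) = θ ((G.σinf ^ k) (f a)) := by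
  have hs : ∀ (p : Perm E) (j : ℕ) (x : E), (p ^ (j + 1)) x = p ((p ^ j) x) := fun p j x => by
    rw [pow_succ', Perm.mul_apply]
  induction k with
  | zero => simp [hθ]
  | succ k ih =>
    have h1 := hk (k + 1) (by omega) le_rfl
    rw [hs, ih fun j hj hjk => hk j hj (by omega), G.conj_σinf, ← hs,
      hθ' _ (C.σ₁_notMem_range h1), G.σ₁_invol, hθ' _ h1]

/-- If `θ` extends `τ` by the identity on the collapsed edges, conjugation by `θ` and `τ` preserves
first returns. -/
theorem firstReturn_conj (C : IsContraction G G' f) (hθ : ∀ a, θ (f a) = f (τ a))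
    (hθ' : ∀ z, z ∉ Set.range f → θ z = z) :
    FirstReturn (G.conj θ).σinf (G'.conj τ).σinf f := by
  refine ⟨C.injective, fun a => ?_⟩
  obtain ⟨b, rfl⟩ := τ.surjective a
  obtain ⟨k, hk0, hk, hk'⟩ := C.σinf b
  have hs : ∀ (p : Perm E) (j : ℕ) (x : E), (p ^ (j + 1)) x = p ((p ^ j) x) := fun p j x => by
    rw [pow_succ', Perm.mul_apply]
  have key : ∀ j, j < k → ((G.conj θ).σinf ^ j) (f (τ b)) = θ ((G.σinf ^ j) (f b)) :=
    fun j hj => C.conj_σinf_pow hθ hθ' b j fun i hi hij => hk' i hi (by omega)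
  refine ⟨k, hk0, ?_, fun j hj0 hjk => ?_⟩
  · obtain ⟨j, rfl⟩ : ∃ j, k = j + 1 := ⟨k - 1, by omega⟩
    rw [hs, key j (by omega), G.conj_σinf, ← hs, hk, ← C.σ₁, hθ, ← C.σ₁, G'.conj_σinf]
  · rw [key j hjk, hθ' _ (hk' j hj0 hjk)]
    exact hk' j hj0 hjk

/-- A rotation of `G/Z` extends to a rotation of `G`. -/
theorem isRotation [Finite E] [Nonempty E'] (C : IsContraction G G' f)
    (hθ : ∀ a, θ (f a) = f (τ a)) (hθ' : ∀ z, z ∉ Set.range f → θ z = z) {R : Set E'}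
    (H : IsRotation G'.toEnrichedData τ R) : IsRotation G.toEnrichedData θ (f '' R) := by
  refine ⟨?_, ?_, ?_, ?_⟩
  · rintro _ ⟨a, ha, rfl⟩
    exact ⟨_, H.σ₁_mem a ha, C.σ₁ a⟩
  · intro e he
    by_cases h : e ∈ Set.range f
    · obtain ⟨a, rfl⟩ := h
      rw [hθ, H.apply_notMem a fun ha => he ⟨a, ha, rfl⟩]
    · exact hθ' e h
  · rintro _ ⟨x, hx, rfl⟩ _ ⟨y, hy, rfl⟩
    rw [← (C.firstReturn_conj hθ hθ').sameCycle, ← C.firstReturn.sameCycle]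
    exact H.sameCycle x hx y hy
  · have hinv : ∀ a, θ⁻¹ (f a) = f (τ⁻¹ a) := fun a => by
      rw [Perm.inv_eq_iff_eq, hθ]; simp
    have hinv' : ∀ z, z ∉ Set.range f → θ⁻¹ z = z := fun z hz => by
      rw [Perm.inv_eq_iff_eq, hθ' z hz]
    set r : E → E → Prop := fun x y => G.block (θ⁻¹ x) (θ⁻¹ y) ∨ y = G.σ₁ x
    have hJ : ∀ x y, Joined G f x y → Relation.EqvGen r (θ x) (θ y) := by
      intro x y hxy
      refine EqvGen.map (φ := θ) (fun x y h => ?_) hxy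
      rcases h with h | ⟨hx, rfl⟩
      · exact Relation.EqvGen.rel _ _ (Or.inl (by simpa using h))
      · rw [hθ' x hx, hθ' _ (C.σ₁_notMem_range hx)]
        exact Relation.EqvGen.rel _ _ (Or.inr rfl)
    have h2 : ∀ x y, Relation.EqvGen r (f x) (f y) := by
      intro x y
      refine EqvGen.map (φ := f) (fun x y h => ?_) (H.connected x y)
      rcases h with h | rfl
      · have := hJ _ _ ((C.block _ _).1 h)
        simpa [hθ] using this
      · exact Relation.EqvGen.rel _ _ (Or.inr (C.σ₁ x))
    have h3 : ∀ x, ∃ a, Relation.EqvGen r x (f a) := by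
      intro x
      obtain ⟨a, ha⟩ := C.exists_joined_range (θ⁻¹ x)
      exact ⟨τ a, by simpa [hθ] using hJ _ _ ha⟩
    intro x y
    obtain ⟨a, ha⟩ := h3 x
    obtain ⟨b, hb⟩ := h3 y
    exact (ha.trans _ _ _ (h2 a b)).trans _ _ _ hb.symm

theorem joined_rotate (C : IsContraction G G' f) (hθ' : ∀ z, z ∉ Set.range f → θ z = z)
    {R : Set E} (H : IsRotation G.toEnrichedData θ R) (a b : E) :
    Joined (G.rotate θ R H) f a b ↔ Joined G f (θ⁻¹ a) (θ⁻¹ b) := by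
  have hinv' : ∀ z, z ∉ Set.range f → θ⁻¹ z = z := fun z hz => by
    rw [Perm.inv_eq_iff_eq, hθ' z hz]
  constructor
  · intro h
    refine EqvGen.map (φ := ⇑θ⁻¹) (fun x y h => ?_) h
    rcases h with h | ⟨hx, rfl⟩
    · exact Relation.EqvGen.rel _ _ (Or.inl h)
    · rw [hinv' x hx]
      refine Relation.EqvGen.rel _ _ (Or.inr ⟨hx, ?_⟩)
      exact hinv' _ (C.σ₁_notMem_range hx)
  · intro h
    have := EqvGen.map (φ := θ) (s := fun x y => (G.rotate θ R H).block x y ∨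
      (x ∉ Set.range f ∧ y = (G.rotate θ R H).σ₁ x)) (fun x y h => ?_) h
    · rwa [show θ (θ⁻¹ a) = a by simp, show θ (θ⁻¹ b) = b by simp] at this
    rcases h with h | ⟨hx, rfl⟩
    · refine Relation.EqvGen.rel _ _ (Or.inl ?_)
      change G.block (θ⁻¹ (θ x)) (θ⁻¹ (θ y))
      simpa using h
    · rw [hθ' x hx, hθ' _ (C.σ₁_notMem_range hx)]
      exact Relation.EqvGen.rel _ _ (Or.inr ⟨hx, rfl⟩)

theorem disjoint_range_iff {R : Set E'} (H : IsRotation G.toEnrichedData θ (f '' R)) (z : E) :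
    (∀ z', (G.rotate θ (f '' R) H).holeOf z' = (G.rotate θ (f '' R) H).holeOf z →
      z' ∉ Set.range f) ↔ ∀ z', G.holeOf z' = G.holeOf z → z' ∉ Set.range f := by
  have hsub : f '' R ⊆ Set.range f := Set.image_subset_range f R
  constructor
  · intro h z' hz'
    rw [RibbonGraph.holeOf_eq_iff, Perm.sameCycle_comm] at hz'
    refine h z' ?_
    rw [RibbonGraph.holeOf_eq_iff, Perm.sameCycle_comm]
    refine (H.sameCycle_of_disjoint' (fun x hx hR => h x ?_ (hsub hR)) z').2 hz'
    exact (RibbonGraph.holeOf_eq_iff _ _ _).2 hx.symm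
  · intro h z' hz'
    rw [RibbonGraph.holeOf_eq_iff, Perm.sameCycle_comm] at hz'
    refine h z' ?_
    rw [RibbonGraph.holeOf_eq_iff, Perm.sameCycle_comm]
    refine (H.sameCycle_of_disjoint (fun x hx hR => h x ?_ (hsub hR)) z').1 hz'
    exact (RibbonGraph.holeOf_eq_iff _ _ _).2 hx.symm

theorem anchored_of_disjoint_range {R : Set E'} {z : E}
    (h : ∀ z', G.holeOf z' = G.holeOf z → z' ∉ Set.range f) : G.Anchored (f '' R) z :=
  Or.inr fun x hx hR => h x ((RibbonGraph.holeOf_eq_iff _ _ _).2 hx.symm)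
    (Set.image_subset_range f R hR)

/-- Rotations are compatible with contractions. -/
theorem rotate [Finite E] (C : IsContraction G G' f)
    (hθ : ∀ a, θ (f a) = f (τ a)) (hθ' : ∀ z, z ∉ Set.range f → θ z = z) {R : Set E'}
    (H' : IsRotation G'.toEnrichedData τ R) (H : IsRotation G.toEnrichedData θ (f '' R)) :
    IsContraction (G.rotate θ (f '' R) H) (G'.rotate τ R H') f := by
  have hinv : ∀ a, θ⁻¹ (f a) = f (τ⁻¹ a) := fun a => by
    rw [Perm.inv_eq_iff_eq, hθ]; simp
  have hinv' : ∀ z, z ∉ Set.range f → θ⁻¹ z = z := fun z hz => by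
    rw [Perm.inv_eq_iff_eq, hθ' z hz]
  have hFR := C.firstReturn_conj hθ hθ'
  have hJ : ∀ a z, Joined (G.rotate θ (f '' R) H) f (f a) z ↔
      Joined G f (f (τ⁻¹ a)) (θ⁻¹ z) := fun a z => by
    rw [C.joined_rotate hθ' H, hinv]
  refine ⟨C.injective, C.σ₁, hFR.ret, fun a b => ?_, fun a => ?_, fun i a => ?_, fun i a => ?_⟩
  · rw [hJ, hinv]
    exact C.block _ _
  · have h1 := C.genus (τ⁻¹ a)
    have h2 : (G'.rotate τ R H').blockChi ((G'.rotate τ R H').blockOf a) =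
        G'.blockChi (G'.blockOf (τ⁻¹ a)) := by
      rw [← G'.toEnrichedData.rotate_blockChi τ R, EnrichedData.rotateBlockEquiv_blockOf]
      simp [EnrichedRibbonGraph.rotate]
    rw [h2, h1]
    congr 2
    · let φ : G.Block ≃ (G.rotate θ (f '' R) H).Block :=
        G.toEnrichedData.rotateBlockEquiv θ (f '' R)
      rw [finsum_mem_def, finsum_mem_def, ← finsum_comp_equiv φ]
      refine finsum_congr fun c => ?_
      have e1 : (c ∈ {c : G.Block | ∃ z, G.blockOf z = c ∧ Joined G f (f (τ⁻¹ a)) z}) ↔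
          φ c ∈
            {c : (G.rotate θ (f '' R) H).Block | ∃ z, (G.rotate θ (f '' R) H).blockOf z = c ∧
              Joined (G.rotate θ (f '' R) H) f (f a) z} := by
        simp only [Set.mem_ofPred_eq, hJ]
        constructor
        · rintro ⟨z, rfl, hz⟩
          exact ⟨θ z, rfl, by simpa using hz⟩
        · rintro ⟨z, hz, hz'⟩
          refine ⟨θ⁻¹ z, φ.injective (Eq.trans ?_ hz), hz'⟩
          change (G.rotate θ (f '' R) H).blockOf (θ (θ⁻¹ z)) = _
          rw [show θ (θ⁻¹ z) = z by simp]
      by_cases hc : c ∈ {c : G.Block | ∃ z, G.blockOf z = c ∧ Joined G f (f (τ⁻¹ a)) z}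
      · rw [Set.indicator_of_mem hc, Set.indicator_of_mem (e1.1 hc)]
        exact (EnrichedData.rotate_blockChi _ _ _ _).symm
      · rw [Set.indicator_of_notMem hc, Set.indicator_of_notMem (fun h => hc (e1.2 h))]
    · refine congrArg _ (Nat.card_congr (Equiv.subtypeEquivRight fun ε => ?_))
      refine exists_congr fun z => and_congr_right fun _ => and_congr_right fun hz => ?_
      rw [hJ, hinv' z hz]
    · rw [EnrichedData.card_hole _ G.hole_marked,
        EnrichedData.card_hole _ (G.rotate θ (f '' R) H).hole_marked]
      refine Nat.card_congr (Equiv.subtypeEquivRight fun i => ?_)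
      constructor
      · rintro ⟨_, hi, hd, z, rfl, hz⟩
        refine ⟨_, (EnrichedData.rotate_marksHole_anchored _ H i
          (anchored_of_disjoint_range hd)).2 hi, (disjoint_range_iff H z).2 hd, z, rfl, ?_⟩
        rw [hJ, hinv' z (hd z rfl)]
        exact hz
      · rintro ⟨_, hi, hd, z, rfl, hz⟩
        have hd' := (disjoint_range_iff H z).1 hd
        refine ⟨_, (EnrichedData.rotate_marksHole_anchored _ H i
          (anchored_of_disjoint_range hd')).1 hi, hd', z, rfl, ?_⟩
        rwa [hJ, hinv' z (hd z rfl)] at hz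
  · have hanch : ∀ y, G'.Anchored R y → G.Anchored (f '' R) (f y) := by
      rintro y (hy | hy)
      · exact Or.inl ⟨y, hy, rfl⟩
      · refine Or.inr ?_
        rintro _ hx ⟨x, hxR, rfl⟩
        exact hy x ((C.firstReturn.sameCycle _ _).2 hx) hxR
    obtain ⟨y, hy, hya⟩ := (G'.conj τ).exists_anchored R a
    rw [H'.anchored_iff] at hy
    have e1 : (G'.rotate τ R H').MarksHole i a ↔ (G'.rotate τ R H').MarksHole i y := by
      unfold EnrichedData.MarksHole
      rw [((G'.rotate τ R H').holeOf_eq_iff a y).2 hya]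
    have e2 : (G.rotate θ (f '' R) H).MarksHole i (f a) ↔
        (G.rotate θ (f '' R) H).MarksHole i (f y) := by
      unfold EnrichedData.MarksHole
      rw [((G.rotate θ (f '' R) H).holeOf_eq_iff (f a) (f y)).2 ((hFR.sameCycle _ _).1 hya)]
    rw [e1, e2]
    exact (EnrichedData.rotate_marksHole_anchored _ H' i hy).trans ((C.marksHole i y).trans
      (EnrichedData.rotate_marksHole_anchored _ H i (hanch y hy)).symm)
  · refine (EnrichedData.rotate_marksBlock _ _ _ _ _).trans ((C.marksBlock i _).trans ?_)
    refine or_congr ?_ ?_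
    · constructor
      · rintro ⟨z, hz, hz'⟩
        exact ⟨θ z, (EnrichedData.rotate_marksBlock _ _ _ _ _).2 (by simpa using hz),
          (hJ _ _).2 (by simpa using hz')⟩
      · rintro ⟨z, hz, hz'⟩
        exact ⟨θ⁻¹ z, (EnrichedData.rotate_marksBlock _ _ _ _ _).1 hz, (hJ _ _).1 hz'⟩
    · refine exists_congr fun z => ?_
      constructor
      · rintro ⟨h1, h2, h3⟩
        refine ⟨(EnrichedData.rotate_marksHole_anchored _ H i
          (anchored_of_disjoint_range h2)).2 h1, (disjoint_range_iff H z).2 h2, ?_⟩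
        rwa [hJ, hinv' z (h2 z rfl)]
      · rintro ⟨h1, h2, h3⟩
        have h2' := (disjoint_range_iff H z).1 h2
        refine ⟨(EnrichedData.rotate_marksHole_anchored _ H i
          (anchored_of_disjoint_range h2')).1 h1, h2', ?_⟩
        rwa [hJ, hinv' z (h2 z rfl)] at h3

end IsContraction

end

section

variable {g n : ℕ} {E E' : Type}

/-! ### Isomorphisms of rotated graphs -/

theorem IsIso.conj {G : EnrichedRibbonGraph g n E} {G' : EnrichedRibbonGraph g n E'} {h : E' ≃ E}
    (H : IsIso G G' h) {θ : Perm E} {θ' : Perm E'} (hθ : ∀ a, h (θ' a) = θ (h a)) (a : E') :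
    h ((G'.conj θ').σ₀ a) = (G.conj θ).σ₀ (h a) := by
  have hinv : ∀ a, h (θ'⁻¹ a) = θ⁻¹ (h a) := fun a => by
    rw [Perm.eq_inv_iff_eq, ← hθ]; simp
  simp only [RibbonGraph.conj, Perm.mul_apply, hθ, H.σ₀, hinv]

theorem IsIso.conj_σinf {G : EnrichedRibbonGraph g n E} {G' : EnrichedRibbonGraph g n E'}
    {h : E' ≃ E} (H : IsIso G G' h) {θ : Perm E} {θ' : Perm E'} (hθ : ∀ a, h (θ' a) = θ (h a))
    (a : E') : h ((G'.conj θ').σinf a) = (G.conj θ).σinf (h a) := by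
  simp only [RibbonGraph.σinf, Perm.mul_apply]
  have h1 : h ((G'.conj θ').σ₀⁻¹ a) = (G.conj θ).σ₀⁻¹ (h a) := by
    rw [Perm.eq_inv_iff_eq, ← H.conj hθ]; simp
  exact (H.σ₁ _).trans (congrArg _ h1)

theorem IsIso.rotate {G : EnrichedRibbonGraph g n E} {G' : EnrichedRibbonGraph g n E'} {h : E' ≃ E}
    (H : IsIso G G' h) {θ : Perm E} {θ' : Perm E'} {R : Set E} {R' : Set E'}
    (hθ : ∀ a, h (θ' a) = θ (h a)) (hR : ∀ a, a ∈ R' ↔ h a ∈ R)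
    (K : IsRotation G.toEnrichedData θ R) (K' : IsRotation G'.toEnrichedData θ' R') :
    IsIso (G.rotate θ R K) (G'.rotate θ' R' K') h := by
  have hinv : ∀ a, h (θ'⁻¹ a) = θ⁻¹ (h a) := fun a => by
    rw [Perm.eq_inv_iff_eq, ← hθ]; simp
  have hanch : ∀ y, G'.Anchored R' y ↔ G.Anchored R (h y) := by
    intro y
    unfold RibbonGraph.Anchored
    refine or_congr (hR y) ?_
    rw [← h.forall_congr_right]
    exact forall_congr' fun x => by rw [IsIso.conj_sameCycle H.σinf, hR]
  refine ⟨H.conj hθ, H.σ₁, fun a b => ?_, fun a => ?_, fun i a => ?_, fun i a => ?_⟩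
  · refine (H.block _ _).trans ?_
    rw [hinv, hinv]
    rfl
  · refine (H.genus _).trans ?_
    rw [hinv]
    rfl
  · refine (EnrichedData.rotate_marksHole _ K' i a).trans
      (Iff.trans ?_ (EnrichedData.rotate_marksHole _ K i (h a)).symm)
    rw [← h.exists_congr_right]
    exact exists_congr fun y => and_congr (hanch y) (and_congr
      (IsIso.conj_sameCycle (H.conj_σinf hθ) _ _) (H.marksHole i y))
  · refine (EnrichedData.rotate_marksBlock _ _ _ _ _).trans ((H.marksBlock i _).trans ?_)
    rw [hinv]
    exact (EnrichedData.rotate_marksBlock _ _ _ _ _).symm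

/-- Rotating by `θ` and then by `θ⁻¹` gives back the same graph. -/
theorem isIso_rotate_rotate (G : EnrichedRibbonGraph g n E) {θ θ' : Perm E} {R : Set E}
    (hθ : θ' = θ⁻¹) (K : IsRotation G.toEnrichedData θ R)
    (K' : IsRotation (G.rotate θ R K).toEnrichedData θ' R) :
    IsIso G ((G.rotate θ R K).rotate θ' R K') (Equiv.refl E) := by
  subst hθ
  have hG : (G.conj θ).conj θ⁻¹ = G.toRibbonGraph := by
    cases G.toRibbonGraph
    simp only [RibbonGraph.conj, RibbonGraph.mk.injEq, and_true]
    ext x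
    simp
  have h0 : ∀ a, (((G.rotate θ R K).rotate θ⁻¹ R K').σ₀) a = G.σ₀ a := fun a =>
    congrArg (fun F : RibbonGraph E => F.σ₀ a) hG
  have h1 : ∀ a b, (((G.conj θ).conj θ⁻¹).σinf.SameCycle a b ↔ G.σinf.SameCycle a b) :=
    fun a b => by rw [hG]
  refine ⟨h0, fun a => rfl, fun a b => ?_, fun a => ?_, fun i a => ?_, fun i a => ?_⟩
  · change G.block (θ⁻¹ (θ⁻¹⁻¹ a)) (θ⁻¹ (θ⁻¹⁻¹ b)) ↔ G.block a b
    simp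
  · change G.genus (G.blockOf (θ⁻¹ (θ⁻¹⁻¹ a))) = G.genus (G.blockOf a)
    simp
  · refine (EnrichedData.rotate_marksHole _ K' i a).trans ?_
    constructor
    · rintro ⟨y, hy, hya, hm⟩
      have hy' : G.Anchored R y := (K.anchored_iff y).1 hy
      have hm' := (EnrichedData.rotate_marksHole_anchored _ K i hy').1 hm
      have h2 := (h1 y a).1 hya
      rw [← RibbonGraph.holeOf_eq_iff] at h2
      change G.mark i = _
      rw [Equiv.refl_apply, ← h2]
      exact hm'
    · intro hm
      obtain ⟨y, hy, hay⟩ := G.exists_anchored R a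
      refine ⟨y, (K.anchored_iff y).2 hy, (h1 y a).2 hay.symm,
        (EnrichedData.rotate_marksHole_anchored _ K i hy).2 ?_⟩
      rw [EnrichedData.MarksHole, (RibbonGraph.holeOf_eq_iff _ y a).2 hay.symm]
      exact hm
  · refine (EnrichedData.rotate_marksBlock _ _ _ _ _).trans
      ((EnrichedData.rotate_marksBlock _ _ _ _ _).trans ?_)
    simp

/-! ### Turning the vertices of even valence -/

/-- Functions that change sign from each oriented edge to the next one at the same vertex. They
vanish at the vertices of odd valence. -/
def RibbonGraph.Alternating (G : RibbonGraph E) (W : E → ℝ) : Prop := ∀ a, W (G.σ₀ a) = -W a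

/-- `τ` moves each oriented edge inside its vertex, commutes with the cyclic orders, and changes the
sign of all alternating functions. -/
structure IsTurn (G : RibbonGraph E) (τ : Perm E) : Prop where
  comm : ∀ a, τ (G.σ₀ a) = G.σ₀ (τ a)
  sameCycle : ∀ a, G.σ₀.SameCycle (τ a) a
  flip : ∀ W, G.Alternating W → ∀ a, W (τ a) = -W a

theorem IsTurn.inv {G : RibbonGraph E} {τ : Perm E} (H : IsTurn G τ) : IsTurn G τ⁻¹ where
  comm a := by rw [Perm.inv_eq_iff_eq, H.comm]; simp
  sameCycle a := by simpa using (H.sameCycle (τ⁻¹ a)).symm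
  flip W hW a := by
    have := H.flip W hW (τ⁻¹ a)
    rw [show τ (τ⁻¹ a) = a by simp] at this
    linarith

/-- The permutation that turns all vertices of even valence (those where some alternating
function does not vanish) by one step. -/
def RibbonGraph.turn (G : RibbonGraph E) : Perm E where
  toFun a := if ∃ W, G.Alternating W ∧ W a ≠ 0 then G.σ₀ a else a
  invFun a := if ∃ W, G.Alternating W ∧ W a ≠ 0 then G.σ₀⁻¹ a else a
  left_inv a := by
    by_cases h : ∃ W, G.Alternating W ∧ W a ≠ 0
    · have h' : ∃ W, G.Alternating W ∧ W (G.σ₀ a) ≠ 0 := by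
        obtain ⟨W, hW, ha⟩ := h
        exact ⟨W, hW, by rw [hW]; exact neg_ne_zero.2 ha⟩
      beta_reduce
      rw [if_pos h, if_pos h']
      simp
    · beta_reduce
      rw [if_neg h, if_neg h]
  right_inv a := by
    by_cases h : ∃ W, G.Alternating W ∧ W a ≠ 0
    · have h' : ∃ W, G.Alternating W ∧ W (G.σ₀⁻¹ a) ≠ 0 := by
        obtain ⟨W, hW, ha⟩ := h
        refine ⟨W, hW, fun h0 => ha ?_⟩
        have := hW (G.σ₀⁻¹ a)
        rw [h0] at this
        simpa using this
      beta_reduce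
      rw [if_pos h, if_pos h']
      simp
    · beta_reduce
      rw [if_neg h, if_neg h]

theorem RibbonGraph.isTurn_turn (G : RibbonGraph E) : IsTurn G G.turn where
  comm a := by
    have h : (∃ W, G.Alternating W ∧ W (G.σ₀ a) ≠ 0) ↔ ∃ W, G.Alternating W ∧ W a ≠ 0 := by
      refine exists_congr fun W => and_congr_right fun hW => ?_
      rw [hW, neg_ne_zero]
    simp only [RibbonGraph.turn, Equiv.coe_fn_mk, h]
    split_ifs <;> rfl
  sameCycle a := by
    simp only [RibbonGraph.turn, Equiv.coe_fn_mk]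
    split_ifs
    · exact Perm.sameCycle_apply_left.2 (Perm.SameCycle.refl _ _)
    · exact Perm.SameCycle.refl _ _
  flip W hW a := by
    simp only [RibbonGraph.turn, Equiv.coe_fn_mk]
    split_ifs with h
    · exact hW a
    · push Not at h
      rw [h W hW, neg_zero]

namespace IsTurn

variable {G' : EnrichedRibbonGraph g n E'} {τ : Perm E'}

theorem conj_eq {G' : RibbonGraph E'} (H : IsTurn G' τ) : G'.conj τ = G' := by
  cases G' with
  | mk σ₀ σ₁ h1 h2 =>
    simp only [RibbonGraph.conj, RibbonGraph.mk.injEq, and_true]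
    ext x
    have := H.comm (τ⁻¹ x)
    simp only [Perm.mul_apply] at this ⊢
    rw [this]
    simp

theorem block (H : IsTurn G'.toRibbonGraph τ) (a b : E') :
    G'.block (τ⁻¹ a) (τ⁻¹ b) ↔ G'.block a b := by
  have h1 : ∀ a, G'.block (τ⁻¹ a) a := fun a => G'.block_of_vertex _ _ (H.inv.sameCycle a)
  exact ⟨fun h => G'.block.trans (G'.block.symm (h1 a)) (G'.block.trans h (h1 b)),
    fun h => G'.block.trans (h1 a) (G'.block.trans h (G'.block.symm (h1 b)))⟩

theorem isRotation (H : IsTurn G'.toRibbonGraph τ) :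
    IsRotation G'.toEnrichedData τ Set.univ where
  σ₁_mem _ _ := Set.mem_univ _
  apply_notMem e he := absurd (Set.mem_univ e) he
  sameCycle x _ y _ := by rw [H.conj_eq]
  connected a b := by
    simp only [H.block]
    exact G'.connected a b

theorem isIso (H : IsTurn G'.toRibbonGraph τ) :
    IsIso (G'.rotate τ Set.univ H.isRotation) G' (Equiv.refl E') := by
  have hb : ∀ a, G'.blockOf (τ⁻¹ a) = G'.blockOf a := fun a =>
    (EnrichedData.blockOf_eq_iff _ _ _).2 (G'.block_of_vertex _ _ (H.inv.sameCycle a))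
  refine ⟨fun a => ?_, fun a => rfl, fun a b => (H.block a b).symm, fun a => ?_, fun i a => ?_,
    fun i a => ?_⟩
  · exact congrArg (fun F : RibbonGraph E' => F.σ₀ a) H.conj_eq.symm
  · change _ = G'.genus (G'.blockOf (τ⁻¹ a))
    rw [hb]
  · exact (EnrichedData.rotate_marksHole_anchored _ H.isRotation i
      (Or.inl (Set.mem_univ a))).symm
  · refine Iff.trans ?_ (EnrichedData.rotate_marksBlock _ _ _ _ _).symm
    rw [EnrichedData.MarksBlock, EnrichedData.MarksBlock, hb]
    rfl

end IsTurn

/-! ### Rotating the star of a cell -/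

/-- The extension of a permutation by the identity outside the range of an injection. -/
def extendPerm (f : E' → E) (hf : Function.Injective f) (τ : Perm E') : Perm E :=
  τ.viaEmbedding ⟨f, hf⟩

theorem extendPerm_apply {f : E' → E} (hf : Function.Injective f) (τ : Perm E') (a : E') :
    extendPerm f hf τ (f a) = f (τ a) := τ.viaEmbedding_apply ⟨f, hf⟩ a

theorem extendPerm_of_notMem {f : E' → E} (hf : Function.Injective f) (τ : Perm E') (z : E)
    (hz : z ∉ Set.range f) : extendPerm f hf τ z = z := τ.viaEmbedding_apply_of_notMem ⟨f, hf⟩ z hz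

theorem extendPerm_inv {f : E' → E} (hf : Function.Injective f) (τ : Perm E') :
    extendPerm f hf τ⁻¹ = (extendPerm f hf τ)⁻¹ := by
  ext z
  rw [Perm.eq_inv_iff_eq]
  by_cases hz : z ∈ Set.range f
  · obtain ⟨a, rfl⟩ := hz
    rw [extendPerm_apply, extendPerm_apply]
    simp
  · rw [extendPerm_of_notMem hf _ z hz, extendPerm_of_notMem hf _ z hz]

namespace Over

variable {G' : EnrichedRibbonGraph g n E'} [Nonempty E'] {τ : Perm E'}

theorem isRotation (x : Over G') (H : IsTurn G'.toRibbonGraph τ) :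
    IsRotation x.graph.toEnrichedData (extendPerm x.map x.isContraction.injective τ)
      (x.map '' Set.univ) :=
  x.isContraction.isRotation (extendPerm_apply _ τ) (extendPerm_of_notMem _ τ) H.isRotation

/-- The rotated contraction: the collapsed part of the graph is glued back after having
been moved relatively to the oriented edges of `G'` by a turn of `G'`. -/
def rotate (x : Over G') (H : IsTurn G'.toRibbonGraph τ) : Over G' where
  N := x.N
  graph := x.graph.rotate _ _ (x.isRotation H)
  map := x.map
  isContraction := (x.isContraction.rotate (extendPerm_apply _ τ) (extendPerm_of_notMem _ τ)
    H.isRotation (x.isRotation H)).comp_iso H.isIso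

theorem Iso.rotate {x y : Over G'} (h : x.Iso y) (H : IsTurn G'.toRibbonGraph τ) :
    (x.rotate H).Iso (y.rotate H) := by
  obtain ⟨h, hi, hm⟩ := h
  have hr : ∀ a, a ∈ Set.range y.map ↔ h a ∈ Set.range x.map := by
    intro a
    constructor
    · rintro ⟨b, rfl⟩
      exact ⟨b, (hm b).symm⟩
    · rintro ⟨b, hb⟩
      exact ⟨b, h.injective (by rw [hm, hb])⟩
  refine ⟨h, hi.rotate (fun a => ?_) (by simpa using hr) (x.isRotation H)
    (y.isRotation H), hm⟩
  by_cases ha : a ∈ Set.range y.map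
  · obtain ⟨b, rfl⟩ := ha
    rw [extendPerm_apply, hm, hm, extendPerm_apply]
  · rw [extendPerm_of_notMem _ _ _ ha, extendPerm_of_notMem _ _ _ fun h' => ha ((hr a).2 h')]

theorem rotate_rotate (x : Over G') {τ' : Perm E'} (hτ : τ' = τ⁻¹) (H : IsTurn G'.toRibbonGraph τ)
    (H' : IsTurn G'.toRibbonGraph τ') : x.Iso ((x.rotate H).rotate H') := by
  refine ⟨Equiv.refl _, ?_, fun a => rfl⟩
  refine isIso_rotate_rotate x.graph ?_ (x.isRotation H) ((x.rotate H).isRotation H')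
  rw [hτ]
  exact extendPerm_inv _ τ

/-- A turn of the vertices of `G'` acts on the star of the cell of `G'`. -/
def rotateStar (H : IsTurn G'.toRibbonGraph τ) : Star G' ≃ Star G' where
  toFun := Quot.map (fun x => x.rotate H) fun _ _ h => h.rotate H
  invFun := Quot.map (fun x => x.rotate H.inv) fun _ _ h => h.rotate H.inv
  left_inv := by
    rintro ⟨x⟩
    exact (Quot.sound (x.rotate_rotate rfl H H.inv)).symm
  right_inv := by
    rintro ⟨x⟩
    exact (Quot.sound (x.rotate_rotate (inv_inv τ).symm H.inv H)).symm

end Over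

theorem EnrichedRibbonGraph.IsOfType.rotate {G : EnrichedRibbonGraph g n E} {m : ℕ →₀ ℕ}
    (hG : G.IsOfType m) {θ : Perm E} {R : Set E} (H : IsRotation G.toEnrichedData θ R) :
    (G.rotate θ R H).IsOfType m where
  block a b hab := by
    have h1 := hG.block _ _ hab
    rw [RibbonGraph.vertexOf_eq_iff] at h1 ⊢
    exact (EnrichedData.rotate_vertex _ _ _ _ _).2 h1
  genus c := by
    obtain ⟨a, rfl⟩ := EnrichedData.exists_blockOf _ c
    exact hG.genus _
  mark i := by
    obtain ⟨h, hh⟩ := hG.mark i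
    simp only [EnrichedRibbonGraph.rotate, EnrichedData.rotate, hh, Sum.map_inl]
    exact ⟨_, rfl⟩
  odd v := by
    obtain ⟨w, rfl⟩ := (G.toEnrichedData.rotateVertexEquiv θ R).surjective v
    obtain ⟨i, hi⟩ := hG.odd w
    exact ⟨i, (G.toEnrichedData.rotate_valence θ R w).trans hi⟩
  count i := by
    rw [← hG.count i]
    refine (Nat.card_congr ((G.toEnrichedData.rotateVertexEquiv θ R).subtypeEquiv fun v => ?_)).symm
    rw [← G.toEnrichedData.rotate_valence θ R v]
    rfl

theorem Over.inSubcomplex_rotate {G' : EnrichedRibbonGraph g n E'} [Nonempty E'] {τ : Perm E'}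
    (x : Over G') (H : IsTurn G'.toRibbonGraph τ) (m : ℕ →₀ ℕ) :
    (x.rotate H).graph.InSubcomplex m ↔ x.graph.InSubcomplex m := by
  have key : ∀ {τ : Perm E'} (x : Over G') (H : IsTurn G'.toRibbonGraph τ),
      x.graph.InSubcomplex m → (x.rotate H).graph.InSubcomplex m := by
    rintro τ x H ⟨y, hy⟩
    have : Nonempty (Fin x.N) := ⟨x.map (Classical.arbitrary E')⟩
    have K := y.isContraction.isRotation (extendPerm_apply y.isContraction.injective _)
      (extendPerm_of_notMem _ _) (x.isRotation H)
    exact ⟨⟨y.N, y.graph.rotate _ _ K, y.map,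
      y.isContraction.rotate (extendPerm_apply _ _) (extendPerm_of_notMem _ _)
        (x.isRotation H) K⟩, hy.rotate K⟩
  refine ⟨fun h => ?_, key x H⟩
  have h1 := key _ H.inv h
  obtain ⟨h, hi, -⟩ := x.rotate_rotate rfl H H.inv
  exact (hi.inSubcomplex m).2 h1

end

section

/-! ### Sums over cycles and primitives -/

theorem mem_of_forall_dual {ι : Type} [Fintype ι] (S : Submodule ℝ (ι → ℝ)) (w : ι → ℝ)
    (h : ∀ c : ι → ℝ, (∀ x ∈ S, ∑ i, c i * x i = 0) → ∑ i, c i * w i = 0) : w ∈ S := by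
  by_contra hw
  obtain ⟨φ, hφ, hS⟩ := Submodule.exists_le_ker_of_notMem hw
  have key : ∀ x : ι → ℝ, φ x = ∑ i, φ (Pi.single i 1) * x i := fun x => by
    rw [LinearMap.pi_apply_eq_sum_univ φ x]
    refine Finset.sum_congr rfl fun i _ => ?_
    rw [smul_eq_mul, mul_comm]
    congr 2
    ext j
    simp [Pi.single_apply, eq_comm]
  refine hφ ?_
  rw [key]
  exact h _ fun x hx => by rw [← key]; exact hS hx

section Cycles

variable {E : Type} [Fintype E]

/-- The cycle of `e` under the permutation `p`. -/
def cycle (p : Perm E) (e : E) : Finset E := Finset.univ.filter fun x => p.SameCycle e x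

theorem mem_cycle {p : Perm E} {e x : E} : x ∈ cycle p e ↔ p.SameCycle e x := by
  simp [cycle]

theorem cycle_eq {p : Perm E} {e x : E} (h : p.SameCycle e x) : cycle p e = cycle p x := by
  ext y
  rw [mem_cycle, mem_cycle]
  exact ⟨fun hy => h.symm.trans hy, fun hy => h.trans hy⟩

theorem isCycleOn_cycle (p : Perm E) (e : E) : p.IsCycleOn (cycle p e : Set E) := by
  refine ⟨⟨fun x hx => ?_, p.injective.injOn, fun x hx => ⟨p⁻¹ x, ?_, by simp⟩⟩,
    fun x hx y hy => ?_⟩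
  · simp only [Finset.mem_coe, mem_cycle] at hx ⊢
    exact Perm.sameCycle_apply_right.2 hx
  · simp only [Finset.mem_coe, mem_cycle] at hx ⊢
    rw [← Perm.sameCycle_apply_right]
    simpa using hx
  · simp only [Finset.mem_coe, mem_cycle] at hx hy
    exact hx.symm.trans hy

theorem sum_range_cycle (p : Perm E) (e : E) (F : E → ℝ) :
    ∑ t ∈ Finset.range (cycle p e).card, F ((p ^ t) e) = ∑ x ∈ cycle p e, F x := by
  have he : e ∈ cycle p e := mem_cycle.2 (Perm.SameCycle.refl _ _)
  refine Finset.sum_bij (fun t _ => (p ^ t) e) (fun t _ => mem_cycle.2 ⟨t, by simp⟩) ?_ ?_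
    fun _ _ => rfl
  · intro s hs t ht hst
    rw [(isCycleOn_cycle p e).pow_apply_eq_pow_apply he] at hst
    exact Nat.ModEq.eq_of_lt_of_lt hst (Finset.mem_range.1 hs) (Finset.mem_range.1 ht)
  · intro x hx
    obtain ⟨t, ht, htx⟩ := (isCycleOn_cycle p e).exists_pow_eq he hx
    exact ⟨t, Finset.mem_range.2 ht, htx⟩

/-- The sum of `u` over each cycle of `p` vanishes. -/
def ZeroSum (p : Perm E) (u : E → ℝ) : Prop := ∀ e, ∑ x ∈ cycle p e, u x = 0

theorem ZeroSum.sum_mul {p : Perm E} {u c : E → ℝ} (hu : ZeroSum p u) (hc : ∀ e, c (p e) = c e) :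
    ∑ e, c e * u e = 0 := by
  have hc' : ∀ e x, p.SameCycle e x → c x = c e := by
    intro e x hx
    obtain ⟨k, rfl⟩ := hx.exists_nat_pow_eq
    clear hx
    induction k with
    | zero => rfl
    | succ k ih => rw [pow_succ', Perm.mul_apply, hc, ih]
  rw [← Finset.sum_fiberwise Finset.univ
    (fun e => (Quotient.mk (Perm.SameCycle.setoid p) e)) (fun e => c e * u e)]
  refine Finset.sum_eq_zero fun q _ => ?_
  obtain ⟨e, rfl⟩ := Quotient.exists_rep q
  have h1 : (Finset.univ.filter fun x => Quotient.mk (Perm.SameCycle.setoid p) x =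
      Quotient.mk (Perm.SameCycle.setoid p) e) = cycle p e := by
    ext x
    simp only [Finset.mem_filter, Finset.mem_univ, true_and, mem_cycle]
    rw [Quotient.eq, Perm.sameCycle_comm]
    rfl
  rw [h1, Finset.sum_congr rfl fun x hx => by rw [hc' e x (mem_cycle.1 hx)], ← Finset.mul_sum, hu,
    mul_zero]

/-- A function whose sum over each cycle vanishes is a coboundary. -/
theorem ZeroSum.exists_primitive {p : Perm E} {w : E → ℝ} (hw : ZeroSum p w) :
    ∃ W : E → ℝ, ∀ e, w e = W e - W (p⁻¹ e) := by
  let T : (E → ℝ) →ₗ[ℝ] (E → ℝ) := LinearMap.id - LinearMap.funLeft ℝ ℝ ⇑p⁻¹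
  have hT : ∀ W e, T W e = W e - W (p⁻¹ e) := fun W e => rfl
  have : w ∈ LinearMap.range T := by
    refine mem_of_forall_dual _ _ fun c hc => hw.sum_mul fun e => ?_
    have h1 := hc (T (Pi.single e 1)) ⟨_, rfl⟩
    simp only [hT, mul_sub, Finset.sum_sub_distrib] at h1
    have h2 : ∑ x, c x * (Pi.single e 1 : E → ℝ) (p⁻¹ x) = c (p e) := by
      rw [← Equiv.sum_comp p]
      simp [Pi.single_apply]
    rw [h2] at h1
    simp only [Pi.single_apply, mul_ite, mul_one, mul_zero, Finset.sum_ite_eq', Finset.mem_univ,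
      if_true] at h1
    linarith
  obtain ⟨W, rfl⟩ := this
  exact ⟨W, hT W⟩

end Cycles

/-! ### The form `Ω` in terms of primitives -/

theorem sum_wedge_eq (a B : ℕ → ℝ) (m : ℕ) :
    ∑ t ∈ Finset.range m, ∑ s ∈ Finset.range t, (a s * (B (t + 1) - B t) - a t * (B (s + 1) - B s))
      = (∑ s ∈ Finset.range m, a s) * (B m + B 0)
        - ∑ t ∈ Finset.range m, a t * (B (t + 1) + B t) := by
  induction m with
  | zero => simp
  | succ m ih =>
    rw [Finset.sum_range_succ, ih, Finset.sum_range_succ, Finset.sum_range_succ _ m,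
      Finset.sum_sub_distrib, ← Finset.sum_mul, ← Finset.mul_sum, Finset.sum_range_sub]
    ring

namespace RibbonGraph

variable {E : Type} [Fintype E] (G : RibbonGraph E)

theorem sides_eq (e : E) : G.sides e = (cycle G.σinf e).card := by
  unfold sides
  rw [Nat.card_eq_fintype_card, Fintype.card_subtype]
  congr 1
  ext x
  simp only [Finset.mem_filter, Finset.mem_univ, true_and, mem_cycle]
  rw [G.holeOf_eq_iff, Perm.sameCycle_comm]

end RibbonGraph

namespace EnrichedRibbonGraph

variable {g n : ℕ} {E : Type} [Fintype E] (G : EnrichedRibbonGraph g n E)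

/-- The form of a hole on functions with zero sum over the sides does not depend on the first
side of the hole. -/
theorem holeForm_eq {u W : E → ℝ} (hu : ZeroSum G.σinf u) (e : E) :
    G.holeForm e u (fun x => W x - W (G.σinf⁻¹ x)) =
      -∑ x ∈ cycle G.σinf e, u x * (W x + W (G.σinf⁻¹ x)) := by
  have he : e ∈ cycle G.σinf e := mem_cycle.2 (Perm.SameCycle.refl _ _)
  obtain ⟨m, hm⟩ : ∃ m, (cycle G.σinf e).card = m + 1 :=
    ⟨(cycle G.σinf e).card - 1, by have := Finset.card_pos.2 ⟨e, he⟩; omega⟩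
  set a : ℕ → ℝ := fun t => u ((G.σinf ^ t) e) with ha
  set B : ℕ → ℝ := fun t => W (G.σinf⁻¹ ((G.σinf ^ t) e)) with hB
  have hB1 : ∀ t, W ((G.σinf ^ t) e) = B (t + 1) := fun t => by
    simp only [hB]
    rw [pow_succ', Perm.mul_apply]
    simp
  have h0 : ∑ s ∈ Finset.range (m + 1), a s = 0 := by
    rw [← hm, sum_range_cycle, hu]
  have hper : B (m + 1) = B 0 := by
    have h1 := (isCycleOn_cycle G.σinf e).pow_card_apply he
    simp only [hB]
    rw [← hm, h1]
    rfl
  have h2 : ∑ x ∈ cycle G.σinf e, u x * (W x + W (G.σinf⁻¹ x)) =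
      ∑ t ∈ Finset.range (m + 1), a t * (B (t + 1) + B t) := by
    rw [← sum_range_cycle, hm]
    exact Finset.sum_congr rfl fun t _ => by rw [hB1]
  rw [h2]
  simp only [holeForm, wedge₂, LinearMap.sum_apply, LinearMap.mk₂_apply, G.sides_eq, hm,
    Nat.add_sub_cancel]
  have h3 := sum_wedge_eq a B m
  rw [Finset.sum_range_succ] at h0 ⊢
  rw [hper]
  have h4 : ∑ s ∈ Finset.range m, a s = -a m := by linarith
  rw [h4] at h3
  calc _ = ∑ t ∈ Finset.range m, ∑ s ∈ Finset.range t,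
        (a s * (B (t + 1) - B t) - a t * (B (s + 1) - B s)) := by
        refine Finset.sum_congr rfl fun t _ => Finset.sum_congr rfl fun s _ => ?_
        rw [hB1, hB1]
    _ = _ := by rw [h3]; ring

theorem Omega_eq {u w W : E → ℝ} (hu : ZeroSum G.σinf u)
    (hw : ∀ e, w e = W e - W (G.σinf⁻¹ e)) :
    G.Omega u w = -(1 / 4) * ∑ e, u e * (W e + W (G.σinf⁻¹ e)) := by
  obtain rfl : w = fun x => W x - W (G.σinf⁻¹ x) := funext hw
  simp only [Omega, LinearMap.smul_apply, LinearMap.sum_apply, G.holeForm_eq hu, smul_eq_mul,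
    G.sides_eq]
  have hpos : ∀ e, ((cycle G.σinf e).card : ℝ) ≠ 0 := fun e => by
    exact_mod_cast (Finset.card_pos.2 ⟨e, mem_cycle.2 (Perm.SameCycle.refl _ _)⟩).ne'
  have h1 : ∀ F : E → ℝ, ∑ e, 1 / ((cycle G.σinf e).card : ℝ) * -∑ x ∈ cycle G.σinf e, F x =
      -∑ x, F x := by
    intro F
    have h2 : ∀ e, 1 / ((cycle G.σinf e).card : ℝ) * -∑ x ∈ cycle G.σinf e, F x =
        -∑ x, if G.σinf.SameCycle e x then F x / ((cycle G.σinf x).card : ℝ) else 0 := by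
      intro e
      rw [← Finset.sum_filter, mul_neg, Finset.mul_sum]
      congr 1
      refine Finset.sum_congr rfl fun x hx => ?_
      rw [cycle_eq (mem_cycle.1 hx)]
      ring
    rw [Finset.sum_congr rfl fun e _ => h2 e, Finset.sum_neg_distrib, Finset.sum_comm]
    congr 1
    refine Finset.sum_congr rfl fun x _ => ?_
    rw [← Finset.sum_filter, Finset.sum_const, nsmul_eq_mul]
    have h3 : (Finset.univ.filter fun e => G.σinf.SameCycle e x) = cycle G.σinf x := by
      ext y
      simp [mem_cycle, Perm.sameCycle_comm]
    rw [h3]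
    field_simp [hpos x]
  rw [h1]
  ring

theorem Omega_self (u : E → ℝ) : G.Omega u u = 0 := by
  simp only [Omega, holeForm, wedge₂, LinearMap.smul_apply, LinearMap.sum_apply,
    LinearMap.mk₂_apply]
  have : ∀ x y : E, u x * u y - u y * u x = 0 := fun x y => by ring
  simp only [this, Finset.sum_const_zero, smul_zero]

theorem Omega_swap (u v : E → ℝ) : G.Omega v u = -G.Omega u v := by
  have h := G.Omega_self (u + v)
  simp only [map_add, LinearMap.add_apply, G.Omega_self] at h
  linarith

/-! ### Tangent vectors with constant perimeters -/

theorem perimeter_apply (i : Fin n) (u : E → ℝ) :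
    G.perimeter i u = ∑ e, if G.MarksHole i e then u e else 0 := by
  simp only [perimeter, LinearMap.sum_apply]
  refine Finset.sum_congr rfl fun e _ => ?_
  split_ifs <;> rfl

theorem perimeter_eq_sum_cycle {i : Fin n} {e : E} (h : G.MarksHole i e) (u : E → ℝ) :
    G.perimeter i u = ∑ x ∈ cycle G.σinf e, u x := by
  rw [perimeter_apply, ← Finset.sum_filter]
  refine Finset.sum_congr ?_ fun _ _ => rfl
  ext x
  simp only [Finset.mem_filter, Finset.mem_univ, true_and, mem_cycle]
  rw [EnrichedData.MarksHole, h, Sum.inl.injEq, G.holeOf_eq_iff]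

theorem zeroSum_iff (u : E → ℝ) : ZeroSum G.σinf u ↔ ∀ i, G.perimeter i u = 0 := by
  constructor
  · intro h i
    rcases hi : G.mark i with hl | c
    · obtain ⟨e, rfl⟩ := G.exists_holeOf hl
      rw [G.perimeter_eq_sum_cycle hi, h]
    · rw [perimeter_apply]
      refine Finset.sum_eq_zero fun e _ => if_neg ?_
      rw [EnrichedData.MarksHole, hi]
      simp
  · intro h e
    obtain ⟨i, hi, -⟩ := G.hole_marked (G.holeOf e)
    rw [← G.perimeter_eq_sum_cycle hi, h]

/-- Functions on oriented edges that are invariant under reversal. -/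
def symmetric : Submodule ℝ (E → ℝ) where
  carrier := {u | ∀ e, u (G.σ₁ e) = u e}
  add_mem' hu hv e := by simp only [Pi.add_apply, hu e, hv e]
  zero_mem' _ := rfl
  smul_mem' c u hu e := by simp only [Pi.smul_apply, hu e]

omit [Fintype E] in
theorem mem_symmetric {u : E → ℝ} : u ∈ G.symmetric ↔ ∀ e, u (G.σ₁ e) = u e := Iff.rfl

/-- The map of all perimeters. -/
def perimeters : (E → ℝ) →ₗ[ℝ] (Fin n → ℝ) := LinearMap.pi G.perimeter

theorem perimeters_apply (u : E → ℝ) (i : Fin n) : G.perimeters u i = G.perimeter i u := rfl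

/-- The tangent vectors of the space of metrics with variation of the perimeters in `D`. -/
def tangentIn (D : Submodule ℝ (Fin n → ℝ)) : Submodule ℝ (E → ℝ) :=
  G.symmetric ⊓ D.comap G.perimeters

theorem mem_tangentIn {D : Submodule ℝ (Fin n → ℝ)} {u : E → ℝ} :
    u ∈ G.tangentIn D ↔ u ∈ G.symmetric ∧ G.perimeters u ∈ D := Iff.rfl

theorem mem_tangentIn_bot {u : E → ℝ} :
    u ∈ G.tangentIn ⊥ ↔ u ∈ G.symmetric ∧ ZeroSum G.σinf u := by
  rw [mem_tangentIn, zeroSum_iff, Submodule.mem_bot, funext_iff]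
  rfl

theorem tangentIn_bot_le (D : Submodule ℝ (Fin n → ℝ)) : G.tangentIn ⊥ ≤ G.tangentIn D :=
  inf_le_inf le_rfl (Submodule.comap_mono bot_le)

omit [Fintype E] in
theorem σinf_inv_apply (e : E) : G.σinf⁻¹ e = G.σ₀ (G.σ₁ e) := by
  rw [Perm.inv_eq_iff_eq, RibbonGraph.σinf, Perm.mul_apply]
  simp [G.σ₁_invol]

omit [Fintype E] in
theorem Alternating.σinf_inv {G : EnrichedRibbonGraph g n E} {W : E → ℝ}
    (hW : G.toRibbonGraph.Alternating W) (e : E) : W (G.σinf⁻¹ e) = -W (G.σ₁ e) := by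
  rw [G.σinf_inv_apply, hW]

/-- The linear forms that vanish on the symmetric functions with zero perimeters are, after
symmetrization, symmetrizations of functions that are constant on the holes. -/
theorem exists_hole_function {k : E → ℝ}
    (hk : ∀ u ∈ G.tangentIn ⊥, ∑ e, k e * u e = 0) :
    ∃ c : E → ℝ, (∀ e, c (G.σinf e) = c e) ∧ ∀ e, k e + k (G.σ₁ e) = c e + c (G.σ₁ e) := by
  -- the functions `k` with this property form a subspace, and a form that annihilates this
  -- subspace is given by a symmetric function with zero perimeters
  let S : Submodule ℝ (E → ℝ) :=
    { carrier := {k | ∃ c : E → ℝ, (∀ e, c (G.σinf e) = c e) ∧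
        ∀ e, k e + k (G.σ₁ e) = c e + c (G.σ₁ e)}
      add_mem' := by
        rintro k k' ⟨c, hc, hk⟩ ⟨c', hc', hk'⟩
        refine ⟨c + c', fun e => by simp only [Pi.add_apply, hc, hc'], fun e => ?_⟩
        simp only [Pi.add_apply]
        linarith [hk e, hk' e]
      zero_mem' := ⟨0, fun _ => rfl, fun _ => rfl⟩
      smul_mem' := by
        rintro r k ⟨c, hc, hk⟩
        refine ⟨r • c, fun e => by simp only [Pi.smul_apply, hc], fun e => ?_⟩
        simp only [Pi.smul_apply, smul_eq_mul, ← mul_add, hk e] }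
  refine mem_of_forall_dual S k fun u hu => ?_
  have hu' : u ∈ G.tangentIn ⊥ := by
    rw [mem_tangentIn_bot]
    constructor
    · intro e
      have h1 := hu (Pi.single e 1 - Pi.single (G.σ₁ e) 1) ⟨0, fun _ => rfl, fun x => by
        have e1 : G.σ₁ x = G.σ₁ e ↔ x = e := G.σ₁.injective.eq_iff
        have e2 : G.σ₁ x = e ↔ x = G.σ₁ e :=
          ⟨fun h => by rw [← h, G.σ₁_invol], fun h => by rw [h, G.σ₁_invol]⟩
        simp only [Pi.sub_apply, Pi.single_apply, Pi.zero_apply, e1, e2]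
        ring⟩
      simp only [Pi.sub_apply, mul_sub, Finset.sum_sub_distrib, Pi.single_apply, mul_ite, mul_one,
        mul_zero, Finset.sum_ite_eq', Finset.mem_univ, if_true] at h1
      linarith
    · intro e
      have h1 := hu (fun x => if G.σinf.SameCycle e x then 1 else 0)
        ⟨fun x => if G.σinf.SameCycle e x then 1 else 0, fun x => by
          simp only [Perm.sameCycle_apply_right], fun x => rfl⟩
      simp only [mul_ite, mul_one, mul_zero] at h1
      rwa [← Finset.sum_filter] at h1
  rw [← hk u hu']
  exact Finset.sum_congr rfl fun e _ => mul_comm _ _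

/-- The radical of `Ω` on the symmetric functions with zero perimeters: its elements have
primitives that alternate around the vertices. -/
theorem exists_alternating_of_radical {w : E → ℝ} (hw : w ∈ G.tangentIn ⊥)
    (h : ∀ u ∈ G.tangentIn ⊥, G.Omega u w = 0) :
    ∃ W : E → ℝ, G.toRibbonGraph.Alternating W ∧ ∀ e, w e = W e - W (G.σinf⁻¹ e) := by
  obtain ⟨hs, h0⟩ := G.mem_tangentIn_bot.1 hw
  obtain ⟨V, hV⟩ := h0.exists_primitive
  obtain ⟨c, hc, hk⟩ := G.exists_hole_function (k := fun e => V e + V (G.σinf⁻¹ e))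
    fun u hu => by
      have h1 := h u hu
      rw [G.Omega_eq (G.mem_tangentIn_bot.1 hu).2 hV] at h1
      have h2 : ∑ e, u e * (V e + V (G.σinf⁻¹ e)) = 0 := by linarith
      rw [← h2]
      exact Finset.sum_congr rfl fun e _ => mul_comm _ _
  have hc' : ∀ e, c (G.σinf⁻¹ e) = c e := fun e => by
    rw [← hc (G.σinf⁻¹ e)]; simp
  refine ⟨fun e => V e - c e / 2, fun a => ?_, fun e => ?_⟩
  · have h1 := hk (G.σ₁ a)
    have h2 := hs (G.σ₁ a)
    have h3 : G.σinf⁻¹ (G.σ₁ a) = G.σ₀ a := by rw [G.σinf_inv_apply, G.σ₁_invol]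
    have h4 := hc' (G.σ₁ a)
    rw [G.σ₁_invol, hV, hV, h3] at h2
    simp only [G.σ₁_invol, h3] at h1
    rw [h3] at h4
    simp only
    rw [h4]
    linarith
  · simp only [hc']
    rw [hV]
    ring

end EnrichedRibbonGraph

end

section

variable {g n : ℕ} {E E' : Type}

/-! ### Corners -/

/-- Starting from `f a`, the permutation `p` reaches `z` without meeting the range of `f` again. For
a contraction of ribbon graphs, the collapsed oriented edge `z` then lies in the corner of the
contracted graph at `a`. -/
def IsCorner (p : Perm E) (f : E' → E) (a : E') (z : E) : Prop :=
  ∃ k : ℕ, (p ^ k) (f a) = z ∧ ∀ j, 0 < j → j ≤ k → (p ^ j) (f a) ∉ Set.range f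

theorem IsCorner.refl (p : Perm E) (f : E' → E) (a : E') : IsCorner p f a (f a) :=
  ⟨0, rfl, fun j h h' => by omega⟩

theorem IsCorner.sameCycle {p : Perm E} {f : E' → E} {a : E'} {z : E} (h : IsCorner p f a z) :
    p.SameCycle (f a) z := by
  obtain ⟨k, hk, -⟩ := h
  exact ⟨k, by simpa using hk⟩

theorem IsCorner.unique {p : Perm E} {f : E' → E} (hf : Function.Injective f) {a b : E'} {z : E}
    (ha : IsCorner p f a z) (hb : IsCorner p f b z) : a = b := by
  obtain ⟨k, rfl, hk⟩ := ha
  obtain ⟨l, hl, hl'⟩ := hb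
  wlog hkl : k ≤ l generalizing a b k l
  · exact (this l hl' k hl.symm hk (by omega)).symm
  obtain ⟨j, rfl⟩ := Nat.exists_eq_add_of_le hkl
  rw [pow_add, Perm.mul_apply, (p ^ k).injective.eq_iff] at hl
  rcases Nat.eq_zero_or_pos j with rfl | hj
  · exact hf hl.symm
  · exact absurd ⟨a, hl.symm⟩ (hl' j hj (by omega))

theorem isCorner_apply_iff {p : Perm E} {f : E' → E} {a : E'} {z : E} (hz : p z ∉ Set.range f) :
    IsCorner p f a (p z) ↔ IsCorner p f a z := by
  constructor
  · rintro ⟨k, hk, hk'⟩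
    obtain ⟨j, rfl⟩ : ∃ j, k = j + 1 := by
      refine ⟨k - 1, ?_⟩
      rcases Nat.eq_zero_or_pos k with rfl | h
      · exact absurd ⟨a, hk⟩ hz
      · omega
    rw [pow_succ', Perm.mul_apply, p.injective.eq_iff] at hk
    exact ⟨j, hk, fun i hi hij => hk' i hi (by omega)⟩
  · rintro ⟨k, rfl, hk'⟩
    refine ⟨k + 1, by rw [pow_succ', Perm.mul_apply], fun j hj hjk => ?_⟩
    rcases Nat.lt_or_ge k j with h | h
    · obtain rfl : j = k + 1 := by omega
      rwa [pow_succ', Perm.mul_apply]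
    · exact hk' j hj h

theorem FirstReturn.apply_eq {p : Perm E} {p' : Perm E'} {f : E' → E} (h : FirstReturn p p' f)
    {a : E'} {z : E} (ha : IsCorner p f a z) (hz : p z ∈ Set.range f) : p z = f (p' a) := by
  obtain ⟨k, rfl, hk⟩ := ha
  obtain ⟨l, hl0, hl, hl'⟩ := h.ret a
  have h1 : p ((p ^ k) (f a)) = (p ^ (k + 1)) (f a) := by rw [pow_succ', Perm.mul_apply]
  rw [h1] at hz ⊢
  rcases lt_trichotomy (k + 1) l with hlt | heq | hgt
  · exact absurd hz (hl' _ (by omega) hlt)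
  · rw [heq, hl]
  · exact absurd ⟨_, hl.symm⟩ (hk l hl0 (by omega))

theorem exists_isCorner [Finite E] {p : Perm E} {f : E' → E} {b : E'} {z : E}
    (hz : p.SameCycle (f b) z) : ∃ a, IsCorner p f a z := by
  obtain ⟨k, rfl⟩ := hz.exists_nat_pow_eq
  clear hz
  induction k with
  | zero => exact ⟨b, IsCorner.refl _ _ _⟩
  | succ k ih =>
    rw [pow_succ', Perm.mul_apply]
    obtain ⟨a, ha⟩ := ih
    by_cases hr : p ((p ^ k) (f b)) ∈ Set.range f
    · obtain ⟨c, hc⟩ := hr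
      exact ⟨c, hc ▸ IsCorner.refl _ _ _⟩
    · exact ⟨a, (isCorner_apply_iff hr).2 ha⟩

/-- The function on `E` whose value on all oriented edges in the corner at `a` is `W a`; it vanishes
on the cycles that do not meet the range of `f`. -/
def spread (p : Perm E) (f : E' → E) (W : E' → ℝ) (z : E) : ℝ :=
  if h : ∃ a, IsCorner p f a z then W h.choose else 0

theorem spread_of_isCorner {p : Perm E} {f : E' → E} (hf : Function.Injective f) (W : E' → ℝ)
    {a : E'} {z : E} (h : IsCorner p f a z) : spread p f W z = W a := by
  have h' : ∃ a, IsCorner p f a z := ⟨a, h⟩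
  rw [spread, dif_pos h', h'.choose_spec.unique hf h]

namespace FirstReturn

variable {p : Perm E} {p' : Perm E'} {f : E' → E}

theorem spread_apply (h : FirstReturn p p' f) (W : E' → ℝ) (a : E') : spread p f W (f a) = W a :=
  spread_of_isCorner h.injective W (IsCorner.refl _ _ _)

theorem spread_inv_of_notMem (h : FirstReturn p p' f) (W : E' → ℝ) {z : E}
    (hz : z ∉ Set.range f) : spread p f W (p⁻¹ z) = spread p f W z := by
  have hz' : p (p⁻¹ z) = z := by simp
  have key : ∀ a, IsCorner p f a z ↔ IsCorner p f a (p⁻¹ z) := fun a => by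
    rw [← isCorner_apply_iff (z := p⁻¹ z) (by rwa [hz']), hz']
  by_cases hc : ∃ a, IsCorner p f a z
  · obtain ⟨a, ha⟩ := hc
    rw [spread_of_isCorner h.injective W ha, spread_of_isCorner h.injective W ((key a).1 ha)]
  · have hc' : ¬ ∃ a, IsCorner p f a (p⁻¹ z) := fun ⟨a, ha⟩ => hc ⟨a, (key a).2 ha⟩
    rw [spread, spread, dif_neg hc, dif_neg hc']

theorem spread_inv_apply [Finite E] (h : FirstReturn p p' f) (W : E' → ℝ) (b : E') :
    spread p f W (p⁻¹ (f b)) = W (p'⁻¹ b) := by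
  have hz : p.SameCycle (f b) (p⁻¹ (f b)) := by
    rw [← Perm.sameCycle_apply_right]
    simpa using Perm.SameCycle.refl p (f b)
  obtain ⟨a, ha⟩ := exists_isCorner hz
  have h1 := h.apply_eq ha ⟨b, by simp⟩
  rw [spread_of_isCorner h.injective W ha]
  have h2 : p (p⁻¹ (f b)) = f b := by simp
  rw [h2] at h1
  rw [h.injective h1]
  simp

end FirstReturn

theorem extendByZero_apply {f : E' → E} (hf : Function.Injective f) (u : E' → ℝ) (a : E') :
    extendByZero f u (f a) = u a := hf.extend_apply u 0 a

theorem extendByZero_of_notMem {f : E' → E} (u : E' → ℝ) {z : E} (hz : z ∉ Set.range f) :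
    extendByZero f u z = 0 := Function.extend_apply' _ _ _ (by simpa using hz)

theorem FirstReturn.extendByZero_eq [Finite E] {p : Perm E} {p' : Perm E'} {f : E' → E}
    (h : FirstReturn p p' f) {w W : E' → ℝ} (hw : ∀ a, w a = W a - W (p'⁻¹ a)) (e : E) :
    extendByZero f w e = spread p f W e - spread p f W (p⁻¹ e) := by
  by_cases he : e ∈ Set.range f
  · obtain ⟨a, rfl⟩ := he
    rw [extendByZero_apply h.injective, h.spread_apply, h.spread_inv_apply, hw]
  · rw [extendByZero_of_notMem w he, h.spread_inv_of_notMem W he, sub_self]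

theorem sum_eq_sum_range_add [Fintype E] [Fintype E'] {f : E' → E} (hf : Function.Injective f)
    (F : E → ℝ) : ∑ e, F e = ∑ a, F (f a) + ∑ e, if e ∈ Set.range f then 0 else F e := by
  have h1 : ∑ a, F (f a) = ∑ e, if e ∈ Set.range f then F e else 0 := by
    rw [← Finset.sum_filter, ← Finset.sum_image (s := Finset.univ) (g := f) (f := F)
      (fun _ _ _ _ h => hf h)]
    refine Finset.sum_congr ?_ fun _ _ => rfl
    ext e
    simp
  rw [h1, ← Finset.sum_add_distrib]
  refine Finset.sum_congr rfl fun e _ => ?_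
  split_ifs <;> simp

/-- Extension by zero as a linear map. -/
def extendLin (f : E' → E) : (E' → ℝ) →ₗ[ℝ] (E → ℝ) := Function.ExtendByZero.linearMap ℝ f

theorem extendLin_apply (f : E' → E) (u : E' → ℝ) : extendLin f u = extendByZero f u := rfl

theorem extendLin_injective {f : E' → E} (hf : Function.Injective f) :
    Function.Injective (extendLin f) := by
  intro u v h
  funext a
  have h1 := congrFun h (f a)
  rwa [extendLin_apply, extendLin_apply, extendByZero_apply hf, extendByZero_apply hf] at h1

/-! ### Tangent vectors and the form `Ω` under contraction -/

namespace IsContraction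

variable {G : EnrichedRibbonGraph g n E} {G' : EnrichedRibbonGraph g n E'} {f : E' → E}

theorem extend_symmetric_iff (C : IsContraction G G' f) (u : E' → ℝ) :
    extendLin f u ∈ G.symmetric ↔ u ∈ G'.symmetric := by
  constructor
  · intro h a
    have h1 := h (f a)
    rwa [← C.σ₁, extendLin_apply, extendByZero_apply C.injective,
      extendByZero_apply C.injective] at h1
  · intro h e
    rw [extendLin_apply]
    by_cases he : e ∈ Set.range f
    · obtain ⟨a, rfl⟩ := he
      rw [← C.σ₁, extendByZero_apply C.injective, extendByZero_apply C.injective, h a]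
    · rw [extendByZero_of_notMem u he, extendByZero_of_notMem u (C.σ₁_notMem_range he)]

variable [Fintype E] [Fintype E']

theorem perimeter_extend (C : IsContraction G G' f) (i : Fin n) (u : E' → ℝ) :
    G.perimeter i (extendLin f u) = G'.perimeter i u := by
  rw [G.perimeter_apply, G'.perimeter_apply, sum_eq_sum_range_add C.injective]
  have h1 : ∀ e, (if e ∈ Set.range f then (0 : ℝ) else
      if G.MarksHole i e then extendLin f u e else 0) = 0 := fun e => by
    split_ifs with h1 h2
    · rfl
    · exact extendByZero_of_notMem u h1
    · rfl
  rw [Finset.sum_congr rfl fun e _ => h1 e, Finset.sum_const_zero, add_zero]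
  refine Finset.sum_congr rfl fun a _ => ?_
  rw [extendLin_apply, extendByZero_apply C.injective]
  simp only [C.marksHole i a]

theorem perimeters_extend (C : IsContraction G G' f) (u : E' → ℝ) :
    G.perimeters (extendLin f u) = G'.perimeters u :=
  funext fun i => C.perimeter_extend i u

theorem extend_mem_tangentIn_iff (C : IsContraction G G' f) {D : Submodule ℝ (Fin n → ℝ)}
    (u : E' → ℝ) : extendLin f u ∈ G.tangentIn D ↔ u ∈ G'.tangentIn D := by
  rw [G.mem_tangentIn, G'.mem_tangentIn, C.extend_symmetric_iff, C.perimeters_extend]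

theorem Omega_extend (C : IsContraction G G' f) {u w : E' → ℝ} (hu : u ∈ G'.tangentIn ⊥)
    (hw : w ∈ G'.tangentIn ⊥) : G.Omega (extendLin f u) (extendLin f w) = G'.Omega u w := by
  obtain ⟨W, hW⟩ := (G'.mem_tangentIn_bot.1 hw).2.exists_primitive
  rw [G'.Omega_eq (G'.mem_tangentIn_bot.1 hu).2 hW,
    G.Omega_eq (G.mem_tangentIn_bot.1 ((C.extend_mem_tangentIn_iff u).2 hu)).2
      (w := extendLin f w) (C.firstReturn.extendByZero_eq hW), sum_eq_sum_range_add C.injective]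
  have h1 : ∀ e, (if e ∈ Set.range f then (0 : ℝ) else
      extendLin f u e * (spread G.σinf f W e + spread G.σinf f W (G.σinf⁻¹ e))) = 0 := fun e => by
    split_ifs with h1
    · rfl
    · rw [extendLin_apply, extendByZero_of_notMem u h1, zero_mul]
  rw [Finset.sum_congr rfl fun e _ => h1 e, Finset.sum_const_zero, add_zero]
  congr 1
  refine Finset.sum_congr rfl fun a _ => ?_
  rw [extendLin_apply, extendByZero_apply C.injective, C.firstReturn.spread_apply,
    C.firstReturn.spread_inv_apply]

/-- Pairing with an element of the radical of the contracted graph only involves the lengths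
of the collapsed edges. -/
theorem Omega_extend_alternating (C : IsContraction G G' f) {u : E → ℝ} {w W : E' → ℝ}
    (hu : u ∈ G.tangentIn ⊥) (hW : G'.toRibbonGraph.Alternating W)
    (hw : ∀ e, w e = W e - W (G'.σinf⁻¹ e)) :
    G.Omega u (extendLin f w) =
      -(1 / 2) * ∑ e, if e ∈ Set.range f then 0 else u e * spread G.σinf f W e := by
  obtain ⟨hs, h0⟩ := G.mem_tangentIn_bot.1 hu
  rw [G.Omega_eq h0 (w := extendLin f w) (C.firstReturn.extendByZero_eq hw),
    sum_eq_sum_range_add C.injective]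
  have h1 : ∑ a, u (f a) * (spread G.σinf f W (f a) + spread G.σinf f W (G.σinf⁻¹ (f a))) = 0 := by
    have h2 : ∀ a, u (f a) * (spread G.σinf f W (f a) + spread G.σinf f W (G.σinf⁻¹ (f a))) =
        u (f a) * W a - u (f (G'.σ₁ a)) * W (G'.σ₁ a) := fun a => by
      rw [C.firstReturn.spread_apply, C.firstReturn.spread_inv_apply,
        EnrichedRibbonGraph.Alternating.σinf_inv hW, C.σ₁, hs]
      ring
    rw [Finset.sum_congr rfl fun a _ => h2 a, Finset.sum_sub_distrib,
      Equiv.sum_comp G'.σ₁ (fun a => u (f a) * W a), sub_self]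
  have h3 : ∀ e, (if e ∈ Set.range f then (0 : ℝ) else
      u e * (spread G.σinf f W e + spread G.σinf f W (G.σinf⁻¹ e))) =
      2 * if e ∈ Set.range f then 0 else u e * spread G.σinf f W e := fun e => by
    split_ifs with h
    · ring
    · rw [C.firstReturn.spread_inv_of_notMem W h]
      ring
  rw [h1, Finset.sum_congr rfl fun e _ => h3 e, ← Finset.mul_sum]
  ring

end IsContraction

namespace EnrichedRibbonGraph

variable (G : EnrichedRibbonGraph g n E)

/-- The function on oriented edges with value `c i` on the hole marked by `x_i`. -/
def holeFun (c : Fin n → ℝ) (e : E) : ℝ := ∑ i, if G.MarksHole i e then c i else 0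

theorem holeFun_eq_of_sameCycle (c : Fin n → ℝ) {x y : E} (h : G.σinf.SameCycle x y) :
    G.holeFun c x = G.holeFun c y := by
  unfold holeFun EnrichedData.MarksHole
  rw [(G.holeOf_eq_iff x y).2 h]

theorem holeFun_of_marksHole {c : Fin n → ℝ} {i : Fin n} {e : E} (h : G.MarksHole i e) :
    G.holeFun c e = c i := by
  unfold holeFun
  rw [Finset.sum_eq_single i]
  · rw [if_pos h]
  · intro j _ hj
    exact if_neg fun hj' => hj ((G.hole_marked _).unique hj' h)
  · simp

variable [Fintype E]

theorem sum_mul_perimeter (c : Fin n → ℝ) (u : E → ℝ) :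
    ∑ i, c i * G.perimeter i u = ∑ e, G.holeFun c e * u e := by
  simp only [G.perimeter_apply, holeFun, Finset.mul_sum, Finset.sum_mul]
  rw [Finset.sum_comm]
  refine Finset.sum_congr rfl fun e _ => Finset.sum_congr rfl fun i _ => ?_
  split_ifs <;> simp

/-- A linear relation between the perimeters gives an alternating function. -/
theorem alternating_holeFun {c : Fin n → ℝ}
    (hc : ∀ u ∈ G.symmetric, ∑ i, c i * G.perimeter i u = 0) :
    G.toRibbonGraph.Alternating (G.holeFun c) := by
  intro a
  have h1 := hc (Pi.single a 1 + Pi.single (G.σ₁ a) 1) fun x => by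
    have e1 : G.σ₁ x = G.σ₁ a ↔ x = a := G.σ₁.injective.eq_iff
    have e2 : G.σ₁ x = a ↔ x = G.σ₁ a :=
      ⟨fun h => by rw [← h, G.σ₁_invol], fun h => by rw [h, G.σ₁_invol]⟩
    simp only [Pi.add_apply, Pi.single_apply, e1, e2]
    ring
  rw [G.sum_mul_perimeter] at h1
  simp only [Pi.add_apply, mul_add, Finset.sum_add_distrib, Pi.single_apply, mul_ite, mul_one,
    mul_zero, Finset.sum_ite_eq', Finset.mem_univ, if_true] at h1
  have h2 : G.holeFun c (G.σ₀ a) = G.holeFun c (G.σ₁ a) := by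
    refine G.holeFun_eq_of_sameCycle c ?_
    rw [← Perm.sameCycle_apply_left, RibbonGraph.σinf, Perm.mul_apply]
    simpa using Perm.SameCycle.refl _ _
  rw [h2]
  linarith

end EnrichedRibbonGraph

theorem IsContraction.sum_mul_perimeter [Fintype E] [Fintype E'] {G : EnrichedRibbonGraph g n E}
    {G' : EnrichedRibbonGraph g n E'} {f : E' → E} (C : IsContraction G G' f)
    (hC : ∀ z, ∃ b, G.σinf.SameCycle (f b) z) (c : Fin n → ℝ) (u : E → ℝ) :
    ∑ i, c i * G.perimeter i u = ∑ a, G'.holeFun c a * u (f a) +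
      ∑ e, if e ∈ Set.range f then 0 else u e * spread G.σinf f (G'.holeFun c) e := by
  have h0 : ∀ a, G.holeFun c (f a) = G'.holeFun c a := fun a => by
    unfold EnrichedRibbonGraph.holeFun
    simp only [C.marksHole]
  rw [G.sum_mul_perimeter, sum_eq_sum_range_add C.injective]
  congr 1
  · exact Finset.sum_congr rfl fun a _ => by rw [h0]
  · refine Finset.sum_congr rfl fun e _ => ?_
    split_ifs with h
    · rfl
    · obtain ⟨b, hb⟩ := hC e
      obtain ⟨a, ha⟩ := exists_isCorner hb
      rw [spread_of_isCorner C.injective _ ha, ← h0, G.holeFun_eq_of_sameCycle c ha.sameCycle,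
        mul_comm]

/-! ### Corners of rotated graphs -/

theorem Over.spread_rotate {G' : EnrichedRibbonGraph g n E'} [Nonempty E'] {τ : Perm E'}
    (x : Over G') (H : IsTurn G'.toRibbonGraph τ) (W : E' → ℝ) {z : Fin x.N}
    (hz : z ∉ Set.range x.map) :
    spread (x.rotate H).graph.σinf (x.rotate H).map W z =
      spread x.graph.σinf x.map (fun a => W (τ a)) z := by
  have hf := x.isContraction.injective
  by_cases h : ∃ a, IsCorner x.graph.σinf x.map a z
  · obtain ⟨a, ha⟩ := h
    rw [spread_of_isCorner hf _ ha]
    refine spread_of_isCorner hf W ?_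
    obtain ⟨k, rfl, hk⟩ := ha
    have key := fun j hjk => x.isContraction.conj_σinf_pow (extendPerm_apply hf τ)
      (extendPerm_of_notMem hf τ) a j fun i hi hij => hk i hi (le_trans hij hjk)
    refine ⟨k, ?_, fun j hj hjk => ?_⟩
    · exact (key k le_rfl).trans (extendPerm_of_notMem hf τ _ hz)
    · have h1 := extendPerm_of_notMem hf τ _ (hk j hj hjk)
      change ((x.graph.conj _).σinf ^ j) (x.map (τ a)) ∉ _
      rw [key j hjk, h1]
      exact hk j hj hjk
  · have h1 : ∀ y, x.graph.σinf.SameCycle z y → y ∉ x.map '' Set.univ := by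
      rintro _ hy ⟨b, -, rfl⟩
      exact h (exists_isCorner hy.symm)
    have h2 : ¬ ∃ a, IsCorner (x.rotate H).graph.σinf (x.rotate H).map a z := by
      rintro ⟨a, ha⟩
      exact ((x.isRotation H).disjoint_iff z).2 h1 _ ha.sameCycle.symm ⟨a, trivial, rfl⟩
    unfold spread
    rw [dif_neg h, dif_neg h2]

theorem Over.spread_rotate_alternating {G' : EnrichedRibbonGraph g n E'} [Nonempty E']
    {τ : Perm E'} (x : Over G') (H : IsTurn G'.toRibbonGraph τ) {W : E' → ℝ}
    (hW : G'.toRibbonGraph.Alternating W) {z : Fin x.N} (hz : z ∉ Set.range x.map) :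
    spread (x.rotate H).graph.σinf (x.rotate H).map W z = -spread x.graph.σinf x.map W z := by
  rw [x.spread_rotate H W hz]
  simp only [H.flip W hW]
  unfold spread
  split_ifs <;> simp

end

section

/-! ### Pfaffians -/

/-- The sum `∑_σ sgn σ ∏_a A (σ (a, 0)) (σ (a, 1))`, a positive multiple of the Pfaffian of `A`. -/
def pfaffian (d : ℕ) (A : Fin d × Fin 2 → Fin d × Fin 2 → ℝ) : ℝ :=
  ∑ σ : Perm (Fin d × Fin 2), ((Perm.sign σ : ℤ) : ℝ) * ∏ a : Fin d, A (σ (a, 0)) (σ (a, 1))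

/-- If the row `q` of `A` vanishes except at `p`, then the Pfaffian is odd in the entry at `(p, q)`,
and does not depend on the other entries of the row `p`. -/
theorem pfaffian_neg {d : ℕ} {A A' : Fin d × Fin 2 → Fin d × Fin 2 → ℝ} {p q : Fin d × Fin 2}
    (hpq : p ≠ q) (hA : ∀ i j, A j i = -A i j) (hA' : ∀ i j, A' j i = -A' i j)
    (h : ∀ i j, i ≠ p → j ≠ p → A' i j = A i j) (hq : ∀ i, i ≠ p → A q i = 0)
    (hp : A' p q = -A p q) : pfaffian d A' = -pfaffian d A := by
  unfold pfaffian
  rw [← Finset.sum_neg_distrib]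
  refine Finset.sum_congr rfl fun σ _ => ?_
  rw [← mul_neg]
  congr 1
  obtain ⟨⟨a, b⟩, hab⟩ := σ.surjective q
  rw [← Finset.mul_prod_erase _ _ (Finset.mem_univ a),
    ← Finset.mul_prod_erase _ (fun a => A (σ (a, 0)) (σ (a, 1))) (Finset.mem_univ a)]
  have hother : ∀ c : Fin d × Fin 2, σ c = p → c.1 = a → ∏ a ∈ Finset.univ.erase a,
      A' (σ (a, 0)) (σ (a, 1)) = ∏ a ∈ Finset.univ.erase a, A (σ (a, 0)) (σ (a, 1)) := by
    rintro c hc rfl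
    refine Finset.prod_congr rfl fun x hx => h _ _ ?_ ?_
    · exact fun hh => Finset.ne_of_mem_erase hx
        (congrArg Prod.fst (σ.injective (hh.trans hc.symm)))
    · exact fun hh => Finset.ne_of_mem_erase hx
        (congrArg Prod.fst (σ.injective (hh.trans hc.symm)))
  fin_cases b
  · simp only [Fin.zero_eta] at hab
    rw [hab]
    by_cases h1 : σ (a, 1) = p
    · rw [hother _ h1 rfl, h1, hA' p q, hp, hA p q]
      ring
    · rw [h _ _ hpq.symm h1, hq _ h1]
      ring
  · simp only [Fin.mk_one] at hab
    rw [hab]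
    by_cases h1 : σ (a, 0) = p
    · rw [hother _ h1 rfl, h1, hp]
      ring
    · rw [h _ _ h1 hpq.symm, hA q, hq _ h1]
      ring

/-- The Gram matrix of a symplectic basis. -/
def symplecticGram (d : ℕ) (x y : Fin d × Fin 2) : ℝ :=
  if x.1 = y.1 then (if x.2 = y.2 then 0 else if x.2 = 0 then 1 else -1) else 0

theorem pfaffian_symplecticGram_pos (d : ℕ) : 0 < pfaffian d (symplecticGram d) := by
  unfold pfaffian
  -- a nonzero term permutes the pairs and swaps some of them; the signs of the swaps occur twice
  have key : ∀ σ : Perm (Fin d × Fin 2), 0 ≤ ((Perm.sign σ : ℤ) : ℝ) *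
      ∏ a : Fin d, symplecticGram d (σ (a, 0)) (σ (a, 1)) := by
    intro σ
    by_cases h0 : ∏ a : Fin d, symplecticGram d (σ (a, 0)) (σ (a, 1)) = 0
    · rw [h0, mul_zero]
    have h1 : ∀ a, (σ (a, 0)).1 = (σ (a, 1)).1 ∧ (σ (a, 0)).2 ≠ (σ (a, 1)).2 := by
      intro a
      have h2 := (Finset.prod_ne_zero_iff.1 h0) a (Finset.mem_univ a)
      unfold symplecticGram at h2
      by_cases h3 : (σ (a, 0)).1 = (σ (a, 1)).1
      · refine ⟨h3, fun h4 => h2 ?_⟩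
        rw [if_pos h3, if_pos h4]
      · exact absurd (if_neg h3) h2
    let s : Fin d → Perm (Fin 2) := fun a => if (σ (a, 0)).2 = 0 then 1 else Equiv.swap 0 1
    have hs : ∀ a, symplecticGram d (σ (a, 0)) (σ (a, 1)) = ((Perm.sign (s a) : ℤ) : ℝ) := by
      intro a
      unfold symplecticGram
      rw [if_pos (h1 a).1, if_neg (h1 a).2]
      simp only [s]
      split_ifs <;> simp
    let κ : Perm (Fin d × Fin 2) := Equiv.prodCongrRight s
    have hκ : Perm.sign κ = ∏ a, Perm.sign (s a) := Equiv.Perm.sign_prodCongrRight s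
    have hσκ : ∀ a b, σ (κ (a, b)) = ((σ (a, 0)).1, b) := by
      intro a b
      have e1 : κ (a, b) = (a, s a b) := rfl
      rw [e1]
      obtain ⟨h2, h3⟩ := h1 a
      by_cases h4 : (σ (a, 0)).2 = 0
      · have h5 : s a b = b := by simp [s, h4]
        rw [h5]
        fin_cases b
        · exact Prod.ext rfl h4
        · refine Prod.ext h2.symm ?_
          rw [h4] at h3
          simp only [Fin.mk_one]
          omega
      · have h5 : s a b = Equiv.swap 0 1 b := by simp [s, h4]
        rw [h5]
        fin_cases b
        · simp only [Fin.zero_eta, Equiv.swap_apply_left]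
          refine Prod.ext h2.symm ?_
          simp only
          omega
        · simp only [Fin.mk_one, Equiv.swap_apply_right]
          refine Prod.ext rfl ?_
          simp only
          omega
    have hinj : Function.Injective fun a => (σ (a, 0)).1 := by
      intro a a' haa
      have h2 : σ (κ (a, 0)) = σ (κ (a', 0)) := by
        rw [hσκ, hσκ]
        exact congrArg (·, (0 : Fin 2)) haa
      exact congrArg Prod.fst (κ.injective (σ.injective h2))
    let π : Perm (Fin d) := Equiv.ofBijective _ (Finite.injective_iff_bijective.1 hinj)
    have hπ : σ * κ = Equiv.prodCongrLeft fun _ : Fin 2 => π := by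
      ext ⟨a, b⟩ <;> simp only [Perm.mul_apply, hσκ] <;> rfl
    have hsign : Perm.sign σ * Perm.sign κ = 1 := by
      rw [← Perm.sign_mul, hπ, Equiv.Perm.sign_prodCongrLeft]
      simp
    rw [Finset.prod_congr rfl fun a _ => hs a]
    have h2 : ∏ a, ((Perm.sign (s a) : ℤ) : ℝ) = ((Perm.sign κ : ℤ) : ℝ) := by
      rw [hκ]
      push_cast
      rfl
    rw [h2, ← Int.cast_mul, ← Units.val_mul, hsign]
    simp
  refine Finset.sum_pos' (fun σ _ => key σ) ⟨1, Finset.mem_univ _, ?_⟩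
  simp [symplecticGram]

variable {V : Type} [AddCommGroup V] [Module ℝ V]

/-- A subspace on which an alternating form is nondegenerate contains symplectic families. -/
theorem exists_symplectic [FiniteDimensional ℝ V] (ω : V →ₗ[ℝ] V →ₗ[ℝ] ℝ) (hω : ∀ x, ω x x = 0)
    (d : ℕ) (T : Submodule ℝ V) (hT : ∀ w ∈ T, (∀ u ∈ T, ω u w = 0) → w = 0)
    (hd : 2 * d ≤ Module.finrank ℝ T) :
    ∃ x : Fin d × Fin 2 → V, (∀ i, x i ∈ T) ∧ ∀ i j, ω (x i) (x j) = symplecticGram d i j := by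
  have hskew : ∀ x y, ω y x = -ω x y := fun x y => by
    have := hω (x + y)
    simp only [map_add, LinearMap.add_apply, hω] at this
    linarith
  induction d generalizing T with
  | zero => exact ⟨fun i => i.1.elim0, fun i => i.1.elim0, fun i => i.1.elim0⟩
  | succ d ih =>
    have hne : T ≠ ⊥ := by
      rintro rfl
      rw [finrank_bot] at hd
      omega
    obtain ⟨f, hf, hf0⟩ := Submodule.exists_mem_ne_zero_of_ne_bot hne
    obtain ⟨u, hu, huf⟩ : ∃ u ∈ T, ω u f ≠ 0 := by
      by_contra hcon
      push Not at hcon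
      exact hf0 (hT f hf hcon)
    set e : V := (ω u f)⁻¹ • u with he
    have heT : e ∈ T := T.smul_mem _ hu
    have hef : ω e f = 1 := by
      rw [he, map_smul, LinearMap.smul_apply, smul_eq_mul, inv_mul_cancel₀ huf]
    have hfe : ω f e = -1 := by rw [hskew, hef]
    set T' : Submodule ℝ V := T ⊓ LinearMap.ker ((ω e).prod (ω f)) with hT'
    have hmem : ∀ x, x ∈ T' ↔ x ∈ T ∧ ω e x = 0 ∧ ω f x = 0 := fun x => by
      rw [hT', Submodule.mem_inf, LinearMap.mem_ker, LinearMap.prod_apply]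
      simp
    have hdim : 2 * d ≤ Module.finrank ℝ T' := by
      have h1 := LinearMap.finrank_range_add_finrank_ker (((ω e).prod (ω f)).domRestrict T)
      have h2 : Module.finrank ℝ (LinearMap.range (((ω e).prod (ω f)).domRestrict T)) ≤ 2 :=
        (Submodule.finrank_le _).trans (by simp)
      have h3 : Module.finrank ℝ (LinearMap.ker (((ω e).prod (ω f)).domRestrict T)) =
          Module.finrank ℝ T' := by
        rw [LinearMap.ker_domRestrict, hT', ← Submodule.map_comap_subtype,
          Submodule.finrank_map_subtype_eq]
      omega
    obtain ⟨x, hx, hxx⟩ := ih T' (fun w hw hwu => by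
      obtain ⟨hwT, hwe, hwf⟩ := (hmem w).1 hw
      refine hT w hwT fun y hy => ?_
      have h1 := hwu (y + ω f y • e - ω e y • f) ((hmem _).2
        ⟨T.sub_mem (T.add_mem hy (T.smul_mem _ heT)) (T.smul_mem _ hf), by
          simp [hω, hef], by simp [hω, hfe]⟩)
      simpa [hwe, hwf] using h1) hdim
    refine ⟨fun i => Fin.cases (if i.2 = 0 then e else f) (fun a => x (a, i.2)) i.1, ?_, ?_⟩
    · rintro ⟨a, b⟩
      refine Fin.cases ?_ (fun a => ?_) a
      · simp only [Fin.cases_zero]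
        split_ifs
        · exact heT
        · exact hf
      · exact ((hmem _).1 (hx (a, b))).1
    · rintro ⟨a, b⟩ ⟨a', b'⟩
      have hz : ∀ i, ω e (x i) = 0 ∧ ω f (x i) = 0 := fun i => ((hmem _).1 (hx i)).2
      have hz' : ∀ i, ω (x i) e = 0 ∧ ω (x i) f = 0 := fun i => by
        rw [hskew e, hskew f, (hz i).1, (hz i).2, neg_zero]
        exact ⟨rfl, rfl⟩
      refine Fin.cases ?_ (fun a => ?_) a <;> refine Fin.cases ?_ (fun a' => ?_) a'
      · fin_cases b <;> fin_cases b' <;> simp [symplecticGram, hω, hef, hfe]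
      · fin_cases b <;> simp [symplecticGram, (hz _).1, (hz _).2, (Fin.succ_ne_zero _).symm]
      · fin_cases b' <;> simp [symplecticGram, (hz' _).1, (hz' _).2, Fin.succ_ne_zero]
      · simp only [Fin.cases_succ, hxx, symplecticGram, Fin.succ_inj]

/-- An alternating form on a space of odd dimension is degenerate. -/
theorem exists_radical_of_odd [FiniteDimensional ℝ V] (ω : V →ₗ[ℝ] V →ₗ[ℝ] ℝ)
    (hω : ∀ x y, ω y x = -ω x y) (S : Submodule ℝ V) (hS : Odd (Module.finrank ℝ S)) :
    ∃ ρ ∈ S, ρ ≠ 0 ∧ ∀ u ∈ S, ω u ρ = 0 := by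
  set b := Module.finBasis ℝ S
  let A : Matrix (Fin (Module.finrank ℝ S)) (Fin (Module.finrank ℝ S)) ℝ :=
    Matrix.of fun i j => ω (b i) (b j)
  have hA : A.transpose = -A := by
    ext i j
    simp only [A, Matrix.transpose_apply, Matrix.of_apply, Matrix.neg_apply]
    exact hω _ _
  have hdet : A.det = 0 := by
    have h1 : A.det = -A.det := by
      conv_lhs => rw [← Matrix.det_transpose, hA, Matrix.det_neg, Fintype.card_fin, hS.neg_one_pow]
      ring
    linarith
  obtain ⟨v, hv, hAv⟩ := Matrix.exists_mulVec_eq_zero_iff.2 hdet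
  refine ⟨(∑ j, v j • b j : S), Subtype.coe_prop _, fun h0 => hv ?_, fun u hu => ?_⟩
  · have h1 : ∑ j, v j • b j = 0 := Subtype.ext h0
    exact funext fun j => (Fintype.linearIndependent_iff.1 b.linearIndependent) v h1 j
  · have h1 : ∀ i, ω (b i) (∑ j, v j • b j : S) = 0 := fun i => by
      have h2 := congrFun hAv i
      simp only [Matrix.mulVec, dotProduct, A, Matrix.of_apply, Pi.zero_apply] at h2
      rw [← h2]
      simp only [Submodule.coe_sum, Submodule.coe_smul, map_sum, map_smul, smul_eq_mul]
      exact Finset.sum_congr rfl fun j _ => mul_comm _ _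
    have h2 : u = (∑ i, b.repr ⟨u, hu⟩ i • b i : S) := by rw [b.sum_repr]
    generalize (∑ j, v j • b j : S) = ρ at h1 ⊢
    rw [h2]
    simp only [Submodule.coe_sum, Submodule.coe_smul, map_sum, map_smul, LinearMap.sum_apply,
      LinearMap.smul_apply, smul_eq_mul]
    exact Finset.sum_eq_zero fun i _ => by rw [h1 i, mul_zero]

/-! ### The form `ω^d ∧ η_0 ∧ ⋯ ∧ η_{q-1}` -/

/-- The form `ω^d ∧ η_0 ∧ ⋯ ∧ η_{q-1}` with arguments indexed by its factors. -/
def wedgeForm (d q : ℕ) (ω : V →ₗ[ℝ] V →ₗ[ℝ] ℝ) (η : Fin q → V →ₗ[ℝ] ℝ) :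
    V [⋀^(Fin d × Fin 2) ⊕ Fin q]→ₗ[ℝ] ℝ :=
  MultilinearMap.alternatization (wedgeProduct d q ω η)

theorem powerForm_apply (d q : ℕ) (ω : V →ₗ[ℝ] V →ₗ[ℝ] ℝ) (η : Fin q → V →ₗ[ℝ] ℝ)
    (x : Fin (d * 2 + q) → V) :
    powerForm d q ω η x = wedgeForm d q ω η fun i =>
      x (((Equiv.sumCongr finProdFinEquiv (Equiv.refl (Fin q))).trans finSumFinEquiv) i) := rfl

/-- If the one-forms vanish on the first `2d` vectors, the value of `ω^d ∧ η_0 ∧ ⋯ ∧ η_{q-1}` is the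
product of a Pfaffian and a determinant. -/
theorem wedgeForm_eq_mul (d q : ℕ) (ω : V →ₗ[ℝ] V →ₗ[ℝ] ℝ) (η : Fin q → V →ₗ[ℝ] ℝ)
    (y : (Fin d × Fin 2) ⊕ Fin q → V) (h : ∀ j p, η j (y (Sum.inl p)) = 0) :
    wedgeForm d q ω η y = pfaffian d (fun i j => ω (y (Sum.inl i)) (y (Sum.inl j))) *
      (Matrix.of fun i j => η j (y (Sum.inr i))).det := by
  have h0 : wedgeForm d q ω η y = ∑ σ : Perm ((Fin d × Fin 2) ⊕ Fin q),
      ((Perm.sign σ : ℤ) : ℝ) *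
        ((∏ a : Fin d, ω (y (σ (Sum.inl (a, 0)))) (y (σ (Sum.inl (a, 1))))) *
        ∏ j : Fin q, η j (y (σ (Sum.inr j)))) := by
    rw [wedgeForm, MultilinearMap.alternatization_apply]
    refine Finset.sum_congr rfl fun σ _ => ?_
    rw [Units.smul_def, zsmul_eq_mul]
    rfl
  rw [h0, pfaffian, Matrix.det_apply', Finset.sum_mul_sum, ← Finset.sum_product']
  symm
  refine Finset.sum_of_injOn (fun σ => Perm.sumCongr σ.1 σ.2) ?_ (fun _ _ => by simp) ?_ ?_
  · rintro ⟨σ₁, σ₂⟩ - ⟨τ₁, τ₂⟩ - hst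
    have h2 : ∀ x, Perm.sumCongr σ₁ σ₂ x = Perm.sumCongr τ₁ τ₂ x := DFunLike.congr_fun hst
    simp only [Sum.map_inr, Sum.map_inl, Perm.sumCongr_apply, Sum.forall, Sum.inl.injEq,
      Sum.inr.injEq] at h2
    exact Prod.ext (Equiv.ext h2.1) (Equiv.ext h2.2)
  · intro σ _ hσ
    -- some one-form is applied to one of the first `2d` vectors
    obtain ⟨j, p, hjp⟩ : ∃ j p, σ (Sum.inr j) = Sum.inl p := by
      by_contra hcon
      push Not at hcon
      have h1 : Set.MapsTo σ (Set.range (Sum.inr : Fin q → (Fin d × Fin 2) ⊕ Fin q))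
          (Set.range Sum.inr) := by
        rintro _ ⟨j, rfl⟩
        rcases hj : σ (Sum.inr j) with p | k
        · exact absurd hj (hcon j p)
        · exact ⟨k, rfl⟩
      have h2 := Perm.mem_sumCongrHom_range_of_perm_mapsTo_inl
        ((Perm.perm_mapsTo_inl_iff_mapsTo_inr σ).2 h1)
      obtain ⟨τ, hτ⟩ := h2
      exact hσ ⟨τ, by simp, hτ⟩
    rw [Finset.prod_eq_zero (Finset.mem_univ j) (by rw [hjp, h]), mul_zero, mul_zero]
  · rintro ⟨σ₁, σ₂⟩ -
    simp only [Perm.sumCongr_apply, Sum.map_inl, Sum.map_inr, Perm.sign_sumCongr, Units.val_mul,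
      Int.cast_mul, Matrix.of_apply]
    ring

end

section

/-! ### Nonvanishing of the top forms -/

section LinearAlgebra

variable {V : Type} [AddCommGroup V] [Module ℝ V]

theorem alternating_ne_zero_of_mem_span {k : ℕ} (F : V [⋀^Fin k]→ₗ[ℝ] ℝ) {v y : Fin k → V}
    (hy : ∀ i, y i ∈ Submodule.span ℝ (Set.range v)) (h : F y ≠ 0) : F v ≠ 0 := by
  choose A hA using fun i => (Submodule.mem_span_range_iff_exists_fun ℝ).1 (hy i)
  have h1 : y = fun i => ∑ j, (Matrix.of A) i j • v j := funext fun i => (hA i).symm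
  intro h0
  rw [h1, alternating_matrix, h0, mul_zero] at h
  exact h rfl

/-- `ω^d ∧ η_0 ∧ ⋯ ∧ η_{q-1}` does not vanish on a space on which the `η_j` are independent, if `ω`
is nondegenerate on a subspace of dimension `2d` of their common kernel. -/
theorem powerForm_ne_zero [FiniteDimensional ℝ V] {d q : ℕ} (ω : V →ₗ[ℝ] V →ₗ[ℝ] ℝ)
    (η : Fin q → V →ₗ[ℝ] ℝ) (hω : ∀ x, ω x x = 0) {S T : Submodule ℝ V} (hST : S ≤ T)
    (hS : ∀ w ∈ S, (∀ u ∈ S, ω u w = 0) → w = 0) (hd : 2 * d ≤ Module.finrank ℝ S)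
    (hη : ∀ j, ∀ u ∈ S, η j u = 0) (ht : ∀ j, ∃ t ∈ T, ∀ i, η i t = if i = j then 1 else 0)
    {v : Fin (d * 2 + q) → V} (hv : T ≤ Submodule.span ℝ (Set.range v)) :
    powerForm d q ω η v ≠ 0 := by
  obtain ⟨x, hx, hxx⟩ := exists_symplectic ω hω d S hS hd
  choose t htT htη using ht
  set ε := (Equiv.sumCongr finProdFinEquiv (Equiv.refl (Fin q))).trans
    (finSumFinEquiv (m := d * 2) (n := q)) with hε
  refine alternating_ne_zero_of_mem_span _ (y := fun i => Sum.elim x t (ε.symm i))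
    (fun i => hv ?_) ?_
  · rcases ε.symm i with p | j
    · exact hST (hx p)
    · exact htT j
  · rw [powerForm_apply, ← hε]
    simp only [Equiv.symm_apply_apply]
    rw [wedgeForm_eq_mul _ _ _ _ _ fun j p => hη j _ (hx p)]
    have h1 : (Matrix.of fun i j => η j (Sum.elim x t (Sum.inr i))) =
        (1 : Matrix (Fin q) (Fin q) ℝ) := by
      ext i j
      simp only [Matrix.of_apply, Sum.elim_inr, htη, Matrix.one_apply]
      exact if_congr eq_comm rfl rfl
    have h2 : (fun i j => ω (Sum.elim x t (Sum.inl i)) (Sum.elim x t (Sum.inl j))) =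
        symplecticGram d := by
      funext i j
      exact hxx i j
    rw [h1, Matrix.det_one, mul_one, h2]
    exact (pfaffian_symplecticGram_pos d).ne'

end LinearAlgebra

variable {g n : ℕ} {E E' : Type}

/-! ### Tangent spaces of cells -/

/-- `B` is a set of perimeters that is relatively open in a translate of `D`, and the same
coordinates are positive at all of its points. -/
structure PerimeterSet (B : Set (Fin n → ℝ)) (D : Submodule ℝ (Fin n → ℝ)) : Prop where
  sub_mem : ∀ p ∈ B, ∀ q ∈ B, p - q ∈ D
  small : ∀ p ∈ B, ∀ v ∈ D, ∃ ε : ℝ, 0 < ε ∧ ∀ t, 0 ≤ t → t ≤ ε → p + t • v ∈ B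
  pos : ∀ p ∈ B, ∀ q ∈ B, ∀ i, 0 < p i → 0 < q i

theorem exists_small_of_pos {ι : Type} [Finite ι] (x u : ι → ℝ) (hx : ∀ i, 0 < x i) :
    ∃ ε : ℝ, 0 < ε ∧ ∀ t, 0 ≤ t → t ≤ ε → ∀ i, 0 < (x + t • u) i := by
  have h1 : ∀ᶠ t in nhds (0 : ℝ), ∀ i, 0 < (x + t • u) i := by
    refine Filter.eventually_all.2 fun i => ?_
    have h2 : Continuous fun t : ℝ => (x + t • u) i := by
      simp only [Pi.add_apply, Pi.smul_apply, smul_eq_mul]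
      fun_prop
    exact h2.continuousAt.eventually (lt_mem_nhds (by simpa using hx i))
  obtain ⟨ε, hε, h⟩ := Metric.eventually_nhds_iff.1 h1
  refine ⟨ε / 2, by positivity, fun t h0 ht => h ?_⟩
  rw [Real.dist_eq, sub_zero, abs_of_nonneg h0]
  linarith

theorem perimeterSet_singleton (p : Fin n → ℝ) : PerimeterSet {p} ⊥ where
  sub_mem a ha b hb := by
    obtain rfl : a = p := ha
    obtain rfl : b = a := hb
    simp
  small a ha v hv := by
    obtain rfl : v = 0 := hv
    exact ⟨1, one_pos, fun t _ _ => by simpa using ha⟩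
  pos a ha b hb i h := by
    obtain rfl : a = p := ha
    obtain rfl : b = a := hb
    exact h

theorem perimeterSet_pos : PerimeterSet {p : Fin n → ℝ | ∀ i, 0 < p i} ⊤ where
  sub_mem _ _ _ _ := trivial
  small p hp v _ := exists_small_of_pos p v hp
  pos _ _ _ hq i _ := hq i

namespace EnrichedRibbonGraph

variable [Fintype E] (G : EnrichedRibbonGraph g n E) {B : Set (Fin n → ℝ)}
  {D : Submodule ℝ (Fin n → ℝ)}

theorem exists_small_mem_openCell (hB : PerimeterSet B D) {x u : E → ℝ} (hx : x ∈ G.openCell B)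
    (hu : u ∈ G.tangentIn D) : ∃ ε : ℝ, 0 < ε ∧ x + ε • u ∈ G.openCell B := by
  obtain ⟨h1, h2, h3⟩ := hx
  obtain ⟨ε₁, hε₁, h4⟩ := exists_small_of_pos x u h2
  obtain ⟨ε₂, hε₂, h5⟩ := hB.small _ h3 _ hu.2
  refine ⟨min ε₁ ε₂, lt_min hε₁ hε₂, fun e => ?_, fun e => ?_, ?_⟩
  · simp only [Pi.add_apply, Pi.smul_apply, h1 e, hu.1 e]
  · exact h4 _ (lt_min hε₁ hε₂).le (min_le_left _ _) e
  · convert h5 _ (lt_min hε₁ hε₂).le (min_le_right _ _) using 1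
    funext i
    simp only [map_add, map_smul, Pi.add_apply, Pi.smul_apply]
    rfl

theorem sub_mem_tangentIn (hB : PerimeterSet B D) {x y : E → ℝ} (hx : x ∈ G.openCell B)
    (hy : y ∈ G.openCell B) : x - y ∈ G.tangentIn D := by
  refine ⟨fun e => by simp only [Pi.sub_apply, hx.1 e, hy.1 e], ?_⟩
  rw [SetLike.mem_coe, Submodule.mem_comap, map_sub]
  exact hB.sub_mem _ hx.2.2 _ hy.2.2

theorem tangent_eq (hB : PerimeterSet B D) (h : (G.openCell B).Nonempty) :
    G.tangent B = G.tangentIn D := by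
  obtain ⟨x, hx⟩ := h
  refine le_antisymm (Submodule.span_le.2 ?_) fun u hu => ?_
  · rintro _ ⟨y, hy, z, hz, rfl⟩
    exact G.sub_mem_tangentIn hB hy hz
  · obtain ⟨ε, hε, hxu⟩ := G.exists_small_mem_openCell hB hx hu
    have h1 := vsub_mem_vectorSpan ℝ hxu hx
    rw [vsub_eq_sub, add_sub_cancel_left] at h1
    have h2 := (G.tangent B).smul_mem ε⁻¹ h1
    rwa [smul_smul, inv_mul_cancel₀ hε.ne', one_smul] at h2

theorem finrank_tangentIn_of_isFrame (hB : PerimeterSet B D) {k : ℕ} {v : Fin k → E → ℝ}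
    (hv : G.IsFrame B v) : Module.finrank ℝ (G.tangentIn D) = k := by
  rw [← G.tangent_eq hB hv.1, ← hv.2.2, finrank_span_eq_card hv.2.1, Fintype.card_fin]

theorem span_of_isFrame (hB : PerimeterSet B D) {k : ℕ} {v : Fin k → E → ℝ}
    (hv : G.IsFrame B v) : Submodule.span ℝ (Set.range v) = G.tangentIn D := by
  rw [hv.2.2, G.tangent_eq hB hv.1]

/-! ### Graphs of type `m` -/

theorem card_edge : Fintype.card E = 2 * Nat.card G.Edge := by
  have h1 : ∀ e x, G.edgeOf x = G.edgeOf e ↔ x = e ∨ x = G.σ₁ e := by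
    intro e x
    unfold RibbonGraph.edgeOf
    rw [Quotient.eq]
    constructor
    · intro h
      obtain ⟨k, hk⟩ := (Perm.SameCycle.symm h).exists_nat_pow_eq
      rw [← hk]
      clear hk h
      induction k with
      | zero => exact Or.inl rfl
      | succ k ih =>
        rw [pow_succ', Perm.mul_apply]
        rcases ih with h | h
        · exact Or.inr (by rw [h])
        · exact Or.inl (by rw [h, G.σ₁_invol])
    · rintro (rfl | rfl)
      · exact Perm.SameCycle.refl _ _
      · exact Perm.sameCycle_apply_left.2 (Perm.SameCycle.refl _ _)
  have : Fintype G.Edge := Fintype.ofFinite _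
  rw [← Finset.card_univ, Finset.card_eq_sum_card_fiberwise (f := G.edgeOf) (t := Finset.univ)
    (fun _ _ => Finset.mem_coe.2 (Finset.mem_univ _)), Nat.card_eq_fintype_card]
  rw [Finset.sum_congr rfl (g := fun _ => 2), Finset.sum_const, Finset.card_univ, smul_eq_mul,
    mul_comm]
  intro ε _
  obtain ⟨e, rfl⟩ := Quotient.exists_rep ε
  have h2 : (Finset.univ.filter fun x => G.edgeOf x = G.edgeOf e) = {e, G.σ₁ e} := by
    ext x
    simp [h1]
  exact (congrArg Finset.card h2).trans (Finset.card_pair (G.σ₁_ne e).symm)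

theorem finrank_symmetric : 2 * Module.finrank ℝ G.symmetric = Fintype.card E := by
  rw [G.card_edge]
  congr 1
  have : Fintype G.Edge := Fintype.ofFinite _
  have h1 : LinearMap.range (LinearMap.funLeft ℝ ℝ G.edgeOf) = G.symmetric := by
    ext u
    constructor
    · rintro ⟨w, rfl⟩ e
      refine congrArg w (Quotient.sound ?_)
      exact Perm.sameCycle_apply_left.2 (Perm.SameCycle.refl _ _)
    · intro hu
      have h2 : ∀ a b : E, G.σ₁.SameCycle a b → u a = u b := by
        intro a b hab
        obtain ⟨k, rfl⟩ := hab.exists_nat_pow_eq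
        clear hab
        induction k with
        | zero => rfl
        | succ k ih => rw [pow_succ', Perm.mul_apply, hu, ih]
      exact ⟨Quotient.lift u h2, rfl⟩
  rw [← h1, LinearMap.finrank_range_of_inj
    (LinearMap.funLeft_injective_of_surjective ℝ ℝ G.edgeOf Quotient.mk_surjective),
    Module.finrank_fintype_fun_eq_card, Nat.card_eq_fintype_card]

theorem tangentIn_top : G.tangentIn ⊤ = G.symmetric := by
  rw [tangentIn, Submodule.comap_top, inf_top_eq]

omit [Fintype E] in
/-- Alternating functions vanish at the vertices of odd valence. -/
theorem alternating_eq_zero_of_odd [Finite E] {W : E → ℝ} (hW : G.toRibbonGraph.Alternating W)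
    {e : E} (h : Odd (G.valence (G.vertexOf e))) : W e = 0 := by
  have : Fintype E := Fintype.ofFinite E
  have hmem : ∀ x, x ∈ cycle G.σ₀ e ↔ G.σ₀ x ∈ cycle G.σ₀ e := fun x => by
    rw [mem_cycle, mem_cycle, Perm.sameCycle_apply_right]
  have hcard : (cycle G.σ₀ e).card = G.valence (G.vertexOf e) := by
    unfold RibbonGraph.valence
    rw [Nat.card_eq_fintype_card, Fintype.card_subtype]
    congr 1
    ext x
    rw [mem_cycle, Finset.mem_filter, G.vertexOf_eq_iff, Perm.sameCycle_comm]
    simp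
  -- the product of the values around the vertex is its own opposite
  have h1 : ∏ x ∈ cycle G.σ₀ e, W (G.σ₀ x) = ∏ x ∈ cycle G.σ₀ e, W x :=
    Finset.prod_equiv G.σ₀ hmem fun _ _ => rfl
  rw [Finset.prod_congr rfl fun x _ => hW x, Finset.prod_neg, hcard, h.neg_one_pow] at h1
  obtain ⟨x, hx, hx0⟩ := Finset.prod_eq_zero_iff.1
    (by linarith : ∏ x ∈ cycle G.σ₀ e, W x = 0)
  have h2 : ∀ k : ℕ, W ((G.σ₀ ^ k) x) = 0 := fun k => by
    induction k with
    | zero => exact hx0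
    | succ k ih => rw [pow_succ', Perm.mul_apply, hW, ih, neg_zero]
  obtain ⟨k, hk⟩ := (mem_cycle.1 hx).symm.exists_nat_pow_eq
  rw [← hk, h2]

omit [Fintype E] in
theorem IsOfType.alternating_eq_zero [Finite E] {G : EnrichedRibbonGraph g n E} {m : ℕ →₀ ℕ}
    (hG : G.IsOfType m) {W : E → ℝ} (hW : G.toRibbonGraph.Alternating W) (e : E) : W e = 0 := by
  refine G.alternating_eq_zero_of_odd hW ?_
  obtain ⟨i, hi⟩ := hG.odd (G.vertexOf e)
  exact hi ▸ ⟨i + 1, by ring⟩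

/-- On a graph of type `m` the perimeters are independent. -/
theorem IsOfType.exists_perimeters_eq {G : EnrichedRibbonGraph g n E} {m : ℕ →₀ ℕ}
    (hG : G.IsOfType m) (p : Fin n → ℝ) : ∃ u ∈ G.symmetric, G.perimeters u = p := by
  have h1 : p ∈ G.symmetric.map G.perimeters := by
    refine mem_of_forall_dual _ _ fun c hc => ?_
    have h2 := hG.alternating_eq_zero
      (G.alternating_holeFun fun u hu => hc _ (Submodule.mem_map_of_mem hu))
    refine Finset.sum_eq_zero fun i _ => ?_
    obtain ⟨h, hh⟩ := hG.mark i
    obtain ⟨e, rfl⟩ := G.exists_holeOf h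
    rw [← G.holeFun_of_marksHole (c := c) hh, h2, zero_mul]
  exact h1

theorem IsOfType.finrank_tangentIn_bot {G : EnrichedRibbonGraph g n E} {m : ℕ →₀ ℕ}
    (hG : G.IsOfType m) :
    n + Module.finrank ℝ (G.tangentIn ⊥) = Module.finrank ℝ G.symmetric := by
  have h1 := LinearMap.finrank_range_add_finrank_ker (G.perimeters.domRestrict G.symmetric)
  have h2 : LinearMap.range (G.perimeters.domRestrict G.symmetric) = ⊤ := by
    rw [eq_top_iff]
    intro p _
    obtain ⟨u, hu, hup⟩ := hG.exists_perimeters_eq p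
    exact ⟨⟨u, hu⟩, hup⟩
  rw [h2, finrank_top, Module.finrank_fin_fun, LinearMap.ker_domRestrict] at h1
  rw [← h1, tangentIn, Submodule.comap_bot, ← Submodule.map_comap_subtype,
    Submodule.finrank_map_subtype_eq]

theorem IsOfType.card {G : EnrichedRibbonGraph g n E} {m : ℕ →₀ ℕ} (hG : G.IsOfType m) :
    Fintype.card E = m.sum fun i a => (2 * i + 3) * a := by
  have : Fintype G.Vertex := Fintype.ofFinite _
  have h1 : Fintype.card E = ∑ v : G.Vertex, G.valence v := by
    rw [← Finset.card_univ, Finset.card_eq_sum_card_fiberwise (f := G.vertexOf) (t := Finset.univ)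
      (fun _ _ => Finset.mem_coe.2 (Finset.mem_univ _))]
    refine Finset.sum_congr rfl fun v _ => ?_
    rw [RibbonGraph.valence, Nat.card_eq_fintype_card, Fintype.card_subtype]
  choose i hi using hG.odd
  have h2 : ∀ v j, i v = j ↔ G.valence v = 2 * j + 3 := fun v j => by
    rw [hi]
    omega
  have h3 : ∀ j, (Finset.univ.filter fun v => i v = j).card = m j := fun j => by
    rw [← hG.count j, Nat.card_eq_fintype_card, Fintype.card_subtype]
    simp only [h2]
  rw [h1, ← Finset.sum_fiberwise_of_maps_to (s := Finset.univ) (t := m.support) (g := i)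
    fun v _ => ?_]
  · refine Finset.sum_congr rfl fun j _ => ?_
    rw [Finset.sum_congr rfl fun v hv => (h2 v j).1 (Finset.mem_filter.1 hv).2, Finset.sum_const,
      h3, smul_eq_mul, mul_comm]
  · rw [Finsupp.mem_support_iff, ← h3]
    exact (Finset.card_pos.2 ⟨v, by simp⟩).ne'

end EnrichedRibbonGraph

theorem IsContraction.exists_extend_eq [Fintype E] [Fintype E'] {G : EnrichedRibbonGraph g n E}
    {G' : EnrichedRibbonGraph g n E'} {f : E' → E} (C : IsContraction G G' f)
    {D : Submodule ℝ (Fin n → ℝ)}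
    (h : Module.finrank ℝ (G'.tangentIn D) = Module.finrank ℝ (G.tangentIn D)) {u : E → ℝ}
    (hu : u ∈ G.tangentIn D) : ∃ w ∈ G'.tangentIn D, extendLin f w = u := by
  have h1 : (G'.tangentIn D).map (extendLin f) = G.tangentIn D := by
    refine Submodule.eq_of_le_of_finrank_eq ?_ ?_
    · rintro _ ⟨w, hw, rfl⟩
      exact (C.extend_mem_tangentIn_iff w).2 hw
    · rw [← h]
      exact (Submodule.equivMapOfInjective _ (extendLin_injective C.injective) _).finrank_eq.symm
  rw [← h1] at hu
  exact hu

/-- The top form does not vanish on the cells of maximal dimension of the subcomplex of `m`.  Such a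
cell has the dimension of a cell of type `m` of which it is a face, so that extension by
zero identifies their tangent spaces; and since its vertices have odd valence, `Ω` is nondegenerate
on the tangent space of a cell of type `m` with constant perimeters. -/
theorem IsContraction.topForm_ne_zero [Fintype E] [Fintype E'] {G : EnrichedRibbonGraph g n E}
    {G' : EnrichedRibbonGraph g n E'} {f : E' → E} (C : IsContraction G G' f) {m : ℕ →₀ ℕ}
    (hG : G.IsOfType m) {D : Submodule ℝ (Fin n → ℝ)} {d q : ℕ} {s : Fin q → Fin n}
    (hdim : Module.finrank ℝ (G'.tangentIn D) = Module.finrank ℝ (G.tangentIn D))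
    (hd : Module.finrank ℝ (G.tangentIn ⊥) = d * 2) (hs : Function.Injective s)
    (hD : ∀ j, Pi.single (s j) 1 ∈ D)
    {v : Fin (d * 2 + q) → E' → ℝ} (hv : Submodule.span ℝ (Set.range v) = G'.tangentIn D) :
    G'.topForm d s v ≠ 0 := by
  have hbot : ∀ u ∈ G.tangentIn ⊥, ∃ w ∈ G'.tangentIn ⊥, extendLin f w = u := by
    intro u hu
    obtain ⟨w, -, rfl⟩ := C.exists_extend_eq hdim (G.tangentIn_bot_le D hu)
    exact ⟨w, (C.extend_mem_tangentIn_iff w).1 hu, rfl⟩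
  refine powerForm_ne_zero (S := G'.tangentIn ⊥) (T := G'.tangentIn D) _ _ G'.Omega_self
    (G'.tangentIn_bot_le D) (fun w hw h => ?_) ?_ (fun j u hu => ?_) (fun j => ?_) hv.ge
  · have h1 := G.exists_alternating_of_radical ((C.extend_mem_tangentIn_iff w).2 hw)
      fun u hu => by
        obtain ⟨u', hu', rfl⟩ := hbot u hu
        rw [C.Omega_extend hu' hw, h u' hu']
    obtain ⟨W, hW, hwW⟩ := h1
    refine extendLin_injective C.injective ?_
    rw [map_zero]
    funext e
    rw [hwW, hG.alternating_eq_zero hW, hG.alternating_eq_zero hW, sub_zero]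
    rfl
  · have h1 : (G.tangentIn ⊥) ≤ (G'.tangentIn ⊥).map (extendLin f) := fun u hu => hbot u hu
    have h2 := (Submodule.finrank_mono h1).trans (Submodule.finrank_map_le _ _)
    omega
  · exact congrFun ((Submodule.mem_bot ℝ).1 hu.2) (s j)
  · obtain ⟨u, hu, hup⟩ := hG.exists_perimeters_eq (Pi.single (s j) 1)
    obtain ⟨t, ht, rfl⟩ := C.exists_extend_eq hdim (D := D) ⟨hu, by
      rw [SetLike.mem_coe, Submodule.mem_comap, hup]
      exact hD j⟩
    refine ⟨t, ht, fun i => ?_⟩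
    rw [C.perimeters_extend] at hup
    have h1 := congrFun hup (s i)
    rw [G'.perimeters_apply] at h1
    rw [h1, Pi.single_apply]
    exact if_congr hs.eq_iff rfl rfl

end

section

variable {g n : ℕ} {E E' : Type}

namespace EnrichedRibbonGraph

theorem IsOfType.finrank_symmetric [Fintype E] {G : EnrichedRibbonGraph g n E} {m : ℕ →₀ ℕ}
    (hG : G.IsOfType m) (hm : (m.sum fun i a => (2 * i + 1) * a) + 4 = 4 * g + 2 * n) {d : ℕ}
    (hd : d + (m.sum fun i a => i * a) + 3 = 3 * g + n) :
    Module.finrank ℝ G.symmetric = d * 2 + n := by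
  have h1 := G.finrank_symmetric
  rw [hG.card] at h1
  have h2 : (m.sum fun i a => (2 * i + 3) * a) + 4 * (m.sum fun i a => i * a) =
      3 * m.sum fun i a => (2 * i + 1) * a := by
    simp only [Finsupp.sum, Finset.mul_sum, ← Finset.sum_add_distrib]
    exact Finset.sum_congr rfl fun i _ => by ring
  omega

theorem extend_sub_neg [Fintype E] (G : EnrichedRibbonGraph g n E) {B : Set (Fin n → ℝ)}
    {f : E' → E} {y : E' → ℝ} {p : E → ℝ} (hp : p ∈ G.openCell B) {e : E}
    (he : e ∉ Set.range f) : (extendLin f y - p) e < 0 := by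
  have h1 : extendLin f y e = 0 := extendByZero_of_notMem y he
  rw [Pi.sub_apply, h1]
  linarith [hp.2.1 e]

end EnrichedRibbonGraph

/-- The top form does not vanish on the cells of maximal dimension of the subcomplex. -/
theorem EnrichedRibbonGraph.InSubcomplex.topForm_ne_zero {N : ℕ}
    {G : EnrichedRibbonGraph g n (Fin N)} {m : ℕ →₀ ℕ}
    (hG : G.InSubcomplex m) (hm : (m.sum fun i a => (2 * i + 1) * a) + 4 = 4 * g + 2 * n) {d : ℕ}
    (hd : d + (m.sum fun i a => i * a) + 3 = 3 * g + n) {B : Set (Fin n → ℝ)}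
    {D : Submodule ℝ (Fin n → ℝ)} (hB : PerimeterSet B D) {q : ℕ} {s : Fin q → Fin n}
    (hs : Function.Injective s) (hD : (q = 0 ∧ D = ⊥) ∨ (q = n ∧ D = ⊤))
    {v : Fin (d * 2 + q) → Fin N → ℝ} (hv : G.IsFrame B v) : G.topForm d s v ≠ 0 := by
  obtain ⟨x, hx⟩ := hG
  have h1 := hx.finrank_symmetric hm hd
  have h2 := hx.finrank_tangentIn_bot
  refine x.isContraction.topForm_ne_zero hx (D := D) ?_ (by omega) hs ?_
    (G.span_of_isFrame hB hv)
  · rw [G.finrank_tangentIn_of_isFrame hB hv]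
    rcases hD with ⟨rfl, rfl⟩ | ⟨rfl, rfl⟩
    · omega
    · rw [x.graph.tangentIn_top, h1]
  · rcases hD with ⟨rfl, rfl⟩ | ⟨rfl, rfl⟩
    · exact fun j => j.elim0
    · exact fun j => trivial

/-! ### Contractions and tangent vectors -/

namespace IsContraction

variable {G : EnrichedRibbonGraph g n E} {G' : EnrichedRibbonGraph g n E'} {f : E' → E}

theorem comp_mem_symmetric (C : IsContraction G G' f) {u : E → ℝ} (hu : u ∈ G.symmetric) :
    u ∘ f ∈ G'.symmetric := fun a => by
  rw [Function.comp_apply, C.σ₁, hu, Function.comp_apply]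

variable [Fintype E] [Fintype E'] {D : Submodule ℝ (Fin n → ℝ)} {B : Set (Fin n → ℝ)}

/-- The tangent space of a face consists of the tangent vectors that vanish on the
collapsed edges. -/
theorem exists_extend_of_eq_zero (C : IsContraction G G' f) {u : E → ℝ} (hu : u ∈ G.tangentIn D)
    (h : ∀ e, e ∉ Set.range f → u e = 0) : ∃ w ∈ G'.tangentIn D, extendLin f w = u := by
  have h1 : extendLin f (u ∘ f) = u := by
    funext e
    by_cases he : e ∈ Set.range f
    · obtain ⟨a, rfl⟩ := he
      exact extendByZero_apply C.injective _ a
    · rw [h e he]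
      exact extendByZero_of_notMem _ he
  exact ⟨_, (C.extend_mem_tangentIn_iff _).1 (by rwa [h1]), h1⟩

/-- If the perimeters are positive, no hole is bordered by collapsed edges only. -/
theorem exists_sameCycle (C : IsContraction G G' f) (hB : PerimeterSet B D)
    (h : (G.openCell B).Nonempty) (h' : (G'.openCell B).Nonempty) (z : E) :
    ∃ b, G.σinf.SameCycle (f b) z := by
  obtain ⟨ℓ, -, hℓ, hℓB⟩ := h
  obtain ⟨ℓ', -, -, hℓB'⟩ := h'
  obtain ⟨i, hi, -⟩ := G.hole_marked (G.holeOf z)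
  have h1 : 0 < G.perimeter i ℓ := by
    rw [G.perimeter_eq_sum_cycle hi]
    exact Finset.sum_pos (fun e _ => hℓ e) ⟨z, mem_cycle.2 (Perm.SameCycle.refl _ _)⟩
  have h2 : 0 < G'.perimeter i ℓ' := hB.pos _ hℓB _ hℓB' i h1
  obtain ⟨a, ha⟩ : ∃ a, G'.MarksHole i a := by
    by_contra hcon
    push Not at hcon
    rw [G'.perimeter_apply, Finset.sum_eq_zero fun e _ => if_neg (hcon e)] at h2
    exact lt_irrefl _ h2
  refine ⟨a, (G.holeOf_eq_iff _ _).1 ?_⟩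
  have h3 := (C.marksHole i a).1 ha
  rw [EnrichedData.MarksHole, hi] at h3
  exact (Sum.inl.inj h3).symm

theorem extend_sub_mem_tangentIn (C : IsContraction G G' f) (hB : PerimeterSet B D) {y : E' → ℝ}
    {p : E → ℝ} (hy : y ∈ G'.openCell B) (hp : p ∈ G.openCell B) :
    extendLin f y - p ∈ G.tangentIn D := by
  refine ⟨G.symmetric.sub_mem ((C.extend_symmetric_iff y).2 hy.1) hp.1, ?_⟩
  rw [SetLike.mem_coe, Submodule.mem_comap, map_sub, C.perimeters_extend]
  exact hB.sub_mem _ hy.2.2 _ hp.2.2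

/-- If the face has codimension one, a linear form that vanishes on the tangent space of the
face has the same sign at all outward pointing vectors. -/
theorem sign_eq (C : IsContraction G G' f)
    (hdim : Module.finrank ℝ (G.tangentIn D) = Module.finrank ℝ (G'.tangentIn D) + 1)
    (φ : (E → ℝ) →ₗ[ℝ] ℝ) (hφ : ∀ w ∈ G'.tangentIn D, φ (extendLin f w) = 0) {u u' : E → ℝ}
    (hu : u ∈ G.tangentIn D) (hu' : u' ∈ G.tangentIn D)
    (hneg : ∀ e, e ∉ Set.range f → u e < 0) (hneg' : ∀ e, e ∉ Set.range f → u' e < 0) :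
    SignType.sign (φ u) = SignType.sign (φ u') := by
  set S := (G'.tangentIn D).map (extendLin f) with hS
  have hfin : Module.finrank ℝ S = Module.finrank ℝ (G'.tangentIn D) :=
    (Submodule.equivMapOfInjective _ (extendLin_injective C.injective) _).finrank_eq.symm
  have hle : S ≤ G.tangentIn D := by
    rintro _ ⟨w, hw, rfl⟩
    exact (C.extend_mem_tangentIn_iff w).2 hw
  obtain ⟨z, hz⟩ : ∃ z, z ∉ Set.range f := by
    by_contra hcon
    push Not at hcon
    have : G.tangentIn D ≤ S := fun u hu =>
      C.exists_extend_of_eq_zero hu fun e he => absurd (hcon e) he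
    have := Submodule.finrank_mono this
    omega
  have hz0 : ∀ w ∈ S, w z = 0 := by
    rintro _ ⟨w, -, rfl⟩
    exact extendByZero_of_notMem w hz
  have huS : u ∉ S := fun h => (hneg z hz).ne (hz0 u h)
  have htop : S ⊔ Submodule.span ℝ {u} = G.tangentIn D := by
    refine Submodule.eq_of_le_of_finrank_le (sup_le hle ?_) ?_
    · rwa [Submodule.span_singleton_le_iff_mem]
    · have h1 : S < S ⊔ Submodule.span ℝ {u} :=
        lt_of_le_of_ne le_sup_left fun h => huS (h ▸ (le_sup_right (a := S)
          (Submodule.mem_span_singleton_self u)))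
      have := Submodule.finrank_lt_finrank_of_lt h1
      omega
  rw [← htop, Submodule.mem_sup] at hu'
  obtain ⟨w, hw, _, hc, rfl⟩ := hu'
  obtain ⟨c, rfl⟩ := Submodule.mem_span_singleton.1 hc
  have hcpos : 0 < c := by
    have h1 := hneg' z hz
    rw [Pi.add_apply, hz0 w hw, Pi.smul_apply, smul_eq_mul, zero_add] at h1
    by_contra hcon
    nlinarith [hneg z hz]
  obtain ⟨w, hw, rfl⟩ := hw
  rw [map_add, hφ w hw, zero_add, map_smul, smul_eq_mul, sign_mul, sign_pos hcpos, one_mul]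

end IsContraction

/-! ### Mirror contractions -/

/-- Two contractions onto `G'` with the same edges, such that the functions `spread W` of
alternating `W` have opposite values on the collapsed edges, and the same collapsed edges border a
hole of `G'`. -/
structure IsMirror (G G₁ : EnrichedRibbonGraph g n E) (G' : EnrichedRibbonGraph g n E')
    (f : E' → E) : Prop where
  left : IsContraction G G' f
  right : IsContraction G₁ G' f
  σ₁ : ∀ e, G₁.σ₁ e = G.σ₁ e
  spread : ∀ W, G'.toRibbonGraph.Alternating W → ∀ z, z ∉ Set.range f →
    spread G₁.σinf f W z = -spread G.σinf f W z
  meets : ∀ z, (∃ b, G₁.σinf.SameCycle (f b) z) ↔ ∃ b, G.σinf.SameCycle (f b) z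

theorem Over.isMirror_rotate {G' : EnrichedRibbonGraph g n E'} [Nonempty E'] {τ : Perm E'}
    (x : Over G') (H : IsTurn G'.toRibbonGraph τ) :
    IsMirror x.graph (x.rotate H).graph G' x.map where
  left := x.isContraction
  right := (x.rotate H).isContraction
  σ₁ _ := rfl
  spread _ hW _ hz := x.spread_rotate_alternating H hW hz
  meets z := by
    have h1 := not_congr ((x.isRotation H).disjoint_iff z)
    have key : ∀ p : Perm (Fin x.N), (¬ ∀ y, p.SameCycle z y → y ∉ x.map '' Set.univ) ↔
        ∃ b, p.SameCycle (x.map b) z := by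
      intro p
      push Not
      constructor
      · rintro ⟨_, h, b, -, rfl⟩
        exact ⟨b, h.symm⟩
      · rintro ⟨b, h⟩
        exact ⟨_, h.symm, b, trivial, rfl⟩
    rw [key, key] at h1
    exact h1

namespace IsMirror

variable {G G₁ : EnrichedRibbonGraph g n E} {G' : EnrichedRibbonGraph g n E'} {f : E' → E}

theorem symm (M : IsMirror G G₁ G' f) : IsMirror G₁ G G' f where
  left := M.right
  right := M.left
  σ₁ e := (M.σ₁ e).symm
  spread W hW z hz := by rw [M.spread W hW z hz, neg_neg]
  meets z := (M.meets z).symm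

theorem symmetric_eq (M : IsMirror G G₁ G' f) : G₁.symmetric = G.symmetric := by
  ext u
  rw [G.mem_symmetric, G₁.mem_symmetric]
  simp only [M.σ₁]

variable [Fintype E] [Fintype E'] {D : Submodule ℝ (Fin n → ℝ)} {B : Set (Fin n → ℝ)}

/-- A relation between the perimeters of `G'` changes sign between mirror contractions. -/
theorem sum_mul_perimeter (M : IsMirror G G₁ G' f) (hC : ∀ z, ∃ b, G.σinf.SameCycle (f b) z)
    {c : Fin n → ℝ} (hc : ∀ w ∈ G'.symmetric, ∑ i, c i * G'.perimeter i w = 0) {u u₁ : E → ℝ}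
    (hu : u ∈ G.symmetric) (hu₁ : u₁ ∈ G.symmetric) (h : ∀ e, e ∉ Set.range f → u₁ e = u e) :
    ∑ i, c i * G₁.perimeter i u₁ = -∑ i, c i * G.perimeter i u := by
  have hC₁ := fun z => (M.meets z).2 (hC z)
  have h0 : ∀ u ∈ G.symmetric, ∑ a, G'.holeFun c a * u (f a) = 0 := fun u hu => by
    rw [← hc _ (M.left.comp_mem_symmetric hu), G'.sum_mul_perimeter]
    rfl
  rw [M.left.sum_mul_perimeter hC, M.right.sum_mul_perimeter hC₁, h0 u hu, h0 u₁ hu₁, zero_add,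
    zero_add, ← Finset.sum_neg_distrib]
  refine Finset.sum_congr rfl fun e _ => ?_
  split_ifs with he
  · rw [neg_zero]
  · rw [M.spread _ (G'.alternating_holeFun hc) e he, h e he]
    ring

/-- Tangent vectors can be transferred between mirror contractions, keeping the lengths of the
collapsed edges: the change of the perimeters can be compensated by a tangent vector of `G'`, as
every obstruction comes from a relation between the perimeters of `G'`, for which it is zero. -/
theorem exists_transfer (M : IsMirror G G₁ G' f) (hC : ∀ z, ∃ b, G.σinf.SameCycle (f b) z)
    {u : E → ℝ} (hu : u ∈ G.tangentIn D) :
    ∃ u₁ ∈ G₁.tangentIn D, ∀ e, e ∉ Set.range f → u₁ e = u e := by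
  have h1 : G₁.perimeters u ∈ D ⊔ G'.symmetric.map G'.perimeters := by
    refine mem_of_forall_dual _ _ fun c hc => ?_
    have h2 := M.sum_mul_perimeter hC (c := c) (fun w hw =>
      hc _ (Submodule.mem_sup_right (Submodule.mem_map_of_mem hw))) hu.1 hu.1 fun _ _ => rfl
    refine h2.trans ?_
    rw [neg_eq_zero]
    exact hc _ (Submodule.mem_sup_left hu.2)
  obtain ⟨δ, hδ, _, ⟨w, hw, rfl⟩, h2⟩ := Submodule.mem_sup.1 h1
  refine ⟨u - extendLin f w, ⟨?_, ?_⟩, fun e he => ?_⟩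
  · rw [M.symmetric_eq]
    exact G.symmetric.sub_mem hu.1 ((M.left.extend_symmetric_iff w).2 hw)
  · rw [SetLike.mem_coe, Submodule.mem_comap, map_sub, M.right.perimeters_extend, ← h2,
      add_sub_cancel_right]
    exact hδ
  · have h3 : extendLin f w e = 0 := extendByZero_of_notMem w he
    rw [Pi.sub_apply, h3, sub_zero]

theorem finrank_le (M : IsMirror G G₁ G' f) (hC : ∀ z, ∃ b, G.σinf.SameCycle (f b) z) :
    Module.finrank ℝ (G.tangentIn D) ≤ Module.finrank ℝ (G₁.tangentIn D) := by
  let r : (E → ℝ) →ₗ[ℝ] ({e // e ∉ Set.range f} → ℝ) := LinearMap.funLeft ℝ ℝ Subtype.val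
  have hker : ∀ {F : EnrichedRibbonGraph g n E}, IsContraction F G' f →
      Module.finrank ℝ (LinearMap.ker (r.domRestrict (F.tangentIn D))) =
        Module.finrank ℝ (G'.tangentIn D) := by
    intro F C
    rw [LinearMap.ker_domRestrict, ← Submodule.finrank_map_subtype_eq,
      Submodule.map_comap_subtype]
    have h1 : F.tangentIn D ⊓ LinearMap.ker r = (G'.tangentIn D).map (extendLin f) := by
      refine le_antisymm ?_ ?_
      · rintro u ⟨hu, hr⟩
        exact C.exists_extend_of_eq_zero hu fun e he => congrFun (LinearMap.mem_ker.1 hr) ⟨e, he⟩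
      · rintro _ ⟨w, hw, rfl⟩
        refine ⟨(C.extend_mem_tangentIn_iff w).2 hw, LinearMap.mem_ker.2 ?_⟩
        funext e
        exact extendByZero_of_notMem w e.2
    rw [h1]
    exact (Submodule.equivMapOfInjective _ (extendLin_injective C.injective) _).finrank_eq.symm
  have hrange : LinearMap.range (r.domRestrict (G.tangentIn D)) ≤
      LinearMap.range (r.domRestrict (G₁.tangentIn D)) := by
    rintro _ ⟨⟨u, hu⟩, rfl⟩
    obtain ⟨u₁, hu₁, h⟩ := M.exists_transfer hC hu
    exact ⟨⟨u₁, hu₁⟩, funext fun e => h e e.2⟩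
  have h1 := LinearMap.finrank_range_add_finrank_ker (r.domRestrict (G.tangentIn D))
  have h2 := LinearMap.finrank_range_add_finrank_ker (r.domRestrict (G₁.tangentIn D))
  rw [hker M.left] at h1
  rw [hker M.right] at h2
  have h3 := Submodule.finrank_mono hrange
  omega

theorem finrank_eq (M : IsMirror G G₁ G' f) (hC : ∀ z, ∃ b, G.σinf.SameCycle (f b) z) :
    Module.finrank ℝ (G₁.tangentIn D) = Module.finrank ℝ (G.tangentIn D) :=
  le_antisymm (M.symm.finrank_le fun z => (M.meets z).2 (hC z)) (M.finrank_le hC)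

/-- Mirror contractions have cells that are both nonempty or both empty: starting from a point of
the cell of `G'`, one moves along the transfer of an inward pointing vector. -/
theorem openCell_nonempty (M : IsMirror G G₁ G' f) (hB : PerimeterSet B D)
    (h : (G.openCell B).Nonempty) (h' : (G'.openCell B).Nonempty) : (G₁.openCell B).Nonempty := by
  have hC := M.left.exists_sameCycle hB h h'
  obtain ⟨p, hp⟩ := h
  obtain ⟨y, hy⟩ := h'
  obtain ⟨u, hu, hup⟩ := M.exists_transfer hC (M.left.extend_sub_mem_tangentIn hB hy hp)
  have hu' : -u ∈ G₁.tangentIn D := neg_mem hu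
  obtain ⟨ε₁, hε₁, h1⟩ := exists_small_of_pos y (-(u ∘ f)) hy.2.1
  obtain ⟨ε₂, hε₂, h2⟩ := hB.small _ hy.2.2 _ hu'.2
  have hε := lt_min hε₁ hε₂
  refine ⟨extendLin f y + min ε₁ ε₂ • -u, ?_, fun e => ?_, ?_⟩
  · exact G₁.symmetric.add_mem ((M.right.extend_symmetric_iff y).2 hy.1)
      (G₁.symmetric.smul_mem _ hu'.1)
  · by_cases he : e ∈ Set.range f
    · obtain ⟨a, rfl⟩ := he
      have h3 := h1 _ hε.le (min_le_left _ _) a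
      have h4 : extendLin f y (f a) = y a := extendByZero_apply M.left.injective y a
      rw [Pi.add_apply, h4]
      exact h3
    · have h3 := G.extend_sub_neg (y := y) hp he
      have h4 : extendLin f y e = 0 := extendByZero_of_notMem y he
      rw [Pi.add_apply, h4, zero_add, Pi.smul_apply, smul_eq_mul, Pi.neg_apply, hup e he]
      exact mul_pos hε (neg_pos.2 h3)
  · convert h2 _ hε.le (min_le_right _ _) using 1
    funext i
    change G₁.perimeters _ i = _
    rw [map_add, M.right.perimeters_extend, map_smul]
    rfl

end IsMirror

end

section

/-! ### Adapted families and evaluation of top forms -/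

section LinearAlgebra

variable {V : Type} [AddCommGroup V] [Module ℝ V]

/-- An independent family in `T` can be completed to a spanning family of `T`, indexed by all but
one of the elements of a set with one more element than the dimension of `T`. -/
theorem exists_extension [FiniteDimensional ℝ V] {α I : Type} [Fintype α] [Fintype I]
    (T : Submodule ℝ V) {i₀ : I} {ι : α → I} (hι : Function.Injective ι)
    (hi₀ : ∀ a, ι a ≠ i₀) {x : α → V} (hx : ∀ a, x a ∈ T) (hxi : LinearIndependent ℝ x)
    (hcard : Fintype.card I = Module.finrank ℝ T + 1) :
    ∃ y : I → V, (∀ a, y (ι a) = x a) ∧ (∀ i, i ≠ i₀ → y i ∈ T) ∧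
      T ≤ Submodule.span ℝ (y '' {i₀}ᶜ) := by
  set X := Submodule.span ℝ (Set.range x) with hX
  have hXT : X ≤ T := Submodule.span_le.2 (by rintro _ ⟨a, rfl⟩; exact hx a)
  obtain ⟨Q, hQ⟩ := Submodule.exists_isCompl (X.comap T.subtype)
  have h1 := Submodule.finrank_add_eq_of_isCompl hQ
  have h2 : Module.finrank ℝ (X.comap T.subtype) = Fintype.card α := by
    rw [← Submodule.finrank_map_subtype_eq, Submodule.map_comap_subtype, inf_eq_right.2 hXT,
      hX, finrank_span_eq_card hxi]
  set A : Finset I := (insert i₀ (Finset.univ.image ι))ᶜ with hA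
  have h3 : Module.finrank ℝ Q = Fintype.card A := by
    rw [Fintype.card_coe, hA, Finset.card_compl, Finset.card_insert_of_notMem (by simpa using hi₀),
      Finset.card_image_of_injective _ hι, Finset.card_univ]
    omega
  let b : Module.Basis A ℝ Q := (Module.finBasisOfFinrankEq ℝ Q h3).reindex
    (Fintype.equivFin A).symm
  have hAmem : ∀ i, i ∈ A ↔ i ≠ i₀ ∧ ∀ a, ι a ≠ i := fun i => by simp [hA]
  let y : I → V := fun i => if h : ∃ a, ι a = i then x h.choose else
    if h : i ∈ A then ((b ⟨i, h⟩ : T) : V) else 0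
  have hy1 : ∀ a, y (ι a) = x a := fun a => by
    have h : ∃ a', ι a' = ι a := ⟨a, rfl⟩
    simp only [y, dif_pos h]
    exact congrArg x (hι h.choose_spec)
  have hy2 : ∀ i (h : i ∈ A), y i = ((b ⟨i, h⟩ : T) : V) := fun i h => by
    have h' : ¬ ∃ a, ι a = i := fun ⟨a, ha⟩ => ((hAmem i).1 h).2 a ha
    simp only [y, dif_neg h', dif_pos h]
  refine ⟨y, hy1, fun i _ => ?_, fun w hw => ?_⟩
  · by_cases h : ∃ a, ι a = i
    · obtain ⟨a, rfl⟩ := h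
      rw [hy1]
      exact hx a
    · by_cases h' : i ∈ A
      · rw [hy2 i h']
        exact Subtype.coe_prop _
      · simp only [y, dif_neg h, dif_neg h']
        exact T.zero_mem
  · have h4 : (⟨w, hw⟩ : T) ∈ X.comap T.subtype ⊔ Q := by rw [hQ.sup_eq_top]; trivial
    obtain ⟨p, hp, r, hr, hpr⟩ := Submodule.mem_sup.1 h4
    have h5 : w = (p : V) + (r : V) := by
      rw [← Submodule.coe_add, hpr]
    rw [h5]
    refine Submodule.add_mem _ ?_ ?_
    · refine Submodule.span_mono ?_ (show (p : V) ∈ X from hp)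
      rintro _ ⟨a, rfl⟩
      exact ⟨ι a, hi₀ a, hy1 a⟩
    · have h6 : (r : V) = ∑ i, b.repr ⟨r, hr⟩ i • ((b i : T) : V) := by
        have h7 := congrArg (fun z : Q => ((z : T) : V)) (b.sum_repr ⟨r, hr⟩)
        simp only [Submodule.coe_sum, Submodule.coe_smul] at h7
        exact h7.symm
      rw [h6]
      refine Submodule.sum_mem _ fun i _ => Submodule.smul_mem _ _ (Submodule.subset_span ?_)
      exact ⟨i, ((hAmem i).1 i.2).1, hy2 i i.2⟩

theorem map_update_add_of_mem_span {I : Type} [DecidableEq I] (F : V [⋀^I]→ₗ[ℝ] ℝ) (X : I → V)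
    (i₀ : I) (u : V) {t : V} (ht : t ∈ Submodule.span ℝ (X '' {i₀}ᶜ)) :
    F (Function.update X i₀ (u + t)) = F (Function.update X i₀ u) := by
  rw [F.map_update_add, add_eq_left]
  have h1 : Submodule.span ℝ (X '' {i₀}ᶜ) ≤
      LinearMap.ker (F.toMultilinearMap.toLinearMap X i₀) := by
    refine Submodule.span_le.2 ?_
    rintro _ ⟨i, hi, rfl⟩
    exact F.map_update_self X (Ne.symm hi)
  exact h1 ht

/-- The form `F` with the first argument fixed, as a linear function of this argument. -/
def frontForm {k j : ℕ} (F : V [⋀^Fin k]→ₗ[ℝ] ℝ) (hj : j + 1 = k) :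
    V →ₗ[ℝ] V [⋀^Fin j]→ₗ[ℝ] ℝ :=
  (F.domDomCongr (finCongr hj.symm)).curryLeft

theorem frontForm_apply {k j : ℕ} (F : V [⋀^Fin k]→ₗ[ℝ] ℝ) (hj : j + 1 = k) (u : V)
    (v : Fin j → V) :
    frontForm F hj u v = F fun i => (Fin.cons u v : Fin (j + 1) → V) (Fin.cast hj.symm i) := rfl

/-- Taking an index `i₀` of the factors of `ω^d ∧ η_0 ∧ ⋯ ∧ η_{q-1}` as the first one identifies
`powerForm` with `wedgeForm` up to a sign. -/
theorem exists_frontForm_eq {d q j : ℕ} (hj : j + 1 = d * 2 + q) (i₀ : (Fin d × Fin 2) ⊕ Fin q) :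
    ∃ (ε : ℝ) (e : Fin j → (Fin d × Fin 2) ⊕ Fin q), Set.range e = {i₀}ᶜ ∧
      ∀ {V : Type} [AddCommGroup V] [Module ℝ V] (ω : V →ₗ[ℝ] V →ₗ[ℝ] ℝ) (η : Fin q → V →ₗ[ℝ] ℝ)
        (X : (Fin d × Fin 2) ⊕ Fin q → V) (u : V),
        frontForm (powerForm d q ω η) hj u (X ∘ e) =
          ε * wedgeForm d q ω η (Function.update X i₀ u) := by
  set δ := (Equiv.sumCongr finProdFinEquiv (Equiv.refl (Fin q))).trans
    (finSumFinEquiv (m := d * 2) (n := q)) with hδ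
  let e₀ : Fin (j + 1) ≃ (Fin d × Fin 2) ⊕ Fin q := (finCongr hj).trans δ.symm
  let e₁ : Fin (j + 1) ≃ (Fin d × Fin 2) ⊕ Fin q := e₀.trans (Equiv.swap (e₀ 0) i₀)
  have he₁ : e₁ 0 = i₀ := by simp [e₁]
  let σ : Perm ((Fin d × Fin 2) ⊕ Fin q) := δ.trans ((finCongr hj.symm).trans e₁)
  refine ⟨((Perm.sign σ : ℤ) : ℝ), fun i => e₁ i.succ, ?_, fun ω η X u => ?_⟩
  · ext i
    rw [Set.mem_compl_iff, Set.mem_singleton_iff]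
    constructor
    · rintro ⟨k, rfl⟩ h
      rw [← he₁] at h
      exact Fin.succ_ne_zero _ (e₁.injective h)
    · intro h
      obtain ⟨k, rfl⟩ := e₁.surjective i
      refine Fin.cases (fun h => absurd he₁ h) (fun k _ => ⟨k, rfl⟩) k h
  · have h1 : (Fin.cons u (X ∘ fun i => e₁ i.succ) : Fin (j + 1) → _) =
        Function.update X i₀ u ∘ e₁ := by
      funext k
      refine Fin.cases ?_ (fun k => ?_) k
      · simp [he₁]
      · have : e₁ k.succ ≠ i₀ := by
          rw [← he₁]
          exact fun h => Fin.succ_ne_zero _ (e₁.injective h)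
        simp [Function.update_of_ne this]
    rw [frontForm_apply, powerForm_apply, h1]
    have h2 := (wedgeForm d q ω η).map_perm (Function.update X i₀ u) σ
    rw [Units.smul_def, zsmul_eq_mul] at h2
    exact h2

end LinearAlgebra

variable {g n : ℕ} {E E' : Type}

namespace IsMirror

variable {G G₁ : EnrichedRibbonGraph g n E} {G' : EnrichedRibbonGraph g n E'} {f : E' → E}
  [Fintype E] [Fintype E'] {D : Submodule ℝ (Fin n → ℝ)} {d q j : ℕ} {s : Fin q → Fin n}
  {u u₁ : E → ℝ}

/-- If the forms `dp_{s k}` are independent on the tangent space of `G'`, then `Ω` has a radical on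
their common kernel, which is of odd dimension; the pairing of `u` with an element of the radical
changes sign between mirror contractions. -/
theorem exists_wedgeForm_neg_of_surjective (M : IsMirror G G₁ G' f)
    (hs : ∀ δ ∈ D, (∀ k, δ (s k) = 0) → δ = 0) (hj : j + 1 = d * 2 + q)
    (hsurj : (G'.tangentIn D).map (LinearMap.pi fun k => G'.perimeter (s k)) = ⊤)
    (hbot : Module.finrank ℝ (G'.tangentIn ⊥) + q = j)
    (hu : u ∈ G.tangentIn D) (hu₁ : u₁ ∈ G₁.tangentIn D)
    (h : ∀ e, e ∉ Set.range f → u₁ e = u e) :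
    ∃ (i₀ : (Fin d × Fin 2) ⊕ Fin q) (y : (Fin d × Fin 2) ⊕ Fin q → E' → ℝ),
      G'.tangentIn D ≤ Submodule.span ℝ (y '' {i₀}ᶜ) ∧
      wedgeForm d q G₁.Omega (fun k => G₁.perimeter (s k))
        (Function.update (fun i => extendLin f (y i)) i₀ u₁) =
      -wedgeForm d q G.Omega (fun k => G.perimeter (s k))
        (Function.update (fun i => extendLin f (y i)) i₀ u) := by
  set S := G'.tangentIn ⊥ with hS
  have hST : S ≤ G'.tangentIn D := G'.tangentIn_bot_le D
  have hsub : ∀ c : Fin q → ℝ, ∃ t ∈ G'.tangentIn D, ∀ k, G'.perimeter (s k) t = c k := by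
    intro c
    obtain ⟨t, ht, htc⟩ := (hsurj ▸ Submodule.mem_top : c ∈ (G'.tangentIn D).map _)
    exact ⟨t, ht, fun k => congrFun htc k⟩
  obtain ⟨ρ, hρ, hρ0, hrad⟩ := exists_radical_of_odd G'.Omega
    (fun x y => G'.Omega_swap x y) S ⟨d - 1, by omega⟩
  obtain ⟨W, hW, hρW⟩ := G'.exists_alternating_of_radical hρ hrad
  let a₀ : Fin d := ⟨0, by omega⟩
  have h01 : ((a₀, 1) : Fin d × Fin 2) ≠ (a₀, 0) := by simp
  obtain ⟨yl, hyl, hylS, hspan⟩ := exists_extension S (i₀ := ((a₀, 0) : Fin d × Fin 2))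
    (ι := fun _ : Unit => (a₀, 1)) (fun _ _ _ => rfl) (fun _ => h01) (x := fun _ => ρ)
    (fun _ => hρ) (linearIndependent_unique_iff.2 hρ0) (by simp; omega)
  choose t htT htc using fun k : Fin q => hsub (Pi.single k 1)
  set i₀ : (Fin d × Fin 2) ⊕ Fin q := Sum.inl (a₀, 0) with hi₀
  set y : (Fin d × Fin 2) ⊕ Fin q → E' → ℝ := Sum.elim yl t with hy
  have hspanT : G'.tangentIn D ≤ Submodule.span ℝ (y '' {i₀}ᶜ) := by
    intro w hw
    have h1 : w - ∑ k, G'.perimeter (s k) w • t k ∈ S := by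
      have h2 : w - ∑ k, G'.perimeter (s k) w • t k ∈ G'.tangentIn D :=
        Submodule.sub_mem _ hw (Submodule.sum_mem _ fun k _ => Submodule.smul_mem _ _ (htT k))
      refine ⟨h2.1, ?_⟩
      rw [SetLike.mem_coe, Submodule.mem_comap, Submodule.mem_bot]
      refine hs _ h2.2 fun k => ?_
      rw [G'.perimeters_apply, map_sub, map_sum]
      simp [htc, Pi.single_apply]
    rw [← sub_add_cancel w (∑ k, G'.perimeter (s k) w • t k)]
    refine Submodule.add_mem _ (Submodule.span_mono ?_ (hspan h1)) (Submodule.sum_mem _ fun k _ =>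
      Submodule.smul_mem _ _ (Submodule.subset_span ⟨Sum.inr k, by simp [hi₀], rfl⟩))
    rintro _ ⟨p, hp, rfl⟩
    exact ⟨Sum.inl p, by simpa [hi₀] using hp, rfl⟩
  refine ⟨i₀, y, hspanT, ?_⟩
  -- the value of the form only depends on `u` modulo the tangent space of `G'`
  have adjust : ∀ {F : EnrichedRibbonGraph g n E}, IsContraction F G' f → ∀ {u : E → ℝ},
      u ∈ F.tangentIn D → ∃ u' ∈ F.tangentIn ⊥, (∀ e, e ∉ Set.range f → u' e = u e) ∧
        wedgeForm d q F.Omega (fun k => F.perimeter (s k))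
          (Function.update (fun i => extendLin f (y i)) i₀ u) =
        wedgeForm d q F.Omega (fun k => F.perimeter (s k))
          (Function.update (fun i => extendLin f (y i)) i₀ u') := by
    intro F C u hu
    obtain ⟨w, hw, hwc⟩ := hsub fun k => -F.perimeter (s k) u
    have h1 : u + extendLin f w ∈ F.tangentIn D :=
      Submodule.add_mem _ hu ((C.extend_mem_tangentIn_iff w).2 hw)
    refine ⟨u + extendLin f w, ⟨h1.1, ?_⟩, fun e he => ?_, ?_⟩
    · rw [SetLike.mem_coe, Submodule.mem_comap, Submodule.mem_bot]
      refine hs _ h1.2 fun k => ?_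
      rw [F.perimeters_apply, map_add, C.perimeter_extend, hwc, add_neg_cancel]
    · have h2 : extendLin f w e = 0 := extendByZero_of_notMem w he
      rw [Pi.add_apply, h2, add_zero]
    · refine (map_update_add_of_mem_span _ _ _ _ ?_).symm
      have h2 := Submodule.mem_map_of_mem (f := extendLin f) (hspanT hw)
      rw [Submodule.map_span, Set.image_image] at h2
      exact h2
  obtain ⟨v, hv, hvu, hv'⟩ := adjust M.left hu
  obtain ⟨v₁, hv₁, hvu₁, hv₁'⟩ := adjust M.right hu₁
  have hvv : ∀ e, e ∉ Set.range f → v₁ e = v e := fun e he => by rw [hvu₁ e he, h e he, hvu e he]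
  rw [hv', hv₁']
  have hX : ∀ (v : E → ℝ) i, i ≠ i₀ →
      Function.update (fun i => extendLin f (y i)) i₀ v i = extendLin f (y i) :=
    fun v i hi => Function.update_of_ne hi _ _
  have hX0 : ∀ v : E → ℝ, Function.update (fun i => extendLin f (y i)) i₀ v i₀ = v :=
    fun v => Function.update_self _ _ _
  have hη : ∀ {F : EnrichedRibbonGraph g n E}, IsContraction F G' f → ∀ {v : E → ℝ},
      v ∈ F.tangentIn ⊥ → ∀ k p, F.perimeter (s k)
        (Function.update (fun i => extendLin f (y i)) i₀ v (Sum.inl p)) = 0 := by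
    intro F C v hv k p
    by_cases hp : (Sum.inl p : (Fin d × Fin 2) ⊕ Fin q) = i₀
    · rw [hp, hX0]
      exact congrFun ((Submodule.mem_bot ℝ).1 hv.2) (s k)
    · rw [hX v _ hp, C.perimeter_extend]
      exact congrFun ((Submodule.mem_bot ℝ).1
        (hylS p fun h => hp (by rw [h])).2) (s k)
  rw [wedgeForm_eq_mul _ _ _ _ _ (hη M.right hv₁), wedgeForm_eq_mul _ _ _ _ _ (hη M.left hv),
    ← neg_mul]
  have hpair : ∀ {F : EnrichedRibbonGraph g n E}, IsContraction F G' f →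
      ∀ v : E → ℝ, ∀ p p' : Fin d × Fin 2, p ≠ (a₀, 0) → p' ≠ (a₀, 0) → F.Omega
        (Function.update (fun i => extendLin f (y i)) i₀ v (Sum.inl p))
        (Function.update (fun i => extendLin f (y i)) i₀ v (Sum.inl p')) =
        G'.Omega (yl p) (yl p') := by
    intro F C v p p' hp hp'
    rw [hX v _ (by simpa [hi₀] using hp), hX v _ (by simpa [hi₀] using hp')]
    exact C.Omega_extend (hylS p hp) (hylS p' hp')
  congr 1
  · refine pfaffian_neg (p := (a₀, 0)) (q := (a₀, 1)) h01.symm (fun _ _ => G.Omega_swap _ _)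
      (fun _ _ => G₁.Omega_swap _ _) (fun p p' hp hp' => ?_) (fun p hp => ?_) ?_
    · rw [hpair M.right v₁ p p' hp hp', hpair M.left v p p' hp hp']
    · rw [hpair M.left v _ p h01 hp, hyl (), G'.Omega_swap, hrad _ (hylS p hp), neg_zero]
    · rw [← hi₀, hX0, hX0, hX _ _ (by simp [hi₀]), hX _ _ (by simp [hi₀])]
      have h1 : y (Sum.inl (a₀, 1)) = ρ := hyl ()
      rw [h1, M.right.Omega_extend_alternating hv₁ hW hρW,
        M.left.Omega_extend_alternating hv hW hρW, ← mul_neg, ← Finset.sum_neg_distrib]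
      congr 1
      refine Finset.sum_congr rfl fun e _ => ?_
      split_ifs with he
      · rw [neg_zero]
      · rw [M.spread W hW e he, hvv e he, mul_neg]
  · congr 1
    ext i k
    simp only [Matrix.of_apply]
    rw [hX _ _ (by simp [hi₀]), hX _ _ (by simp [hi₀]), M.right.perimeter_extend,
      M.left.perimeter_extend]

/-- If the forms `dp_k` are dependent on the tangent space of `G'`, then the value at `u` of a
combination that vanishes on this space changes sign between mirror contractions. -/
theorem exists_wedgeForm_neg_of_relation (M : IsMirror G G₁ G' f)
    (hC : ∀ z, ∃ b, G.σinf.SameCycle (f b) z) (hj : j + 1 = d * 2 + q)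
    (hT : Module.finrank ℝ G'.symmetric = j) {c : Fin q → ℝ} (hc : c ≠ 0)
    (hcT : ∀ w ∈ G'.symmetric, ∑ k, c k * G'.perimeter (s k) w = 0)
    (hbot : d * 2 ≤ Module.finrank ℝ (G'.tangentIn ⊥))
    (hu : u ∈ G.symmetric) (hu₁ : u₁ ∈ G.symmetric)
    (h : ∀ e, e ∉ Set.range f → u₁ e = u e) :
    ∃ (i₀ : (Fin d × Fin 2) ⊕ Fin q) (y : (Fin d × Fin 2) ⊕ Fin q → E' → ℝ),
      G'.symmetric ≤ Submodule.span ℝ (y '' {i₀}ᶜ) ∧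
      wedgeForm d q G₁.Omega (fun k => G₁.perimeter (s k))
        (Function.update (fun i => extendLin f (y i)) i₀ u₁) =
      -wedgeForm d q G.Omega (fun k => G.perimeter (s k))
        (Function.update (fun i => extendLin f (y i)) i₀ u) := by
  obtain ⟨k₀, hk₀⟩ := Function.ne_iff.1 hc
  obtain ⟨x', hx'⟩ := exists_linearIndependent_of_le_finrank hbot
  set x : Fin d × Fin 2 → E' → ℝ := fun p => (x' (finProdFinEquiv p) : E' → ℝ) with hxdef
  have hxS : ∀ p, x p ∈ G'.tangentIn ⊥ := fun p => Subtype.coe_prop _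
  have hxi : LinearIndependent ℝ x :=
    (hx'.map' (G'.tangentIn ⊥).subtype (Submodule.ker_subtype _)).comp _ finProdFinEquiv.injective
  set i₀ : (Fin d × Fin 2) ⊕ Fin q := Sum.inr k₀ with hi₀
  obtain ⟨y, hyx, hyT, hspan⟩ := exists_extension G'.symmetric (i₀ := i₀) (ι := Sum.inl)
    Sum.inl_injective (fun _ => by simp [hi₀]) (fun p => (hxS p).1) hxi (by simp; omega)
  refine ⟨i₀, y, hspan, ?_⟩
  have hX : ∀ (v : E → ℝ) i, i ≠ i₀ →
      Function.update (fun i => extendLin f (y i)) i₀ v i = extendLin f (y i) :=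
    fun v i hi => Function.update_of_ne hi _ _
  have hX0 : ∀ v : E → ℝ, Function.update (fun i => extendLin f (y i)) i₀ v i₀ = v :=
    fun v => Function.update_self _ _ _
  have hinl : ∀ p, (Sum.inl p : (Fin d × Fin 2) ⊕ Fin q) ≠ i₀ := fun p => by simp [hi₀]
  have hη : ∀ {F : EnrichedRibbonGraph g n E}, IsContraction F G' f → ∀ (v : E → ℝ) k p,
      F.perimeter (s k) (Function.update (fun i => extendLin f (y i)) i₀ v (Sum.inl p)) = 0 := by
    intro F C v k p
    rw [hX v _ (hinl p), C.perimeter_extend, hyx]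
    exact congrFun ((Submodule.mem_bot ℝ).1 (hxS p).2) (s k)
  rw [wedgeForm_eq_mul _ _ _ _ _ (hη M.right u₁), wedgeForm_eq_mul _ _ _ _ _ (hη M.left u),
    ← mul_neg]
  congr 1
  · congr 1
    funext p p'
    rw [hX _ _ (hinl p), hX _ _ (hinl p'), hX _ _ (hinl p), hX _ _ (hinl p'), hyx, hyx,
      M.right.Omega_extend (hxS p) (hxS p'), M.left.Omega_extend (hxS p) (hxS p')]
  · -- the two matrices only differ in the row `k₀`, and `c` annihilates the sum of these rows
    set A : Matrix (Fin q) (Fin q) ℝ := Matrix.of fun i k => G.perimeter (s k)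
      (Function.update (fun i => extendLin f (y i)) i₀ u (Sum.inr i)) with hA
    set A₁ : Matrix (Fin q) (Fin q) ℝ := Matrix.of fun i k => G₁.perimeter (s k)
      (Function.update (fun i => extendLin f (y i)) i₀ u₁ (Sum.inr i)) with hA₁
    have hrow : ∀ i, i ≠ k₀ → ∀ k, A i k = G'.perimeter (s k) (y (Sum.inr i)) ∧
        A₁ i k = G'.perimeter (s k) (y (Sum.inr i)) := by
      intro i hi k
      have hne : (Sum.inr i : (Fin d × Fin 2) ⊕ Fin q) ≠ i₀ := by simpa [hi₀] using hi
      simp only [hA, hA₁, Matrix.of_apply]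
      rw [hX _ _ hne, hX _ _ hne, M.left.perimeter_extend, M.right.perimeter_extend]
      exact ⟨rfl, rfl⟩
    have hA' : A.updateRow k₀ (A₁ k₀) = A₁ := by
      ext i k
      by_cases hi : i = k₀
      · rw [hi, Matrix.updateRow_self]
      · rw [Matrix.updateRow_ne hi, (hrow i hi k).1, (hrow i hi k).2]
    have h1 : (A.updateRow k₀ (A k₀ + A₁ k₀)).det = A.det + A₁.det := by
      rw [Matrix.det_updateRow_add, Matrix.updateRow_eq_self, hA']
    have h2 : (A.updateRow k₀ (A k₀ + A₁ k₀)).det = 0 := by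
      refine Matrix.exists_mulVec_eq_zero_iff.1 ⟨c, hc, funext fun i => ?_⟩
      rw [Matrix.mulVec, dotProduct, Pi.zero_apply]
      by_cases hi : i = k₀
      · -- the relation, as a relation between all the perimeters
        let c' : Fin n → ℝ := fun l => ∑ k, if s k = l then c k else 0
        have hc' : ∀ F : Fin n → ℝ, ∑ l, c' l * F l = ∑ k, c k * F (s k) := fun F => by
          simp only [c', Finset.sum_mul]
          rw [Finset.sum_comm]
          refine Finset.sum_congr rfl fun k _ => ?_
          simp only [ite_mul, zero_mul, Finset.sum_ite_eq, Finset.mem_univ, if_true]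
        have h3 := M.sum_mul_perimeter hC (c := c')
          (fun w hw => (hc' fun i => G'.perimeter i w).trans (hcT w hw)) hu hu₁ h
        rw [hc' fun i => G₁.perimeter i u₁, hc' fun i => G.perimeter i u] at h3
        have h4 : ∀ k, A k₀ k = G.perimeter (s k) u := fun k => by
          simp only [hA, Matrix.of_apply]
          rw [← hi₀, hX0]
        have h5 : ∀ k, A₁ k₀ k = G₁.perimeter (s k) u₁ := fun k => by
          simp only [hA₁, Matrix.of_apply]
          rw [← hi₀, hX0]
        rw [hi, Matrix.updateRow_self]
        simp only [Pi.add_apply, h4, h5, add_mul, Finset.sum_add_distrib]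
        rw [Finset.sum_congr rfl fun k _ => mul_comm (G.perimeter (s k) u) (c k),
          Finset.sum_congr rfl fun k _ => mul_comm (G₁.perimeter (s k) u₁) (c k), h3]
        ring
      · rw [Matrix.updateRow_ne hi, ← hcT _ (hyT (Sum.inr i) (by simpa [hi₀] using hi))]
        exact Finset.sum_congr rfl fun k _ => by rw [(hrow i hi k).1, mul_comm]
    linarith

/-- The top forms of mirror contractions induce opposite orientations of a face of
codimension one. -/
theorem topForm_neg (M : IsMirror G G₁ G' f) (hC : ∀ z, ∃ b, G.σinf.SameCycle (f b) z)
    (hD : q = 0 ∨ D = ⊤) (hs : ∀ δ ∈ D, (∀ k, δ (s k) = 0) → δ = 0) (hj : j + 1 = d * 2 + q)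
    (hT : Module.finrank ℝ (G'.tangentIn D) = j) (hu : u ∈ G.tangentIn D)
    (hu₁ : u₁ ∈ G₁.tangentIn D) (h : ∀ e, e ∉ Set.range f → u₁ e = u e)
    {v : Fin j → E' → ℝ} (hv : ∀ a, v a ∈ G'.tangentIn D) :
    frontForm (G₁.topForm d s) hj u₁ (fun a => extendLin f (v a)) =
      -frontForm (G.topForm d s) hj u (fun a => extendLin f (v a)) := by
  set ψ : (E' → ℝ) →ₗ[ℝ] (Fin q → ℝ) := LinearMap.pi fun k => G'.perimeter (s k) with hψ
  have hker : Module.finrank ℝ ((G'.tangentIn D).map ψ) +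
      Module.finrank ℝ (G'.tangentIn ⊥) = j := by
    have h1 := LinearMap.finrank_range_add_finrank_ker (ψ.domRestrict (G'.tangentIn D))
    rw [LinearMap.range_domRestrict, LinearMap.ker_domRestrict, hT,
      ← Submodule.finrank_map_subtype_eq, Submodule.map_comap_subtype] at h1
    have h2 : G'.tangentIn D ⊓ LinearMap.ker ψ = G'.tangentIn ⊥ := by
      refine le_antisymm ?_ fun w hw => ⟨G'.tangentIn_bot_le D hw, ?_⟩
      · rintro w ⟨hw, hw'⟩
        refine ⟨hw.1, ?_⟩
        rw [SetLike.mem_coe, Submodule.mem_comap, Submodule.mem_bot]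
        exact hs _ hw.2 fun k => congrFun (LinearMap.mem_ker.1 hw') k
      · rw [SetLike.mem_coe, LinearMap.mem_ker]
        funext k
        exact congrFun ((Submodule.mem_bot ℝ).1 hw.2) (s k)
    rwa [h2] at h1
  obtain ⟨i₀, y, hspan, hy⟩ : ∃ (i₀ : (Fin d × Fin 2) ⊕ Fin q)
      (y : (Fin d × Fin 2) ⊕ Fin q → E' → ℝ),
      G'.tangentIn D ≤ Submodule.span ℝ (y '' {i₀}ᶜ) ∧
      wedgeForm d q G₁.Omega (fun k => G₁.perimeter (s k))
        (Function.update (fun i => extendLin f (y i)) i₀ u₁) =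
      -wedgeForm d q G.Omega (fun k => G.perimeter (s k))
        (Function.update (fun i => extendLin f (y i)) i₀ u) := by
    by_cases hsurj : (G'.tangentIn D).map ψ = ⊤
    · refine M.exists_wedgeForm_neg_of_surjective hs hj hsurj ?_ hu hu₁ h
      rw [hsurj, finrank_top, Module.finrank_fin_fun] at hker
      omega
    · have h1 := Submodule.finrank_lt hsurj
      rw [Module.finrank_fin_fun] at h1
      obtain rfl : D = ⊤ := hD.resolve_left (by omega)
      obtain ⟨w, -, hw⟩ := SetLike.exists_of_lt (lt_top_iff_ne_top.2 hsurj)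
      have h2 := mt (mem_of_forall_dual ((G'.tangentIn ⊤).map ψ) w) hw
      push Not at h2
      obtain ⟨c, hc, hcw⟩ := h2
      rw [G'.tangentIn_top] at hT hc ⊢
      rw [G.tangentIn_top] at hu
      rw [G₁.tangentIn_top, M.symmetric_eq] at hu₁
      refine M.exists_wedgeForm_neg_of_relation hC hj hT (c := c) ?_ (fun w hw => ?_) (by omega)
        hu hu₁ h
      · rintro rfl
        exact hcw (by simp)
      · exact hc _ (Submodule.mem_map_of_mem hw)
  obtain ⟨ε, e, he, hε⟩ := exists_frontForm_eq hj i₀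
  have h1 : ∀ F : EnrichedRibbonGraph g n E, ∀ u : E → ℝ, frontForm (F.topForm d s) hj u
      (fun a => extendLin f (y (e a))) = ε * wedgeForm d q F.Omega (fun k => F.perimeter (s k))
        (Function.update (fun i => extendLin f (y i)) i₀ u) := fun F u =>
    hε F.Omega (fun k => F.perimeter (s k)) (fun i => extendLin f (y i)) u
  -- both sides are determined by their values on a spanning family
  let Φ : (E' → ℝ) [⋀^Fin j]→ₗ[ℝ] ℝ := (frontForm (G₁.topForm d s) hj u₁ +
    frontForm (G.topForm d s) hj u).compLinearMap (extendLin f)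
  have hΦ : ∀ v, Φ v = frontForm (G₁.topForm d s) hj u₁ (fun a => extendLin f (v a)) +
    frontForm (G.topForm d s) hj u (fun a => extendLin f (v a)) := fun v => rfl
  have h0 : Φ (fun a => y (e a)) = 0 := by
    rw [hΦ, h1, h1, hy]
    ring
  have h2 : Φ v = 0 := by
    by_contra hcon
    refine alternating_ne_zero_of_mem_span Φ (v := fun a => y (e a)) (fun a => ?_) hcon h0
    have h3 := hspan (hv a)
    rw [← he, ← Set.range_comp] at h3
    exact h3
  rw [hΦ] at h2
  linarith

end IsMirror

end

section

variable {g n : ℕ}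

/-! ### Cancellation in the boundary -/

namespace Over

variable {N' j k : ℕ} {G' : EnrichedRibbonGraph g n (Fin N')} {B : Set (Fin n → ℝ)}
  {D : Submodule ℝ (Fin n → ℝ)}

/-- The contribution of a contraction onto `G'` to the boundary coefficient of `c` at `G'`. -/
def boundaryTerm (x : Over G') (c : CellularChain g n B k) (hj : j + 1 = k)
    (v : Fin j → Fin N' → ℝ) : ℚ :=
  if h : (G'.openCell B).Nonempty ∧ (x.graph.openCell B).Nonempty ∧
      Module.finrank ℝ (x.graph.tangent B) = k then
    c.coeff x.graph (fun i =>
      (Fin.cons (extendByZero x.map h.1.some - h.2.1.some)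
        (fun a => extendByZero x.map (v a)) : Fin (j + 1) → Fin x.N → ℝ) (Fin.cast hj.symm i))
  else 0

theorem boundaryCoeff_eq (c : CellularChain g n B k) (hj : j + 1 = k) (v : Fin j → Fin N' → ℝ) :
    c.boundaryCoeff hj G' v = ∑ᶠ x : Star G', x.out.boundaryTerm c hj v := rfl

variable {d q : ℕ} {s : Fin q → Fin n} {m : ℕ →₀ ℕ} {hj : j + 1 = d * 2 + q}
  {v : Fin j → Fin N' → ℝ}

/-- The contribution of a contraction can be computed with any outward pointing tangent vector. -/
theorem boundaryTerm_eq (x : Over G') (hB : PerimeterSet B D) (hv : G'.IsFrame B v)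
    (hne : (x.graph.openCell B).Nonempty)
    (hfin : Module.finrank ℝ (x.graph.tangentIn D) = d * 2 + q) {u : Fin x.N → ℝ}
    (hu : u ∈ x.graph.tangentIn D) (hneg : ∀ e, e ∉ Set.range x.map → u e < 0) :
    x.boundaryTerm (wittenChain g n m B d s) hj v =
      if x.graph.InSubcomplex m then ((SignType.sign (frontForm (x.graph.topForm d s) hj u
        fun a => extendLin x.map (v a)) : SignType) : ℚ) else 0 := by
  have hfin' := G'.finrank_tangentIn_of_isFrame hB hv
  have h : (G'.openCell B).Nonempty ∧ (x.graph.openCell B).Nonempty ∧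
      Module.finrank ℝ (x.graph.tangent B) = d * 2 + q :=
    ⟨hv.1, hne, by rw [x.graph.tangent_eq hB hne, hfin]⟩
  rw [boundaryTerm, dif_pos h]
  change (if x.graph.InSubcomplex m then ((SignType.sign (frontForm (x.graph.topForm d s) hj
    (extendLin x.map h.1.some - h.2.1.some) fun a => extendLin x.map (v a)) : SignType) : ℚ)
    else 0) = _
  let φ : (Fin x.N → ℝ) →ₗ[ℝ] ℝ :=
    { toFun := fun u => frontForm (x.graph.topForm d s) hj u fun a => extendLin x.map (v a)
      map_add' := fun u u' => by rw [map_add]; rfl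
      map_smul' := fun r u => by rw [map_smul]; rfl }
  have h1 := x.isContraction.sign_eq (D := D) (by omega) φ (fun w hw => ?_)
    (x.isContraction.extend_sub_mem_tangentIn hB h.1.some_mem h.2.1.some_mem) hu
    (fun e he => x.graph.extend_sub_neg h.2.1.some_mem he) hneg
  · exact if_congr Iff.rfl (congrArg (fun σ : SignType => (σ : ℚ)) h1) rfl
  · -- a tangent vector of the face is a combination of the frame
    rw [← G'.span_of_isFrame hB hv] at hw
    change φ.comp (extendLin x.map) w = 0
    have h2 : Submodule.span ℝ (Set.range v) ≤ LinearMap.ker (φ.comp (extendLin x.map)) := by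
      refine Submodule.span_le.2 ?_
      rintro _ ⟨a, rfl⟩
      rw [SetLike.mem_coe, LinearMap.mem_ker]
      change frontForm (x.graph.topForm d s) hj (extendLin x.map (v a))
        (fun a => extendLin x.map (v a)) = 0
      rw [frontForm_apply]
      refine AlternatingMap.map_eq_zero_of_eq _ _ (i := Fin.cast hj 0) (j := Fin.cast hj a.succ)
        (by simp) fun h => ?_
      exact (Fin.succ_ne_zero a).symm (Fin.cast_injective hj h)
    exact h2 hw

theorem boundaryTerm_eq_zero (x : Over G') (hB : PerimeterSet B D) {c : CellularChain g n B k}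
    {hj : j + 1 = k} (h : ¬ ((x.graph.openCell B).Nonempty ∧
      Module.finrank ℝ (x.graph.tangentIn D) = k)) : x.boundaryTerm c hj v = 0 :=
  dif_neg fun h' => h ⟨h'.2.1, by rw [← x.graph.tangent_eq hB h'.2.1, h'.2.2]⟩

/-- Mirror contractions have opposite contributions. -/
theorem boundaryTerm_rotate [Nonempty (Fin N')] {τ : Perm (Fin N')} (x : Over G')
    (H : IsTurn G'.toRibbonGraph τ) (hB : PerimeterSet B D) (hD : q = 0 ∨ D = ⊤)
    (hs : ∀ δ ∈ D, (∀ k, δ (s k) = 0) → δ = 0) (hv : G'.IsFrame B v) :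
    (x.rotate H).boundaryTerm (wittenChain g n m B d s) hj v =
      -x.boundaryTerm (wittenChain g n m B d s) hj v := by
  have M := x.isMirror_rotate H
  by_cases hne : (x.graph.openCell B).Nonempty
  · have hC := x.isContraction.exists_sameCycle hB hne hv.1
    have hne' := M.openCell_nonempty hB hne hv.1
    by_cases hfin : Module.finrank ℝ (x.graph.tangentIn D) = d * 2 + q
    · obtain ⟨y, hy⟩ := hv.1
      obtain ⟨p, hp⟩ := hne
      have hu := x.isContraction.extend_sub_mem_tangentIn hB hy hp
      have hneg := fun e (he : e ∉ Set.range x.map) => x.graph.extend_sub_neg (y := y) hp he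
      obtain ⟨u₁, hu₁, h⟩ := M.exists_transfer hC hu
      rw [x.boundaryTerm_eq hB hv ⟨p, hp⟩ hfin hu hneg,
        (x.rotate H).boundaryTerm_eq hB hv hne' ((M.finrank_eq hC).trans hfin) hu₁
          fun e he => by rw [h e he]; exact hneg e he]
      have h2 : frontForm ((x.rotate H).graph.topForm d s) hj u₁ (fun a => extendLin x.map (v a)) =
          -frontForm (x.graph.topForm d s) hj (extendLin x.map y - p)
            (fun a => extendLin x.map (v a)) :=
        M.topForm_neg hC hD hs hj (G'.finrank_tangentIn_of_isFrame hB hv) hu hu₁ h fun a => by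
          rw [← G'.span_of_isFrame hB hv]
          exact Submodule.subset_span ⟨a, rfl⟩
      have h3 := congrArg (fun r : ℝ => ((SignType.sign r : SignType) : ℚ)) h2
      simp only [Left.sign_neg, SignType.coe_neg] at h3
      by_cases hm : x.graph.InSubcomplex m
      · rw [if_pos hm, if_pos ((x.inSubcomplex_rotate H m).2 hm)]
        exact h3
      · rw [if_neg hm, if_neg fun h => hm ((x.inSubcomplex_rotate H m).1 h), neg_zero]
    · rw [x.boundaryTerm_eq_zero hB fun h => hfin h.2, (x.rotate H).boundaryTerm_eq_zero hB
        fun h => hfin ((M.finrank_eq hC).symm.trans h.2), neg_zero]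
  · rw [x.boundaryTerm_eq_zero hB fun h => hne h.1, (x.rotate H).boundaryTerm_eq_zero hB
      fun h => hne (M.symm.openCell_nonempty hB h.1 hv.1), neg_zero]

/-- Isomorphic contractions have equal contributions. -/
theorem Iso.boundaryTerm_eq {x y : Over G'} (h : x.Iso y) (hB : PerimeterSet B D)
    (hv : G'.IsFrame B v) : x.boundaryTerm (wittenChain g n m B d s) hj v =
      y.boundaryTerm (wittenChain g n m B d s) hj v := by
  obtain ⟨h, hi, hm⟩ := h
  have hsymm : ∀ {z w : Over G'} {h : Fin w.N ≃ Fin z.N}, IsIso z.graph w.graph h →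
      ∀ u, extendLin h u ∈ z.graph.symmetric ↔ u ∈ w.graph.symmetric := by
    intro z w h hi u
    rw [z.graph.mem_symmetric, w.graph.mem_symmetric, ← h.forall_congr_right]
    refine forall_congr' fun e => ?_
    rw [extendLin_apply, ← hi.σ₁, extendByZero_equiv, extendByZero_equiv]
  have hperim : ∀ {z w : Over G'} {h : Fin w.N ≃ Fin z.N}, IsIso z.graph w.graph h →
      ∀ u, z.graph.perimeters (extendLin h u) = w.graph.perimeters u :=
    fun hi u => funext fun i => hi.perimeter i u
  have hcell : ∀ {z w : Over G'} {h : Fin w.N ≃ Fin z.N}, IsIso z.graph w.graph h →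
      ∀ p, p ∈ w.graph.openCell B → extendLin h p ∈ z.graph.openCell B := by
    intro z w h hi p hp
    refine ⟨(hsymm hi p).2 hp.1, fun e => ?_, ?_⟩
    · obtain ⟨a, rfl⟩ := h.surjective e
      rw [extendLin_apply, extendByZero_equiv]
      exact hp.2.1 a
    · have h1 := hp.2.2
      change w.graph.perimeters p ∈ B at h1
      rw [← hperim hi] at h1
      exact h1
  have hle : ∀ {z w : Over G'} {h : Fin w.N ≃ Fin z.N}, IsIso z.graph w.graph h →
      Module.finrank ℝ (w.graph.tangentIn D) ≤ Module.finrank ℝ (z.graph.tangentIn D) := by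
    intro z w h hi
    rw [(Submodule.equivMapOfInjective _ (extendLin_injective h.injective)
      (w.graph.tangentIn D)).finrank_eq]
    refine Submodule.finrank_mono ?_
    rintro _ ⟨u, hu, rfl⟩
    refine ⟨(hsymm hi u).2 hu.1, ?_⟩
    rw [SetLike.mem_coe, Submodule.mem_comap, hperim hi]
    exact hu.2
  have hfin := le_antisymm (hle hi.symm) (hle hi)
  by_cases hy : (y.graph.openCell B).Nonempty ∧
      Module.finrank ℝ (y.graph.tangentIn D) = d * 2 + q
  · obtain ⟨⟨p, hp⟩, hyd⟩ := hy
    obtain ⟨y₀, hy₀⟩ := hv.1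
    have hext : ∀ w : Fin N' → ℝ, extendLin h (extendLin y.map w) = extendLin x.map w := by
      intro w
      funext e
      obtain ⟨a, rfl⟩ := h.surjective e
      rw [extendLin_apply, extendByZero_equiv, extendLin_apply, extendLin_apply]
      by_cases ha : a ∈ Set.range y.map
      · obtain ⟨b, rfl⟩ := ha
        rw [hm, extendByZero_apply y.isContraction.injective,
          extendByZero_apply x.isContraction.injective]
      · rw [extendByZero_of_notMem w ha, extendByZero_of_notMem w]
        rintro ⟨b, hb⟩
        exact ha ⟨b, h.injective (by rw [hm, hb])⟩
    have hp' := hcell hi p hp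
    rw [y.boundaryTerm_eq hB hv ⟨p, hp⟩ hyd
        (y.isContraction.extend_sub_mem_tangentIn hB hy₀ hp)
        (fun e he => y.graph.extend_sub_neg hp he),
      x.boundaryTerm_eq hB hv ⟨_, hp'⟩ (hfin.trans hyd)
        (x.isContraction.extend_sub_mem_tangentIn hB hy₀ hp')
        (fun e he => x.graph.extend_sub_neg hp' he)]
    refine if_congr (hi.inSubcomplex m) ?_ rfl
    have h1 := hi.topForm d s fun i => (Fin.cons (extendLin y.map y₀ - p)
      (fun a => extendLin y.map (v a)) : Fin (j + 1) → Fin y.N → ℝ) (Fin.cast hj.symm i)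
    rw [frontForm_apply, frontForm_apply, ← h1]
    congr 3
    funext i
    generalize Fin.cast hj.symm i = i'
    rw [← extendLin_apply]
    refine Fin.cases ?_ (fun a => ?_) i'
    · rw [Fin.cons_zero, Fin.cons_zero, map_sub, hext]
    · rw [Fin.cons_succ, Fin.cons_succ, hext]
  · rw [y.boundaryTerm_eq_zero hB hy, x.boundaryTerm_eq_zero hB]
    rintro ⟨⟨p, hp⟩, hxd⟩
    exact hy ⟨⟨_, hcell hi.symm p hp⟩, hfin.symm.trans hxd⟩

end Over

/-- The chain of the subcomplex of `m` is a cycle: the turn of the vertices of `G'` is a permutation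
of the star of the cell of `G'` that changes the signs of all contributions. -/
theorem isCycle_wittenChain {B : Set (Fin n → ℝ)} {D : Submodule ℝ (Fin n → ℝ)} {d q : ℕ}
    {s : Fin q → Fin n} {m : ℕ →₀ ℕ} (hB : PerimeterSet B D) (h0 : (0 : Fin n → ℝ) ∉ B)
    (hD : q = 0 ∨ D = ⊤) (hs : ∀ δ ∈ D, (∀ k, δ (s k) = 0) → δ = 0) :
    (wittenChain g n m B d s).IsCycle := by
  intro j hj N' G' v hv
  have : Nonempty (Fin N') := by
    by_contra hcon
    rw [not_nonempty_iff] at hcon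
    obtain ⟨ℓ, -, -, hℓ⟩ := hv.1
    refine h0 ?_
    convert hℓ using 1
    funext i
    rw [G'.perimeter_apply]
    simp
  let T : Star G' → ℚ := Quot.lift
    (fun x => x.boundaryTerm (wittenChain g n m B d s) hj v) fun _ _ h => h.boundaryTerm_eq hB hv
  have hT : ∀ x : Star G', x.out.boundaryTerm (wittenChain g n m B d s) hj v = T x := fun x =>
    congrArg T (Quot.out_eq x)
  have hneg : ∀ x, T (Over.rotateStar G'.isTurn_turn x) = -T x := by
    rintro ⟨x⟩
    exact x.boundaryTerm_rotate G'.isTurn_turn hB hD hs hv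
  rw [Over.boundaryCoeff_eq, finsum_congr hT]
  have h1 := finsum_comp_equiv (Over.rotateStar G'.isTurn_turn) (f := T)
  rw [finsum_congr hneg, finsum_neg_distrib] at h1
  linarith

end

end WittenCycle

end

theorem mainTheorem4 (g n : ℕ) (hn : 0 < n) (hgn : 2 < 2 * g + n) (m : ℕ →₀ ℕ)
    (hm : (m.sum fun i a => (2 * i + 1) * a) + 4 = 4 * g + 2 * n)
    (d : ℕ) (hd : d + (m.sum fun i a => i * a) + 3 = 3 * g + n) :
    (∀ p : Fin n → ℝ, 0 ≤ p → p ≠ 0 →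
      (∀ (N : ℕ) (G : WittenCycle.EnrichedRibbonGraph g n (Fin N))
        (v : Fin (d * 2) → Fin N → ℝ), G.InSubcomplex m → G.IsFrame {p} v →
        G.topForm d (Fin.elim0 : Fin 0 → Fin n) v ≠ 0) ∧
      (WittenCycle.wittenSlice g n m d p).IsCycle) ∧
    (∀ (N : ℕ) (G : WittenCycle.EnrichedRibbonGraph g n (Fin N))
      (v : Fin (d * 2 + n) → Fin N → ℝ), G.InSubcomplex m →
      G.IsFrame {p : Fin n → ℝ | ∀ i, 0 < p i} v →
      G.topForm d (fun i : Fin n => i) v ≠ 0) ∧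
    (WittenCycle.wittenTotal g n m d).IsCycle := by
  refine ⟨fun p _ hp => ⟨fun N G v hG hv => ?_, ?_⟩, fun N G v hG hv => ?_, ?_⟩
  · exact hG.topForm_ne_zero hm hd (WittenCycle.perimeterSet_singleton p) (q := 0)
      (fun i => i.elim0) (Or.inl ⟨rfl, rfl⟩) hv
  · exact WittenCycle.isCycle_wittenChain (q := 0) (WittenCycle.perimeterSet_singleton p)
      (fun h => hp h.symm) (Or.inl rfl) fun δ hδ _ => hδ
  · exact hG.topForm_ne_zero hm hd WittenCycle.perimeterSet_pos Function.injective_id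
      (Or.inr ⟨rfl, rfl⟩) hv
  · exact WittenCycle.isCycle_wittenChain WittenCycle.perimeterSet_pos
      (fun h => lt_irrefl _ (h ⟨0, hn⟩)) (Or.inr rfl) fun δ _ h => funext h
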